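/- **Setting.** All functions and coefficients are complex valued. Let $T_n,U_n$ be the Chebyshev polynomials of the first and second kind and $\omega(x)=\sqrt{1-x^2}$. For $s\in\mathbb R$, let $U^s$ be the space of formal series $u=\sum_{n\ge0}u_nU_n$ with $\|u\|_{U^s}^2=\frac12\sum_n(1+n^2)^s|u_n|^2<\infty$; put $U^{\infty}=\bigcap_sU^s$ and $U^{-\infty}=\bigcup_sU^s$. A continuous function $f$ on $[-1,1]$ is identified with the series with coefficients $\frac2\pi\int_{-1}^1fU_m\omega\,dx$. An operator on $U^{-\infty}$ is a linear map $A:U^{-\infty}\to U^{-\infty}$ that is continuous in the sense that for every $s$ there is $t$ such that $A$ maps $U^s$ continuously into $U^t$. Let $H^{-\infty}_{per}=\bigcup_sH^s_{per}$ be the space of $2\pi$-periodic distributions, $\mathcal Fu(n)$ the Fourier coefficients of $u$, $e_n(\theta)=e^{in\theta}$, and let $\mathcal S:U^{-\infty}\to H^{-\infty}_{per}$ be the linear map with $\mathcal S\sum_nu_nU_n=\sum_nu_n\sin((n+1)\theta)$ (so $\mathcal Su(\theta)=\sin\theta\,u(\cos\theta)$ for functions). *Periodic operators.* $\Sigma^\alpha$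 ($\alpha\in\mathbb R$) is the set of $\sigma:\mathbb T_{2\pi}\times\mathbb Z\to\mathbb C$ that extend to a function in $C^\infty(\mathbb T_{2\pi}\times\mathbb R)$ satisfying $|\partial_\theta^j\partial_\xi^k\sigma(\theta,\xi)|\le C_{j,k}(1+|\xi|)^{\alpha-k}$ for all $j,k\in\mathbb N$. A PPDO of order $\alpha$ is an operator $\mathrm{Op}(\sigma)u=\sum_{n\in\mathbb Z}\sigma(\cdot,n)\,\mathcal Fu(n)\,e_n$ on $H^{-\infty}_{per}$ with $\sigma\in\Sigma^\alpha$; its symbol is recovered as $\sigma_{\tilde A}(\theta,n)=\overline{e_n(\theta)}\,(\tilde Ae_n)(\theta)$. The symbol $\sigma$ is elliptic of order $\alpha$ if there are $C>0$ and $M$ with $|\sigma(\theta,n)|\ge C(1+|n|)^\alpha$ for all $\theta$ and all $|n|\ge M$; a PPDO of order $\alpha$ is elliptic if its symbol is elliptic of order $\alpha$. For a PPDO $\tilde A$ put $\tilde\sigma(\theta,n)=\frac12\big(\sigma_{\tilde A}(\theta,n)+\sigma_{\tilde A}(-\theta,-n)\big)$ and, for $x\in[-1,1]$ and $n\in\mathbb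 N$, $$a_1(\tilde A)(x,n)=\tfrac12\big(\tilde\sigma(\arccos x,n)+\tilde\sigma(\arccos x,-n)\big),\qquad a_2(\tilde A)(x,n)=\frac{\tilde\sigma(\arccos x,n)-\tilde\sigma(\arccos x,-n)}{2i\sqrt{1-x^2}},$$ the latter being extended by continuity to $x=\pm1$. *Operators on the segment.* For functions $a_1(x,n),a_2(x,n)$ that are $C^\infty$ in $x\in[-1,1]$ ($n\ge1$) put $$\tilde\sigma(a_1,a_2)(\theta,n)=a_1(\cos\theta,|n|)+i\sin\theta\,\mathrm{sign}(n)\,a_2(\cos\theta,|n|)\quad(n\ne0),\qquad\tilde\sigma(a_1,a_2)(\theta,0)=0.$$ Write $(a_1,a_2)\in S_U^\alpha$ if $\tilde\sigma(a_1,a_2)\in\Sigma^\alpha$, and $S_U^{-\infty}=\bigcap_\alpha S_U^\alpha$. An operator $A$ on $U^{-\infty}$ has the pair of symbols $(a_1,a_2)$ if $AU_{n-1}=a_1(\cdot,n)U_{n-1}+a_2(\cdot,n)T_n$ for all $n\ge1$. *Operators on the curve.* Let $\Gamma$ be a smooth simple open curve (arc) in $\mathbb R^2$, parametrized by a $C^\infty$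 diffeomorphism $r:[-1,1]\to\Gamma$ with $|r'|=|\Gamma|/2$, where $|\Gamma|$ is its length, and let $R_\Gamma u=u\circ r$. Let $U^s(\Gamma)$ be the space of formal series $v=\sum_nv_nR_\Gamma^{-1}U_n$ with $R_\Gamma v:=\sum_nv_nU_n\in U^s$, normed by $\|v\|_{U^s(\Gamma)}^2=\frac{|\Gamma|^2}2\|R_\Gamma v\|_{U^s}^2$, and $U^{-\infty}(\Gamma)=\bigcup_sU^s(\Gamma)$. An operator $A$ on $U^{-\infty}(\Gamma)$ has the pair of symbols $(a_1,a_2)$ if $R_\Gamma AR_\Gamma^{-1}$ has it. $Op(S_U^\alpha(\Gamma))$ (resp. $Op(S_U^{-\infty}(\Gamma))$) is the set of those having a pair of symbols in $S_U^\alpha$ (resp. $S_U^{-\infty}$). $A\in Op(S_U^\alpha(\Gamma))$ is elliptic (of order $\alpha$) if it has a pair of symbols $(a_1,a_2)\in S_U^\alpha$ such that $\tilde\sigma(a_1,a_2)$ is elliptic of order $\alpha$. $A=B+U_{-\infty}$ means $A-B\in Op(S_U^{-\infty}(\Gamma))$. **Statement.** For all $\alpha,\beta\in\mathbb R$: (i)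 If $A\in Op(S_U^\alpha(\Gamma))$, then for all $s\in\mathbb R$, $A$ maps $U^s(\Gamma)$ continuously into $U^{s-\alpha}(\Gamma)$. (ii) If $A\in Op(S_U^\alpha(\Gamma))$ and $B\in Op(S_U^\beta(\Gamma))$, then $AB\in Op(S_U^{\alpha+\beta}(\Gamma))$. (iii) If $A$ and $B$ have the pairs of symbols $(a_1,a_2)\in S_U^\alpha$ and $(b_1,b_2)\in S_U^\beta$ respectively, then $AB$ has the pair of symbols $(a_1(\tilde C),a_2(\tilde C))\in S_U^{\alpha+\beta}$, where $\tilde C=\mathrm{Op}(\tilde\sigma(a_1,a_2))\,\mathrm{Op}(\tilde\sigma(b_1,b_2))$. (iv) If $A\in Op(S_U^\alpha(\Gamma))$ and $B\in Op(S_U^\beta(\Gamma))$, then $AB-BA\in Op(S_U^{\alpha+\beta-1}(\Gamma))$. (v) An operator $A\in Op(S_U^\alpha(\Gamma))$ is elliptic if and only if there is an elliptic PPDO $\tilde A$ of order $\alpha$ such that $\mathcal SR_\Gamma AR_\Gamma^{-1}=\tilde A\mathcal S$ in $U^\infty$. In this case there is an elliptic operator $B\in Op(S_U^{-\alpha}(\Gamma))$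 such that $BA=I_d+U_{-\infty}$ and $AB=I_d+U_{-\infty}$. -/

import Mathlib

open Set Filter Topology MeasureTheory
open scoped ContDiff

/-! ### Weighted square-summable sequences -/

/-- Sequences `u` with `∑ (1 + (c i)²)^s |u i|² < ∞`; here `c` is the cast of `ℕ` or `ℤ` into `ℝ`. -/
def seqSobolev {ι : Type} (c : ι → ℝ) (s : ℝ) : Submodule ℂ (ι → ℂ) where
  carrier := {u | Summable fun i => (1 + c i ^ 2) ^ s * ‖u i‖ ^ 2}
  zero_mem' := by simp [summable_zero]
  add_mem' := by
    intro u v hu hv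
    refine Summable.of_nonneg_of_le (fun i => by positivity) (fun i => ?_)
      ((hu.add hv).mul_left 2)
    have hw : 0 ≤ (1 + c i ^ 2) ^ s := by positivity
    have h1 : ‖u i + v i‖ ≤ ‖u i‖ + ‖v i‖ := norm_add_le _ _
    have h2 : ‖u i + v i‖ ^ 2 ≤ 2 * (‖u i‖ ^ 2 + ‖v i‖ ^ 2) := by
      nlinarith [sq_nonneg (‖u i‖ - ‖v i‖), norm_nonneg (u i + v i)]
    calc (1 + c i ^ 2) ^ s * ‖(u + v) i‖ ^ 2
        ≤ (1 + c i ^ 2) ^ s * (2 * (‖u i‖ ^ 2 + ‖v i‖ ^ 2)) :=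
          mul_le_mul_of_nonneg_left h2 hw
      _ = 2 * ((1 + c i ^ 2) ^ s * ‖u i‖ ^ 2 + (1 + c i ^ 2) ^ s * ‖v i‖ ^ 2) := by ring
  smul_mem' := by
    intro a u hu
    have h : Summable fun i => ‖a‖ ^ 2 * ((1 + c i ^ 2) ^ s * ‖u i‖ ^ 2) := hu.mul_left _
    refine h.congr (fun i => ?_)
    simp only [Pi.smul_apply, smul_eq_mul, norm_mul]
    ring

theorem seqSobolev_anti {ι : Type} (c : ι → ℝ) {s t : ℝ} (h : s ≤ t) :
    seqSobolev c t ≤ seqSobolev c s := by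
  intro u hu
  refine Summable.of_nonneg_of_le (fun i => by positivity) (fun i => ?_) hu
  have : (1 + c i ^ 2) ^ s ≤ (1 + c i ^ 2) ^ t :=
    Real.rpow_le_rpow_of_exponent_le (by nlinarith [sq_nonneg (c i)]) h
  exact mul_le_mul_of_nonneg_right this (by positivity)

/-- The union over `s ∈ ℝ` of the spaces `seqSobolev c s`. -/
def seqSobolevNegInf {ι : Type} (c : ι → ℝ) : Submodule ℂ (ι → ℂ) where
  carrier := {u | ∃ s : ℝ, u ∈ seqSobolev c s}
  zero_mem' := ⟨0, Submodule.zero_mem _⟩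
  add_mem' := by
    rintro u v ⟨s, hu⟩ ⟨t, hv⟩
    exact ⟨min s t, Submodule.add_mem _ (seqSobolev_anti c (min_le_left s t) hu)
      (seqSobolev_anti c (min_le_right s t) hv)⟩
  smul_mem' := by
    rintro a u ⟨s, hu⟩
    exact ⟨s, Submodule.smul_mem _ a hu⟩

theorem single_mem_seqSobolevNegInf {ι : Type} [DecidableEq ι] (c : ι → ℝ) (j : ι) :
    (Pi.single j 1 : ι → ℂ) ∈ seqSobolevNegInf c := by
  refine ⟨0, summable_of_ne_finset_zero (s := {j}) (fun i hi => ?_)⟩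
  have hij : i ≠ j := by simpa using hi
  simp [Pi.single_eq_of_ne hij]

/-! ### Periodic distributions and periodic pseudo-differential operators -/

/-- `H^{-∞}_per = ⋃ₛ H^s_per`, i.e. the periodic distributions, each given by its family of
Fourier coefficients `m ↦ 𝓕u(m)`; `‖u‖²_{H^s} = ∑ (1 + m²)^s |𝓕u(m)|²`. -/
def HPerNegInf : Submodule ℂ (ℤ → ℂ) := seqSobolevNegInf (fun m : ℤ => (m : ℝ))

/-- The `m`-th Fourier coefficient `(1/2π) ∫_{-π}^{π} f(θ) e^{-imθ} dθ`. -/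
noncomputable def fourierCoef (f : ℝ → ℂ) (m : ℤ) : ℂ :=
  (1 / (2 * Real.pi : ℝ) : ℂ) *
    ∫ θ in (-Real.pi)..Real.pi, f θ * Complex.exp (-(m * θ * Complex.I))

/-- `e_n : θ ↦ e^{inθ}` as an element of `H^{-∞}_per`. -/
noncomputable def expPer (n : ℤ) : HPerNegInf :=
  ⟨Pi.single n 1, single_mem_seqSobolevNegInf _ n⟩

/-- `σ ∈ C^∞(𝕋_{2π} × ℝ)` with `|∂_θ^j ∂_ξ^k σ(θ, ξ)| ≤ C_{jk} (1 + |ξ|)^{α - k}` for all `j, k`. -/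
def IsProlongedSymbol (α : ℝ) (σ : ℝ → ℝ → ℂ) : Prop :=
  ContDiff ℝ ∞ (fun p : ℝ × ℝ => σ p.1 p.2) ∧
  (∀ θ ξ : ℝ, σ (θ + 2 * Real.pi) ξ = σ θ ξ) ∧
  ∀ j k : ℕ, ∃ C : ℝ, ∀ θ ξ : ℝ,
    ‖iteratedDeriv j (fun t => iteratedDeriv k (σ t) ξ) θ‖ ≤ C * (1 + |ξ|) ^ (α - k)

/-- `Σ^α`: symbols on `𝕋_{2π} × ℤ` that can be prolonged to `𝕋_{2π} × ℝ` as above. -/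
def SigmaClass (α : ℝ) : Set (ℝ → ℤ → ℂ) :=
  {σ | ∃ τ : ℝ → ℝ → ℂ, IsProlongedSymbol α τ ∧ ∀ (θ : ℝ) (n : ℤ), σ θ n = τ θ n}

/-- Ellipticity of a symbol (of order `α`). -/
def IsEllipticSymbol (α : ℝ) (σ : ℝ → ℤ → ℂ) : Prop :=
  ∃ C : ℝ, 0 < C ∧ ∃ M : ℝ, ∀ n : ℤ, M ≤ |(n : ℝ)| → ∀ θ : ℝ,
    C * (1 + |(n : ℝ)|) ^ α ≤ ‖σ θ n‖

/-- `A = Op(σ)`: for every periodic distribution `u`, `A u = ∑ₙ σ(·, n) 𝓕u(n) e_n`, the equality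
being that of the Fourier coefficients. -/
def IsOpPer (σ : ℝ → ℤ → ℂ) (A : HPerNegInf →ₗ[ℂ] HPerNegInf) : Prop :=
  ∀ (u : HPerNegInf) (m : ℤ),
    HasSum (fun n : ℤ =>
      fourierCoef (fun θ => σ θ n * Complex.exp (n * θ * Complex.I)) m * u.1 n) ((A u).1 m)

/-- `A` is an elliptic periodic pseudo-differential operator of order `α`. -/
def IsEllipticPPDO (α : ℝ) (A : HPerNegInf →ₗ[ℂ] HPerNegInf) : Prop :=
  ∃ σ ∈ SigmaClass α, IsOpPer σ A ∧ IsEllipticSymbol α σ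

/-- The symbol `σ_A(θ, n) = conj(e_n(θ)) (A e_n)(θ)` of a periodic pseudo-differential operator;
the function `A e_n` is recovered from its Fourier series. -/
noncomputable def symbolPer (A : HPerNegInf →ₗ[ℂ] HPerNegInf) (θ : ℝ) (n : ℤ) : ℂ :=
  Complex.exp (-(n * θ * Complex.I)) *
    ∑' m : ℤ, (A (expPer n)).1 m * Complex.exp (m * θ * Complex.I)

/-- `(σ_A(θ, n) + σ_A(-θ, -n)) / 2`. -/
noncomputable def symmSymbolPer (A : HPerNegInf →ₗ[ℂ] HPerNegInf) (θ : ℝ) (n : ℤ) : ℂ :=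
  (symbolPer A θ n + symbolPer A (-θ) (-n)) / 2

/-- The function `a₁(A)` on `[-1, 1] × ℕ`. -/
noncomputable def symbA1 (A : HPerNegInf →ₗ[ℂ] HPerNegInf) (x : ℝ) (n : ℕ) : ℂ :=
  (symmSymbolPer A (Real.arccos x) n + symmSymbolPer A (Real.arccos x) (-n)) / 2

/-- The function `a₂(A)` on `[-1, 1] × ℕ`: given by the quotient for `-1 < x < 1`, and by
continuity at `x = ±1`, where the quotient is undefined. -/
noncomputable def symbA2 (A : HPerNegInf →ₗ[ℂ] HPerNegInf) (x : ℝ) (n : ℕ) : ℂ :=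
  extendFrom (Ioo (-1 : ℝ) 1) (fun y : ℝ =>
    (symmSymbolPer A (Real.arccos y) n - symmSymbolPer A (Real.arccos y) (-n)) /
      (2 * Complex.I * (Real.sqrt (1 - y ^ 2) : ℂ))) x

/-! ### The spaces `U^s` on the segment -/

/-- Formal series `∑ cₙ bₙ` in a family `b` of functions, given by the coefficients `cₙ`. -/
def FormalSeries {X : Type} (_b : ℕ → X → ℂ) : Type := ℕ → ℂ

noncomputable instance {X : Type} (b : ℕ → X → ℂ) : AddCommGroup (FormalSeries b) :=
  inferInstanceAs (AddCommGroup (ℕ → ℂ))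

noncomputable instance {X : Type} (b : ℕ → X → ℂ) : Module ℂ (FormalSeries b) :=
  inferInstanceAs (Module ℂ (ℕ → ℂ))

/-- The Chebyshev polynomials of the second kind as functions on `[-1, 1]`. -/
noncomputable def chebU (n : ℕ) (x : Icc (-1 : ℝ) 1) : ℂ :=
  (((Polynomial.Chebyshev.U ℝ (n : ℤ)).eval (x : ℝ) : ℝ) : ℂ)

/-- `U^s`: the formal series `∑ uₙ Uₙ` with `∑ (1 + n²)^s |uₙ|² < ∞`. -/
def USpace (s : ℝ) : Submodule ℂ (FormalSeries chebU) := seqSobolev (fun n : ℕ => (n : ℝ)) s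

/-- `U^{-∞} = ⋃ₛ U^s`. -/
def UNegInf : Submodule ℂ (FormalSeries chebU) := seqSobolevNegInf (fun n : ℕ => (n : ℝ))

/-- `‖u‖_{U^s}`, where `‖u‖²_{U^s} = ½ ∑ (1 + n²)^s |uₙ|²` (used for `u ∈ U^s`). -/
noncomputable def normU (s : ℝ) (u : FormalSeries chebU) : ℝ :=
  Real.sqrt (1 / 2 * ∑' n : ℕ, (1 + (n : ℝ) ^ 2) ^ s * ‖u n‖ ^ 2)

/-- `U_k` as an element of `U^{-∞}`. -/
noncomputable def basisU (k : ℕ) : UNegInf :=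
  ⟨(Pi.single k 1 : ℕ → ℂ), single_mem_seqSobolevNegInf _ k⟩

/-- The coefficients `(2/π) ∫_{-1}^{1} f U_m ω dx`, `ω(x) = √(1 - x²)`, of the expansion
`f = ∑ f_m U_m` of a function `f` on `[-1, 1]`. -/
noncomputable def chebCoefU (f : ℝ → ℂ) (m : ℕ) : ℂ :=
  (2 / (Real.pi : ℝ) : ℂ) * ∫ x in (-1 : ℝ)..1,
    f x * (((Polynomial.Chebyshev.U ℝ (m : ℤ)).eval x : ℝ) : ℂ) * (Real.sqrt (1 - x ^ 2) : ℂ)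

/-- The Fourier coefficients of `∑ uₙ sin((n+1)θ)`, as
`sin((n+1)θ) = (e_{n+1}(θ) - e_{-(n+1)}(θ)) / (2i)`. -/
noncomputable def sineCoef (u : ℕ → ℂ) : ℤ → ℂ
  | Int.ofNat 0 => 0
  | Int.ofNat (n + 1) => u n / (2 * Complex.I)
  | Int.negSucc n => -(u n) / (2 * Complex.I)

theorem sineCoef_mem (u : ℕ → ℂ) (hu : u ∈ seqSobolevNegInf (fun n : ℕ => (n : ℝ))) :
    sineCoef u ∈ HPerNegInf := by
  obtain ⟨s, hs⟩ := hu
  have hs0 : Summable fun n : ℕ => (1 + (n : ℝ) ^ 2) ^ (min s 0) * ‖u n‖ ^ 2 :=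
    seqSobolev_anti _ (min_le_left s 0) hs
  have key : ∀ n : ℕ, (1 + ((n : ℝ) + 1) ^ 2) ^ (min s 0) * (‖u n‖ ^ 2 / 4) ≤
      (1 + (n : ℝ) ^ 2) ^ (min s 0) * ‖u n‖ ^ 2 := by
    intro n
    have h1 : (1 + ((n : ℝ) + 1) ^ 2) ^ (min s 0) ≤ (1 + (n : ℝ) ^ 2) ^ (min s 0) := by
      apply Real.rpow_le_rpow_of_nonpos (by positivity) _ (min_le_right s 0)
      nlinarith [(Nat.cast_nonneg n : (0 : ℝ) ≤ n)]
    apply mul_le_mul h1 _ (by positivity) (by positivity)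
    nlinarith [sq_nonneg ‖u n‖]
  have hsum : Summable fun n : ℕ => (1 + ((n : ℝ) + 1) ^ 2) ^ (min s 0) * (‖u n‖ ^ 2 / 4) :=
    Summable.of_nonneg_of_le (fun n => by positivity) key hs0
  have hI : ∀ z : ℂ, ‖z / (2 * Complex.I)‖ ^ 2 = ‖z‖ ^ 2 / 4 := by
    intro z
    rw [norm_div, norm_mul, Complex.norm_I, div_pow]
    norm_num
  refine ⟨min s 0, Summable.of_nat_of_neg_add_one ?_ ?_⟩
  · refine (summable_nat_add_iff 1).mp (hsum.congr (fun n => ?_))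
    have h : sineCoef u ((n + 1 : ℕ) : ℤ) = u n / (2 * Complex.I) := rfl
    simp only [h, hI]
    push_cast
    rfl
  · refine hsum.congr (fun n => ?_)
    have h : sineCoef u (-((n : ℤ) + 1)) = -(u n) / (2 * Complex.I) := by
      rw [← Int.negSucc_eq]; rfl
    simp only [h, hI, norm_neg]
    push_cast
    congr 2
    ring

/-- The map `𝓢 : U^{-∞} → H^{-∞}_per`, `𝓢 Uₙ = (θ ↦ sin((n+1)θ))`; on functions,
`𝓢u(θ) = sin θ u(cos θ)`. -/
noncomputable def sineTransform : UNegInf →ₗ[ℂ] HPerNegInf where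
  toFun u := ⟨sineCoef u.1, sineCoef_mem u.1 u.2⟩
  map_add' u v := by
    ext m
    match m with
    | Int.ofNat 0 => exact (add_zero (0 : ℂ)).symm
    | Int.ofNat (n + 1) => exact add_div (u.1 n) (v.1 n) _
    | Int.negSucc n =>
      change -(u.1 n + v.1 n) / _ = -(u.1 n) / _ + -(v.1 n) / _
      ring
  map_smul' a u := by
    ext m
    match m with
    | Int.ofNat 0 => exact (mul_zero a).symm
    | Int.ofNat (n + 1) => exact mul_div_assoc a (u.1 n) _
    | Int.negSucc n =>
      change -(a * u.1 n) / _ = a * (-(u.1 n) / _)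
      ring

/-! ### Pseudo-differential operators on the segment -/

/-- Continuity of a linear operator on the scale `U^{-∞} = ⋃ₛ U^s`: each `U^s` is mapped
continuously into some `U^t`. -/
def IsContinuousOpU (A : UNegInf →ₗ[ℂ] UNegInf) : Prop :=
  ∀ s : ℝ, ∃ t C : ℝ, ∀ u : UNegInf, u.1 ∈ USpace s →
    (A u).1 ∈ USpace t ∧ normU t (A u).1 ≤ C * normU s u.1

/-- `σ̃(a₁, a₂)(θ, n) = a₁(cos θ, |n|) + i sin θ sign(n) a₂(cos θ, |n|)`, with the convention
`a₁(·, 0) = a₂(·, 0) = 0`. -/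
noncomputable def sigmaTilde (a₁ a₂ : ℝ → ℕ → ℂ) (θ : ℝ) (n : ℤ) : ℂ :=
  if n = 0 then 0 else
    a₁ (Real.cos θ) n.natAbs +
      Complex.I * (Real.sin θ : ℂ) * (n.sign : ℂ) * a₂ (Real.cos θ) n.natAbs

/-- `(a₁, a₂) ∈ S_U^α`; only the values at `x ∈ [-1, 1]` and `n ≥ 1` matter. -/
def MemSU (α : ℝ) (a₁ a₂ : ℝ → ℕ → ℂ) : Prop :=
  (∀ n : ℕ, 1 ≤ n → ContDiffOn ℝ ∞ (fun x => a₁ x n) (Icc (-1) 1) ∧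
    ContDiffOn ℝ ∞ (fun x => a₂ x n) (Icc (-1) 1)) ∧
  sigmaTilde a₁ a₂ ∈ SigmaClass α

/-- `A = Op_U(a₁, a₂)`: `A` is the continuous operator on `U^{-∞}` such that
`A U_{n-1} = a₁(x, n) U_{n-1} + a₂(x, n) T_n` for all `n ≥ 1` (written with `n = k + 1`). -/
def IsOpU (a₁ a₂ : ℝ → ℕ → ℂ) (A : UNegInf →ₗ[ℂ] UNegInf) : Prop :=
  IsContinuousOpU A ∧
  ∀ k m : ℕ, (A (basisU k)).1 m = chebCoefU (fun x =>
    a₁ x (k + 1) * (((Polynomial.Chebyshev.U ℝ (k : ℤ)).eval x : ℝ) : ℂ) +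
    a₂ x (k + 1) * (((Polynomial.Chebyshev.T ℝ ((k : ℤ) + 1)).eval x : ℝ) : ℂ)) m

/-! ### Smooth open curves -/

/-- A smooth simple open curve `Γ = r([-1, 1])` in the plane (an arc), parametrized with the constant
speed `|r'| = |Γ| / 2`. -/
structure SmoothOpenCurve where
  r : ℝ → EuclideanSpace ℝ (Fin 2)
  smooth : ContDiffOn ℝ ∞ r (Icc (-1) 1)
  inj : InjOn r (Icc (-1) 1)
  speed : ∀ x ∈ Icc (-1 : ℝ) 1, ‖derivWithin r (Icc (-1) 1) x‖ =
    (∫ y in (-1 : ℝ)..1, ‖derivWithin r (Icc (-1) 1) y‖) / 2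

namespace SmoothOpenCurve

/-- The set of points of the curve. -/
def carrier (Γ : SmoothOpenCurve) : Set (EuclideanSpace ℝ (Fin 2)) := Γ.r '' Icc (-1) 1

/-- The length `|Γ|`. -/
noncomputable def length (Γ : SmoothOpenCurve) : ℝ :=
  ∫ y in (-1 : ℝ)..1, ‖derivWithin Γ.r (Icc (-1) 1) y‖

/-- The bijection `r : [-1, 1] → Γ`. -/
noncomputable def param (Γ : SmoothOpenCurve) : Icc (-1 : ℝ) 1 ≃ Γ.carrier :=
  Equiv.Set.imageOfInjOn Γ.r (Icc (-1) 1) Γ.inj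

/-- The functions `R_Γ⁻¹ Uₙ = Uₙ ∘ r⁻¹` on `Γ`. -/
noncomputable def chebUCurve (Γ : SmoothOpenCurve) (n : ℕ) : Γ.carrier → ℂ :=
  chebU n ∘ Γ.param.symm

/-- The pullback `R_Γ`, extended to formal series: `R_Γ (∑ vₙ R_Γ⁻¹ Uₙ) = ∑ vₙ Uₙ`. -/
noncomputable def pullback (Γ : SmoothOpenCurve) :
    FormalSeries Γ.chebUCurve ≃ₗ[ℂ] FormalSeries chebU :=
  LinearEquiv.refl ℂ (ℕ → ℂ)

/-- `U^s(Γ)`: the formal series `v = ∑ vₙ R_Γ⁻¹ Uₙ` with `R_Γ v ∈ U^s`. -/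
noncomputable def USpace (Γ : SmoothOpenCurve) (s : ℝ) : Submodule ℂ (FormalSeries Γ.chebUCurve) :=
  (_root_.USpace s).comap Γ.pullback.toLinearMap

/-- `U^{-∞}(Γ)`. -/
noncomputable def UNegInf (Γ : SmoothOpenCurve) : Submodule ℂ (FormalSeries Γ.chebUCurve) :=
  _root_.UNegInf.comap Γ.pullback.toLinearMap

/-- The norm of `U^s(Γ)`, `‖v‖²_{U^s(Γ)} = (|Γ|²/2) ‖R_Γ v‖²_{U^s}`. -/
noncomputable def normU (Γ : SmoothOpenCurve) (s : ℝ) (v : FormalSeries Γ.chebUCurve) : ℝ :=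
  Real.sqrt (Γ.length ^ 2 / 2) * _root_.normU s (Γ.pullback v)

/-- `R_Γ : U^{-∞}(Γ) → U^{-∞}`. -/
noncomputable def pullbackNegInf (Γ : SmoothOpenCurve) : Γ.UNegInf ≃ₗ[ℂ] _root_.UNegInf where
  toFun v := ⟨Γ.pullback v.1, v.2⟩
  invFun u := ⟨Γ.pullback.symm u.1, by
    change Γ.pullback (Γ.pullback.symm u.1) ∈ _root_.UNegInf
    rw [LinearEquiv.apply_symm_apply]
    exact u.2⟩
  left_inv v := by ext1; exact Γ.pullback.symm_apply_apply v.1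
  right_inv u := by ext1; exact Γ.pullback.apply_symm_apply u.1
  map_add' u v := by ext1; exact map_add Γ.pullback u.1 v.1
  map_smul' a u := by ext1; exact map_smul Γ.pullback a u.1

/-- `R_Γ A R_Γ⁻¹`. -/
noncomputable def toSegment (Γ : SmoothOpenCurve) (A : Γ.UNegInf →ₗ[ℂ] Γ.UNegInf) :
    _root_.UNegInf →ₗ[ℂ] _root_.UNegInf :=
  Γ.pullbackNegInf.toLinearMap ∘ₗ A ∘ₗ Γ.pullbackNegInf.symm.toLinearMap

/-- `(a₁, a₂) ∈ S_U^α` is a pair of symbols of the operator `A` on `U^{-∞}(Γ)`. -/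
def IsSymbolPair (Γ : SmoothOpenCurve) (α : ℝ) (a₁ a₂ : ℝ → ℕ → ℂ)
    (A : Γ.UNegInf →ₗ[ℂ] Γ.UNegInf) : Prop :=
  MemSU α a₁ a₂ ∧ IsOpU a₁ a₂ (Γ.toSegment A)

/-- The class `Op(S_U^α(Γ))`. -/
def OpSU (Γ : SmoothOpenCurve) (α : ℝ) : Set (Γ.UNegInf →ₗ[ℂ] Γ.UNegInf) :=
  {A | ∃ a₁ a₂ : ℝ → ℕ → ℂ, Γ.IsSymbolPair α a₁ a₂ A}

/-- The class `Op(S_U^{-∞}(Γ))`, where `S_U^{-∞} = ⋂_α S_U^α`. -/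
def OpSUNegInf (Γ : SmoothOpenCurve) : Set (Γ.UNegInf →ₗ[ℂ] Γ.UNegInf) :=
  {A | ∃ a₁ a₂ : ℝ → ℕ → ℂ, ∀ α : ℝ, Γ.IsSymbolPair α a₁ a₂ A}

/-- `A ∈ Op(S_U^α(Γ))` is elliptic: it has a pair of symbols `(a₁, a₂) ∈ S_U^α` such that
`σ̃(a₁, a₂)` is elliptic of order `α`. -/
def IsEllipticU (Γ : SmoothOpenCurve) (α : ℝ) (A : Γ.UNegInf →ₗ[ℂ] Γ.UNegInf) : Prop :=
  ∃ a₁ a₂ : ℝ → ℕ → ℂ, Γ.IsSymbolPair α a₁ a₂ A ∧ IsEllipticSymbol α (sigmaTilde a₁ a₂)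

end SmoothOpenCurve

/-! Everything is reduced to an algebra of infinite matrices indexed by ℤ × ℤ. After conjugation by
R_Γ and passage through the sine transform, an operator with a pair of symbols becomes `Op(σ̃)`, and
in the basis e_n this operator has the entries M(m, n), the Fourier coefficient of index m - n of
σ̃(·, n).

The dictionary. A symbol lies in Σ^α exactly when its matrix decays rapidly away from the diagonal,
grows like (1 + |n|)^α along it, and gains one order with each difference along the diagonals
(`IsPDMatrix`). From symbols to matrices this is integration by parts in θ and the mean value
theorem in ξ (`isPDMatrix_symbolMatrix`). The converse (`IsPDMatrix.matSymbol_mem`) must produce a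
smooth function of a real ξ from values at integers. It uses kernels Φ_k such that Φ_0 is the unit
sequence at integers and Φ_k' is the forward difference of Φ_{k+1}. By summation by parts, the
derivatives of the interpolant are then interpolants of the differences of the data, so they inherit
their decay.

The algebra. Composition is the matrix product, and a discrete Leibniz rule shows that orders add.
Comparing it with the product `starMul`, which corresponds to pointwise multiplication of symbols
and is commutative, gives an error of order α + β - 1 (`IsPDMatrix.mulDefect`), hence the commutator
estimate. Continuity on the scale is Young's inequality with the kernel (1 + |m - n|)⁻². For the
parametrix, the reciprocal of an elliptic symbol, corrected on finitely many columns, inverts the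
operator up to an error of order -1. A Neumann series, again after removal of finitely many columns,
turns this into an inverse modulo smoothing matrices (`exists_inverse_one_sub`,
`exists_parametrix`).

The segment. The symbol σ̃(a₁, a₂) is invariant under (θ, n) ↦ (-θ, -n), so its matrix preserves odd
sequences, which are the image of the sine transform. The substitution x = cos θ identifies the
action on U_k with that of the matrix on e_{k+1} - e_{-(k+1)} (`chebCoefU_symbolPair`), and
continuity determines the operator from these values. In the other direction, e^{ilθ} = T_l(cos θ) +
i sin θ U_{l-1}(cos θ) splits the symbol of a reflection invariant matrix into two Chebyshev series.
They are smooth up to ±1 because the derivatives of T_l and U_{l-1} grow only polynomially in l.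

Ellipticity. An intertwining periodic operator is not unique: it is fixed only on odd sequences, so
two candidates differ by a matrix D with D(m, n) = D(m, -n) for n ≠ 0. Such a matrix is small both
off the diagonal and off the antidiagonal; its symbol is therefore of lower order and cannot affect
ellipticity. -/

/-! ### The weight `1 + |x|` -/

/-- The weight `1 + |x|`. -/
noncomputable def bracket (x : ℝ) : ℝ := 1 + |x|

theorem one_le_bracket (x : ℝ) : 1 ≤ bracket x := le_add_of_nonneg_right (abs_nonneg x)

theorem bracket_pos (x : ℝ) : 0 < bracket x := lt_of_lt_of_le one_pos (one_le_bracket x)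

theorem bracket_nonneg (x : ℝ) : 0 ≤ bracket x := (bracket_pos x).le

theorem bracket_zero : bracket 0 = 1 := by simp [bracket]

theorem bracket_neg (x : ℝ) : bracket (-x) = bracket x := by simp [bracket]

theorem bracket_sub_comm (x y : ℝ) : bracket (x - y) = bracket (y - x) := by
  rw [← bracket_neg, neg_sub]

theorem abs_le_bracket (x : ℝ) : |x| ≤ bracket x := by simp [bracket]

theorem bracket_add_le (x y : ℝ) : bracket (x + y) ≤ bracket x * bracket y := by
  unfold bracket
  nlinarith [abs_add_le x y, mul_nonneg (abs_nonneg x) (abs_nonneg y)]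

theorem bracket_le_mul_sub (x y : ℝ) : bracket x ≤ bracket (x - y) * bracket y := by
  simpa using bracket_add_le (x - y) y

theorem bracket_rpow_pos (x s : ℝ) : 0 < bracket x ^ s := Real.rpow_pos_of_pos (bracket_pos x) s

theorem bracket_rpow_nonneg (x s : ℝ) : 0 ≤ bracket x ^ s := (bracket_rpow_pos x s).le

theorem bracket_rpow_add (x s t : ℝ) : bracket x ^ (s + t) = bracket x ^ s * bracket x ^ t :=
  Real.rpow_add (bracket_pos x) s t

theorem bracket_rpow_mono (x : ℝ) {s t : ℝ} (h : s ≤ t) : bracket x ^ s ≤ bracket x ^ t :=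
  Real.rpow_le_rpow_of_exponent_le (one_le_bracket x) h

theorem bracket_pow_mono (x : ℝ) {p q : ℕ} (h : p ≤ q) : bracket x ^ p ≤ bracket x ^ q :=
  pow_le_pow_right₀ (one_le_bracket x) h

theorem one_le_bracket_pow (x : ℝ) (p : ℕ) : 1 ≤ bracket x ^ p := one_le_pow₀ (one_le_bracket x)

/-- Peetre's inequality. -/
theorem peetre (x y s : ℝ) : bracket x ^ s ≤ bracket (x - y) ^ |s| * bracket y ^ s := by
  rcases le_total 0 s with hs | hs
  · rw [abs_of_nonneg hs, ← Real.mul_rpow (bracket_nonneg _) (bracket_nonneg _)]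
    exact Real.rpow_le_rpow (bracket_nonneg _) (bracket_le_mul_sub x y) hs
  · obtain ⟨t, rfl⟩ : ∃ t, s = -t := ⟨-s, by simp⟩
    have ht : 0 ≤ t := by linarith
    rw [abs_neg, abs_of_nonneg ht, Real.rpow_neg (bracket_nonneg _),
      Real.rpow_neg (bracket_nonneg _), ← div_eq_mul_inv,
      le_div_iff₀ (bracket_rpow_pos y t), inv_mul_le_iff₀ (bracket_rpow_pos x t), mul_comm,
      ← Real.mul_rpow (bracket_nonneg _) (bracket_nonneg _), bracket_sub_comm]
    exact Real.rpow_le_rpow (bracket_nonneg _) (bracket_le_mul_sub y x) ht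

/-- A natural exponent lets the Peetre factor be absorbed into the natural powers of off-diagonal
decay. -/
theorem peetre_pow (x y s : ℝ) :
    bracket x ^ s ≤ bracket (x - y) ^ ⌈|s|⌉₊ * bracket y ^ s := by
  refine (peetre x y s).trans (mul_le_mul_of_nonneg_right ?_ (bracket_rpow_nonneg _ _))
  rw [← Real.rpow_natCast]
  exact bracket_rpow_mono _ (Nat.le_ceil _)

theorem summable_bracket_inv_sq : Summable fun n : ℤ => (bracket (n : ℝ) ^ 2)⁻¹ := by
  have h : Summable fun n : ℕ => (bracket (n : ℝ) ^ 2)⁻¹ := by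
    have h2 := (summable_nat_add_iff 1).mpr
      (Real.summable_nat_pow_inv.mpr (by norm_num : 1 < 2))
    refine h2.congr (fun n => ?_)
    rw [bracket, abs_of_nonneg (Nat.cast_nonneg n)]
    push_cast
    rw [add_comm]
  refine Summable.of_nat_of_neg (by simpa using h) ?_
  simpa [bracket_neg] using h

/-- The constant `∑ (1 + |n|)⁻²`. -/
noncomputable def bracketSum : ℝ := ∑' n : ℤ, (bracket (n : ℝ) ^ 2)⁻¹

theorem bracketSum_nonneg : 0 ≤ bracketSum :=
  tsum_nonneg fun _ => inv_nonneg.mpr (pow_nonneg (bracket_nonneg _) 2)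

theorem hasSum_bracket_sub (n : ℤ) :
    HasSum (fun l : ℤ => (bracket ((l : ℝ) - n) ^ 2)⁻¹) bracketSum := by
  have h := (Equiv.subRight n).hasSum_iff.mpr summable_bracket_inv_sq.hasSum
  simpa [Function.comp_def, bracketSum] using h

theorem hasSum_bracket_sub' (n : ℤ) :
    HasSum (fun l : ℤ => (bracket ((n : ℝ) - l) ^ 2)⁻¹) bracketSum := by
  simpa only [bracket_sub_comm] using hasSum_bracket_sub n

/-- Two spare powers of decay around any integer n dominate a series by a translate of ∑ (1 +
|l|)⁻², so the resulting bounds do not depend on the centre. -/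
theorem norm_le_of_bracket_mul_le {F : ℤ → ℂ} {K : ℝ} {n : ℤ}
    (h : ∀ l : ℤ, bracket ((l : ℝ) - n) ^ 2 * ‖F l‖ ≤ K) (l : ℤ) :
    ‖F l‖ ≤ K * (bracket ((l : ℝ) - n) ^ 2)⁻¹ := by
  rw [← div_eq_mul_inv, le_div_iff₀ (pow_pos (bracket_pos _) 2), mul_comm]
  exact h l

theorem summable_norm_of_bracket {F : ℤ → ℂ} {K : ℝ} {n : ℤ}
    (h : ∀ l : ℤ, bracket ((l : ℝ) - n) ^ 2 * ‖F l‖ ≤ K) : Summable fun l => ‖F l‖ :=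
  Summable.of_nonneg_of_le (fun _ => norm_nonneg _) (norm_le_of_bracket_mul_le h)
    ((hasSum_bracket_sub n).summable.mul_left K)

theorem tsum_norm_le_of_bracket {F : ℤ → ℂ} {K : ℝ} {n : ℤ}
    (h : ∀ l : ℤ, bracket ((l : ℝ) - n) ^ 2 * ‖F l‖ ≤ K) : ∑' l, ‖F l‖ ≤ K * bracketSum := by
  rw [← (hasSum_bracket_sub n).tsum_eq, ← tsum_mul_left]
  exact (summable_norm_of_bracket h).tsum_le_tsum (norm_le_of_bracket_mul_le h)
    ((hasSum_bracket_sub n).summable.mul_left K)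

theorem norm_tsum_le_of_bracket {F : ℤ → ℂ} {K : ℝ} {n : ℤ}
    (h : ∀ l : ℤ, bracket ((l : ℝ) - n) ^ 2 * ‖F l‖ ≤ K) : ‖∑' l, F l‖ ≤ K * bracketSum :=
  (norm_tsum_le_tsum_norm (summable_norm_of_bracket h)).trans (tsum_norm_le_of_bracket h)

/-! ### Matrices with off-diagonal decay -/

/-- `M` decays rapidly off the diagonal and grows with order `α` along it. -/
def DecayBound (α : ℝ) (M : ℤ → ℤ → ℂ) : Prop :=
  ∀ N : ℕ, ∃ C : ℝ, ∀ m n : ℤ, bracket ((m : ℝ) - n) ^ N * ‖M m n‖ ≤ C * bracket (n : ℝ) ^ α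

/-- The conjugate of `M` by the shift. -/
def diagShift (M : ℤ → ℤ → ℂ) (m n : ℤ) : ℂ := M (m + 1) (n + 1)

/-- The forward difference of `M` along the diagonals. -/
def diagDiff (M : ℤ → ℤ → ℂ) (m n : ℤ) : ℂ := M (m + 1) (n + 1) - M m n

/-- `DecayBound` for `M` and its first `k` differences, each difference lowering the order by one. -/
def PDMatrixUpTo : ℕ → ℝ → (ℤ → ℤ → ℂ) → Prop
  | 0, α, M => DecayBound α M
  | k + 1, α, M => DecayBound α M ∧ PDMatrixUpTo k (α - 1) (diagDiff M)

/-- The matrices, in the basis `e_n`, of periodic pseudo-differential operators of order `α`. -/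
def IsPDMatrix (α : ℝ) (M : ℤ → ℤ → ℂ) : Prop := ∀ k, PDMatrixUpTo k α M

theorem DecayBound.const_nonneg {α C : ℝ} {M : ℤ → ℤ → ℂ} {N : ℕ}
    (h : ∀ m n : ℤ, bracket ((m : ℝ) - n) ^ N * ‖M m n‖ ≤ C * bracket (n : ℝ) ^ α) : 0 ≤ C := by
  have h0 := h 0 0
  simp only [Int.cast_zero, sub_zero, bracket_zero, one_pow, one_mul, Real.one_rpow, mul_one] at h0
  exact (norm_nonneg _).trans h0

theorem DecayBound.mono {α β : ℝ} {M : ℤ → ℤ → ℂ} (h : α ≤ β) (hM : DecayBound α M) :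
    DecayBound β M := by
  intro N
  obtain ⟨C, hC⟩ := hM N
  exact ⟨C, fun m n => (hC m n).trans
    (mul_le_mul_of_nonneg_left (bracket_rpow_mono _ h) (DecayBound.const_nonneg hC))⟩

theorem DecayBound.add {α : ℝ} {M M' : ℤ → ℤ → ℂ} (h : DecayBound α M) (h' : DecayBound α M') :
    DecayBound α (M + M') := by
  intro N
  obtain ⟨C, hC⟩ := h N
  obtain ⟨C', hC'⟩ := h' N
  refine ⟨C + C', fun m n => ?_⟩
  have h1 := mul_le_mul_of_nonneg_left (norm_add_le (M m n) (M' m n))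
    (pow_nonneg (bracket_nonneg ((m : ℝ) - n)) N)
  simp only [Pi.add_apply]
  linarith [hC m n, hC' m n]

theorem DecayBound.smul {α : ℝ} {M : ℤ → ℤ → ℂ} (c : ℂ) (h : DecayBound α M) :
    DecayBound α (c • M) := by
  intro N
  obtain ⟨C, hC⟩ := h N
  refine ⟨‖c‖ * C, fun m n => ?_⟩
  simp only [Pi.smul_apply, smul_eq_mul, norm_mul]
  have := mul_le_mul_of_nonneg_left (hC m n) (norm_nonneg c)
  linarith

theorem DecayBound.diagShift {α : ℝ} {M : ℤ → ℤ → ℂ} (h : DecayBound α M) :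
    DecayBound α (diagShift M) := by
  intro N
  obtain ⟨C, hC⟩ := h N
  refine ⟨C * bracket 1 ^ ⌈|α|⌉₊, fun m n => ?_⟩
  have h1 := hC (m + 1) (n + 1)
  push_cast at h1
  rw [add_sub_add_right_eq_sub] at h1
  refine h1.trans ?_
  rw [mul_assoc]
  refine mul_le_mul_of_nonneg_left ?_ (DecayBound.const_nonneg hC)
  simpa using peetre_pow ((n : ℝ) + 1) n α

theorem diagDiff_add (M M' : ℤ → ℤ → ℂ) : diagDiff (M + M') = diagDiff M + diagDiff M' := by
  funext m n; simp only [diagDiff, Pi.add_apply]; ring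

theorem diagDiff_smul (c : ℂ) (M : ℤ → ℤ → ℂ) : diagDiff (c • M) = c • diagDiff M := by
  funext m n; simp only [diagDiff, Pi.smul_apply, smul_eq_mul]; ring

namespace PDMatrixUpTo

theorem decayBound {k : ℕ} {α : ℝ} {M : ℤ → ℤ → ℂ} (h : PDMatrixUpTo k α M) : DecayBound α M := by
  cases k with
  | zero => exact h
  | succ k => exact h.1

theorem mono {k : ℕ} {α β : ℝ} {M : ℤ → ℤ → ℂ} (h : α ≤ β) (hM : PDMatrixUpTo k α M) :
    PDMatrixUpTo k β M := by
  induction k generalizing α β M with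
  | zero => exact DecayBound.mono h hM
  | succ k ih => exact ⟨hM.1.mono h, ih (by linarith) hM.2⟩

theorem add {k : ℕ} {α : ℝ} {M M' : ℤ → ℤ → ℂ} (h : PDMatrixUpTo k α M)
    (h' : PDMatrixUpTo k α M') : PDMatrixUpTo k α (M + M') := by
  induction k generalizing α M M' with
  | zero => exact DecayBound.add h h'
  | succ k ih => exact ⟨h.1.add h'.1, by rw [diagDiff_add]; exact ih h.2 h'.2⟩

theorem smul {k : ℕ} {α : ℝ} {M : ℤ → ℤ → ℂ} (c : ℂ) (h : PDMatrixUpTo k α M) :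
    PDMatrixUpTo k α (c • M) := by
  induction k generalizing α M with
  | zero => exact DecayBound.smul c h
  | succ k ih => exact ⟨h.1.smul c, by rw [diagDiff_smul]; exact ih h.2⟩

theorem shift {k : ℕ} {α : ℝ} {M : ℤ → ℤ → ℂ} (h : PDMatrixUpTo k α M) :
    PDMatrixUpTo k α (diagShift M) := by
  induction k generalizing α M with
  | zero => exact DecayBound.diagShift h
  | succ k ih => exact ⟨h.1.diagShift, ih h.2⟩

theorem of_succ {k : ℕ} {α : ℝ} {M : ℤ → ℤ → ℂ} (h : PDMatrixUpTo (k + 1) α M) :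
    PDMatrixUpTo k α M := by
  induction k generalizing α M with
  | zero => exact h.1
  | succ k ih => exact ⟨h.1, ih h.2⟩

end PDMatrixUpTo

namespace IsPDMatrix

theorem decayBound {α : ℝ} {M : ℤ → ℤ → ℂ} (h : IsPDMatrix α M) : DecayBound α M := h 0

theorem mono {α β : ℝ} {M : ℤ → ℤ → ℂ} (h : α ≤ β) (hM : IsPDMatrix α M) : IsPDMatrix β M :=
  fun k => (hM k).mono h

theorem add {α : ℝ} {M M' : ℤ → ℤ → ℂ} (h : IsPDMatrix α M) (h' : IsPDMatrix α M') :
    IsPDMatrix α (M + M') := fun k => (h k).add (h' k)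

theorem smul {α : ℝ} {M : ℤ → ℤ → ℂ} (c : ℂ) (h : IsPDMatrix α M) : IsPDMatrix α (c • M) :=
  fun k => (h k).smul c

theorem neg {α : ℝ} {M : ℤ → ℤ → ℂ} (h : IsPDMatrix α M) : IsPDMatrix α (-M) := by
  simpa using h.smul (-1)

theorem sub {α : ℝ} {M M' : ℤ → ℤ → ℂ} (h : IsPDMatrix α M) (h' : IsPDMatrix α M') :
    IsPDMatrix α (M - M') := by
  simpa [sub_eq_add_neg] using h.add h'.neg

theorem diagDiff {α : ℝ} {M : ℤ → ℤ → ℂ} (h : IsPDMatrix α M) :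
    IsPDMatrix (α - 1) (diagDiff M) := fun k => (h (k + 1)).2

end IsPDMatrix

/-! ### Sums over the inner index of a product. -/

/-- Bounds for sums `∑ X(m, l, n) B(l, n)`, where `X` behaves like a matrix of order `α` in `(m, l)`
up to powers of `1 + |l - n|`. -/
def TwistedBound (α : ℝ) (X : ℤ → ℤ → ℤ → ℂ) : Prop :=
  ∀ N : ℕ, ∃ (C : ℝ) (P : ℕ), ∀ m l n : ℤ, bracket ((m : ℝ) - l) ^ N * ‖X m l n‖ ≤
    C * bracket ((l : ℝ) - n) ^ P * bracket (n : ℝ) ^ α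

theorem TwistedBound.term_le {α β : ℝ} {X : ℤ → ℤ → ℤ → ℂ} {B : ℤ → ℤ → ℂ}
    (hX : TwistedBound α X) (hB : DecayBound β B) (N : ℕ) :
    ∃ C : ℝ, ∀ m n l : ℤ, bracket ((l : ℝ) - n) ^ 2 *
      (bracket ((m : ℝ) - n) ^ N * ‖X m l n * B l n‖) ≤ C * bracket (n : ℝ) ^ (α + β) := by
  obtain ⟨C, P, hC⟩ := hX N
  -- N powers pass the weight from m - n to l - n, P powers absorb the twist of X, and 2 powers
  -- remain for summability in l.
  obtain ⟨D, hD⟩ := hB (N + P + 2)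
  refine ⟨C * D, fun m n l => ?_⟩
  have hC0 : 0 ≤ C := by
    have h0 := hC 0 0 0
    simp only [Int.cast_zero, sub_zero, bracket_zero, one_pow, one_mul, Real.one_rpow,
      mul_one] at h0
    exact (norm_nonneg _).trans h0
  have hmn : bracket ((m : ℝ) - n) ^ N ≤ bracket ((m : ℝ) - l) ^ N * bracket ((l : ℝ) - n) ^ N := by
    rw [← mul_pow]
    refine pow_le_pow_left₀ (bracket_nonneg _) ?_ N
    have := bracket_add_le ((m : ℝ) - l) (l - n)
    simpa using this
  have h1 := hC m l n
  have h2 := hD l n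
  set b := bracket ((l : ℝ) - n)
  have hb : 0 ≤ b := bracket_nonneg _
  rw [norm_mul, bracket_rpow_add]
  calc b ^ 2 * (bracket ((m : ℝ) - n) ^ N * (‖X m l n‖ * ‖B l n‖))
      ≤ b ^ 2 * ((bracket ((m : ℝ) - l) ^ N * b ^ N) * (‖X m l n‖ * ‖B l n‖)) := by gcongr
    _ = (bracket ((m : ℝ) - l) ^ N * ‖X m l n‖) * (b ^ (N + 2) * ‖B l n‖) := by ring
    _ ≤ (C * b ^ P * bracket (n : ℝ) ^ α) * (b ^ (N + 2) * ‖B l n‖) := by gcongr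
    _ = (C * bracket (n : ℝ) ^ α) * (b ^ (N + P + 2) * ‖B l n‖) := by ring
    _ ≤ (C * bracket (n : ℝ) ^ α) * (D * bracket (n : ℝ) ^ β) :=
        mul_le_mul_of_nonneg_left h2 (mul_nonneg hC0 (bracket_rpow_nonneg _ _))
    _ = C * D * (bracket (n : ℝ) ^ α * bracket (n : ℝ) ^ β) := by ring

theorem TwistedBound.summable {α β : ℝ} {X : ℤ → ℤ → ℤ → ℂ} {B : ℤ → ℤ → ℂ}
    (hX : TwistedBound α X) (hB : DecayBound β B) (m n : ℤ) :
    Summable fun l => ‖X m l n * B l n‖ := by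
  obtain ⟨C, hC⟩ := hX.term_le hB 0
  exact summable_norm_of_bracket (fun l => by simpa using hC m n l)

theorem TwistedBound.decayBound {α β : ℝ} {X : ℤ → ℤ → ℤ → ℂ} {B : ℤ → ℤ → ℂ}
    (hX : TwistedBound α X) (hB : DecayBound β B) :
    DecayBound (α + β) (fun m n => ∑' l, X m l n * B l n) := by
  intro N
  obtain ⟨C, hC⟩ := hX.term_le hB N
  refine ⟨C * bracketSum, fun m n => ?_⟩
  have hb : 0 ≤ bracket ((m : ℝ) - n) ^ N := pow_nonneg (bracket_nonneg _) _
  have h := norm_tsum_le_of_bracket (F := fun l => ((bracket ((m : ℝ) - n) ^ N : ℝ) : ℂ) *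
    (X m l n * B l n)) (n := n) (K := C * bracket (n : ℝ) ^ (α + β)) (fun l => by
      rw [norm_mul, Complex.norm_real, Real.norm_of_nonneg hb]
      exact hC m n l)
  rw [tsum_mul_left, norm_mul, Complex.norm_real, Real.norm_of_nonneg hb] at h
  linarith

/-- Peetre's inequality moves the weight from column l to column n at the price of a power of 1 + |l
- n|. -/
theorem DecayBound.twistedBound {α : ℝ} {A : ℤ → ℤ → ℂ} (hA : DecayBound α A) :
    TwistedBound α (fun m l _ => A m l) := by
  intro N
  obtain ⟨C, hC⟩ := hA N
  refine ⟨C, ⌈|α|⌉₊, fun m l n => (hC m l).trans ?_⟩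
  rw [mul_assoc]
  exact mul_le_mul_of_nonneg_left (peetre_pow _ _ _) (DecayBound.const_nonneg hC)

/-- The entry already sits in column n with offset m - l, so no twist is needed. -/
theorem DecayBound.twistedBound_star {α : ℝ} {A : ℤ → ℤ → ℂ} (hA : DecayBound α A) :
    TwistedBound α (fun m l n => A (n + m - l) n) := by
  intro N
  obtain ⟨C, hC⟩ := hA N
  refine ⟨C, 0, fun m l n => ?_⟩
  have h := hC (n + m - l) n
  push_cast at h
  rw [show (n : ℝ) + m - l - n = m - l by ring] at h
  simpa using h

/-- Telescoping: k steps along a diagonal, each controlled by the difference matrix, which has order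
α - 1. -/
theorem norm_sub_diag_le {α : ℝ} {A : ℤ → ℤ → ℂ} (hA : DecayBound (α - 1) (diagDiff A)) (N : ℕ) :
    ∃ (C : ℝ) (P : ℕ), ∀ (m n : ℤ) (k : ℕ),
      bracket ((m : ℝ) - n) ^ N * ‖A (m + k) (n + k) - A m n‖ ≤
        C * bracket (k : ℝ) ^ P * bracket (n : ℝ) ^ (α - 1) := by
  obtain ⟨C, hC⟩ := hA N
  have hC0 : 0 ≤ C := DecayBound.const_nonneg hC
  -- One power counts the k steps; the others compare the weights at the columns n + j, j < k, with
  -- the weight at n.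
  refine ⟨C, ⌈|α - 1|⌉₊ + 1, fun m n k => ?_⟩
  have key : ∀ j : ℕ, j ≤ k → bracket ((m : ℝ) - n) ^ N * ‖A (m + j) (n + j) - A m n‖ ≤
      j * (C * bracket (k : ℝ) ^ ⌈|α - 1|⌉₊ * bracket (n : ℝ) ^ (α - 1)) := by
    intro j
    induction j with
    | zero => intro _; simp
    | succ j ih =>
      intro hj
      have h1 := ih (by omega)
      have h2 := hC (m + j) (n + j)
      push_cast at h2
      rw [add_sub_add_right_eq_sub] at h2
      have h3 : C * bracket ((n : ℝ) + j) ^ (α - 1) ≤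
          C * bracket (k : ℝ) ^ ⌈|α - 1|⌉₊ * bracket (n : ℝ) ^ (α - 1) := by
        rw [mul_assoc]
        refine mul_le_mul_of_nonneg_left ((peetre_pow _ (n : ℝ) _).trans ?_) hC0
        refine mul_le_mul_of_nonneg_right ?_ (bracket_rpow_nonneg _ _)
        refine pow_le_pow_left₀ (bracket_nonneg _) ?_ _
        rw [add_sub_cancel_left, bracket, bracket, abs_of_nonneg (Nat.cast_nonneg _),
          abs_of_nonneg (Nat.cast_nonneg _)]
        have : (j : ℝ) ≤ k := by exact_mod_cast (by omega : j ≤ k)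
        linarith
      have h4 : A (m + (j + 1 : ℕ)) (n + (j + 1 : ℕ)) - A m n =
          diagDiff A (m + j) (n + j) + (A (m + j) (n + j) - A m n) := by
        simp only [diagDiff]; push_cast; rw [add_assoc, add_assoc]; ring
      rw [h4]
      have h5 := mul_le_mul_of_nonneg_left
        (norm_add_le (diagDiff A (m + j) (n + j)) (A (m + j) (n + j) - A m n))
        (pow_nonneg (bracket_nonneg ((m : ℝ) - n)) N)
      push_cast
      linarith
  refine (key k le_rfl).trans ?_
  have hk : (k : ℝ) ≤ bracket (k : ℝ) := by
    simpa using abs_le_bracket (k : ℝ)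
  have h0 : 0 ≤ C * bracket (k : ℝ) ^ ⌈|α - 1|⌉₊ * bracket (n : ℝ) ^ (α - 1) :=
    mul_nonneg (mul_nonneg hC0 (pow_nonneg (bracket_nonneg _) _)) (bracket_rpow_nonneg _ _)
  calc _ ≤ bracket (k : ℝ) * (C * bracket (k : ℝ) ^ ⌈|α - 1|⌉₊ * bracket (n : ℝ) ^ (α - 1)) := by
        gcongr
    _ = _ := by rw [pow_succ]; ring

/-- Both entries lie on the diagonal of offset m - l, at distance |l - n| from each other, so the
telescoping bound applies. It starts from the smaller of the two columns; if that column is l,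
Peetre's inequality restores the weight at n. -/
theorem DecayBound.twistedBound_sub {α : ℝ} {A : ℤ → ℤ → ℂ}
    (hA : DecayBound (α - 1) (_root_.diagDiff A)) :
    TwistedBound (α - 1) (fun m l n => A m l - A (n + m - l) n) := by
  intro N
  obtain ⟨C, P, hC⟩ := norm_sub_diag_le hA N
  have hC0 : 0 ≤ C := by
    have h0 := hC 0 0 0
    simp only [Int.cast_zero, Nat.cast_zero, sub_zero, bracket_zero, one_pow, one_mul,
      Real.one_rpow, mul_one] at h0
    exact (norm_nonneg _).trans h0
  refine ⟨C, P + ⌈|α - 1|⌉₊, fun m l n => ?_⟩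
  rcases le_total n l with h | h
  · obtain ⟨k, rfl⟩ : ∃ k : ℕ, l = n + k := ⟨(l - n).toNat, by omega⟩
    have h1 := hC (m - k) n k
    push_cast at h1 ⊢
    rw [sub_add_cancel, show (n : ℤ) + m - (n + k) = m - k by ring,
      show (m : ℝ) - (n + k) = m - k - n by ring, add_sub_cancel_left] at *
    refine h1.trans (mul_le_mul_of_nonneg_right ?_ (bracket_rpow_nonneg _ _))
    exact mul_le_mul_of_nonneg_left (bracket_pow_mono _ (by omega)) hC0
  · obtain ⟨k, rfl⟩ : ∃ k : ℕ, n = l + k := ⟨(n - l).toNat, by omega⟩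
    have h1 := hC m l k
    push_cast at h1 ⊢
    rw [norm_sub_rev, show l + (k : ℤ) + m - l = m + k by ring,
      bracket_sub_comm (l : ℝ), add_sub_cancel_left]
    refine h1.trans ?_
    have h2 := peetre_pow (l : ℝ) (l + k) (α - 1)
    rw [bracket_sub_comm (l : ℝ), add_sub_cancel_left] at h2
    calc _ ≤ C * bracket (k : ℝ) ^ P *
        (bracket (k : ℝ) ^ ⌈|α - 1|⌉₊ * bracket ((l : ℝ) + k) ^ (α - 1)) :=
          mul_le_mul_of_nonneg_left h2 (mul_nonneg hC0 (pow_nonneg (bracket_nonneg _) _))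
      _ = _ := by rw [pow_add]; ring

/-! ### Products of matrices compared with products of symbols. -/

/-- The product of two infinite matrices. -/
noncomputable def matMul (A B : ℤ → ℤ → ℂ) (m n : ℤ) : ℂ := ∑' l, A m l * B l n

/-- The matrix whose symbol is the pointwise product of those of `A` and `B`. -/
noncomputable def starMul (A B : ℤ → ℤ → ℂ) (m n : ℤ) : ℂ := ∑' l, A (n + m - l) n * B l n

/-- The difference of `matMul A B` and `starMul A B`. -/
noncomputable def mulDefect (A B : ℤ → ℤ → ℂ) (m n : ℤ) : ℂ :=
  ∑' l, (A m l - A (n + m - l) n) * B l n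

/-- The substitution l ↦ n + m - l exchanges the two factors; this is the commutativity of pointwise
multiplication of symbols. -/
theorem starMul_comm (A B : ℤ → ℤ → ℂ) : starMul A B = starMul B A := by
  funext m n
  rw [starMul, starMul, ← (Equiv.subLeft (n + m)).tsum_eq]
  refine tsum_congr fun l => ?_
  simp [mul_comm]

theorem DecayBound.summable_mul {α β : ℝ} {A B : ℤ → ℤ → ℂ} (hA : DecayBound α A)
    (hB : DecayBound β B) (m n : ℤ) : Summable fun l => ‖A m l * B l n‖ :=
  hA.twistedBound.summable hB m n

theorem DecayBound.summable_star {α β : ℝ} {A B : ℤ → ℤ → ℂ} (hA : DecayBound α A)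
    (hB : DecayBound β B) (m n : ℤ) : Summable fun l => ‖A (n + m - l) n * B l n‖ :=
  hA.twistedBound_star.summable hB m n

theorem DecayBound.matMul {α β : ℝ} {A B : ℤ → ℤ → ℂ} (hA : DecayBound α A)
    (hB : DecayBound β B) : DecayBound (α + β) (matMul A B) := hA.twistedBound.decayBound hB

theorem mulDefect_eq {α β : ℝ} {A B : ℤ → ℤ → ℂ} (hA : DecayBound α A) (hB : DecayBound β B) :
    mulDefect A B = matMul A B - starMul A B := by
  funext m n
  simp only [Pi.sub_apply, matMul, starMul, mulDefect]
  rw [← (hA.summable_mul hB m n).of_norm.tsum_sub (hA.summable_star hB m n).of_norm]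
  exact tsum_congr fun l => by ring

/-- Discrete Leibniz rule: a shift of the summation index makes the shifted product the product of
the shifted matrices, and the mixed term (shifted A) B is then subtracted and added. -/
theorem diagDiff_matMul {α β : ℝ} {A B : ℤ → ℤ → ℂ} (hA : DecayBound α A) (hB : DecayBound β B) :
    diagDiff (matMul A B) = matMul (diagShift A) (diagDiff B) + matMul (diagDiff A) B := by
  funext m n
  have h1 : matMul A B (m + 1) (n + 1) = matMul (diagShift A) (diagShift B) m n := by
    simp only [matMul, diagShift]
    exact ((Equiv.addRight (1 : ℤ)).tsum_eq (fun l => A (m + 1) l * B l (n + 1))).symm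
  have s1 := (hA.diagShift.summable_mul hB.diagShift m n).of_norm
  have s2 := (hA.diagShift.summable_mul hB m n).of_norm
  have s3 := (hA.summable_mul hB m n).of_norm
  have e1 : matMul (diagShift A) (diagDiff B) m n =
      matMul (diagShift A) (diagShift B) m n - matMul (diagShift A) B m n := by
    simp only [matMul]
    rw [← s1.tsum_sub s2]
    exact tsum_congr fun l => by simp only [diagDiff, diagShift]; ring
  have e2 : matMul (diagDiff A) B m n = matMul (diagShift A) B m n - matMul A B m n := by
    simp only [matMul]
    rw [← s2.tsum_sub s3]
    exact tsum_congr fun l => by simp only [diagDiff, diagShift]; ring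
  rw [Pi.add_apply, Pi.add_apply, diagDiff, h1, e1, e2]
  ring

theorem diagDiff_starMul {α β : ℝ} {A B : ℤ → ℤ → ℂ} (hA : DecayBound α A) (hB : DecayBound β B) :
    diagDiff (starMul A B) = starMul (diagShift A) (diagDiff B) + starMul (diagDiff A) B := by
  funext m n
  have h1 : starMul A B (m + 1) (n + 1) = starMul (diagShift A) (diagShift B) m n := by
    simp only [starMul, diagShift]
    rw [← (Equiv.addRight (1 : ℤ)).tsum_eq]
    refine tsum_congr fun l => ?_
    simp only [Equiv.coe_addRight]
    congr 2
    ring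
  have s1 := (hA.diagShift.summable_star hB.diagShift m n).of_norm
  have s2 := (hA.diagShift.summable_star hB m n).of_norm
  have s3 := (hA.summable_star hB m n).of_norm
  have e1 : starMul (diagShift A) (diagDiff B) m n =
      starMul (diagShift A) (diagShift B) m n - starMul (diagShift A) B m n := by
    simp only [starMul]
    rw [← s1.tsum_sub s2]
    exact tsum_congr fun l => by simp only [diagDiff, diagShift]; ring
  have e2 : starMul (diagDiff A) B m n = starMul (diagShift A) B m n - starMul A B m n := by
    simp only [starMul]
    rw [← s2.tsum_sub s3]
    exact tsum_congr fun l => by simp only [diagDiff, diagShift]; ring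
  rw [Pi.add_apply, Pi.add_apply, diagDiff, h1, e1, e2]
  ring

theorem DecayBound.sub {α : ℝ} {M M' : ℤ → ℤ → ℂ} (h : DecayBound α M) (h' : DecayBound α M') :
    DecayBound α (M - M') := by
  have := h.add (h'.smul (-1))
  simpa [sub_eq_add_neg] using this

theorem DecayBound.diagDiff {α : ℝ} {M : ℤ → ℤ → ℂ} (h : DecayBound α M) :
    DecayBound α (diagDiff M) := h.diagShift.sub h

theorem diagDiff_mulDefect {α β : ℝ} {A B : ℤ → ℤ → ℂ} (hA : DecayBound α A)
    (hB : DecayBound β B) :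
    diagDiff (mulDefect A B) = mulDefect (diagShift A) (diagDiff B) + mulDefect (diagDiff A) B := by
  rw [mulDefect_eq hA hB, mulDefect_eq hA.diagShift hB.diagDiff, mulDefect_eq hA.diagDiff hB]
  have h : ∀ M M' : ℤ → ℤ → ℂ, diagDiff (M - M') = diagDiff M - diagDiff M' := by
    intro M M'; funext m n; simp only [diagDiff, Pi.sub_apply]; ring
  rw [h, diagDiff_matMul hA hB, diagDiff_starMul hA hB]
  abel

theorem PDMatrixUpTo.matMul {k : ℕ} {α β : ℝ} {A B : ℤ → ℤ → ℂ} (hA : PDMatrixUpTo k α A)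
    (hB : PDMatrixUpTo k β B) : PDMatrixUpTo k (α + β) (matMul A B) := by
  induction k generalizing α β A B with
  | zero => exact DecayBound.matMul hA hB
  | succ k ih =>
    refine ⟨hA.1.matMul hB.1, ?_⟩
    rw [diagDiff_matMul hA.1 hB.1]
    refine PDMatrixUpTo.add ?_ ?_
    · rw [show α + β - 1 = α + (β - 1) by ring]
      exact ih hA.of_succ.shift hB.2
    · rw [show α + β - 1 = (α - 1) + β by ring]
      exact ih hA.2 hB.of_succ

/-- The gain of one order comes from telescoping A along its diagonals, which uses one difference of
A more than is obtained for the defect. The Leibniz rule propagates the estimate to higher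
differences. -/
theorem PDMatrixUpTo.mulDefect {k : ℕ} {α β : ℝ} {A B : ℤ → ℤ → ℂ} (hA : PDMatrixUpTo (k + 1) α A)
    (hB : PDMatrixUpTo k β B) : PDMatrixUpTo k (α + β - 1) (mulDefect A B) := by
  induction k generalizing α β A B with
  | zero =>
    rw [show α + β - 1 = (α - 1) + β by ring]
    exact (DecayBound.twistedBound_sub hA.2).decayBound hB
  | succ k ih =>
    constructor
    · rw [show α + β - 1 = (α - 1) + β by ring]
      exact (DecayBound.twistedBound_sub hA.2.decayBound).decayBound hB.1
    · rw [diagDiff_mulDefect hA.1 hB.1]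
      refine PDMatrixUpTo.add ?_ ?_
      · rw [show α + β - 1 - 1 = α + (β - 1) - 1 by ring]
        exact ih hA.of_succ.shift hB.2
      · rw [show α + β - 1 - 1 = (α - 1) + β - 1 by ring]
        exact ih hA.2 hB.of_succ

theorem IsPDMatrix.matMul {α β : ℝ} {A B : ℤ → ℤ → ℂ} (hA : IsPDMatrix α A)
    (hB : IsPDMatrix β B) : IsPDMatrix (α + β) (matMul A B) := fun k => (hA k).matMul (hB k)

theorem IsPDMatrix.mulDefect {α β : ℝ} {A B : ℤ → ℤ → ℂ} (hA : IsPDMatrix α A)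
    (hB : IsPDMatrix β B) : IsPDMatrix (α + β - 1) (mulDefect A B) :=
  fun k => (hA (k + 1)).mulDefect (hB k)

/-- Since `starMul` is commutative, it cancels between the two products, and the commutator is a
difference of two defects. -/
theorem IsPDMatrix.commutator {α β : ℝ} {A B : ℤ → ℤ → ℂ} (hA : IsPDMatrix α A)
    (hB : IsPDMatrix β B) : IsPDMatrix (α + β - 1) (_root_.matMul A B - _root_.matMul B A) := by
  have h := (hA.mulDefect hB).sub (by simpa only [add_comm α β] using hB.mulDefect hA)
  rwa [mulDefect_eq hA.decayBound hB.decayBound, mulDefect_eq hB.decayBound hA.decayBound,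
    starMul_comm B A, sub_sub_sub_cancel_right] at h

/-! ### Matrices with finitely many columns, smoothing matrices -/

theorem isPDMatrix_zero (α : ℝ) : IsPDMatrix α 0 := by
  intro k
  induction k generalizing α with
  | zero => intro N; exact ⟨0, fun m n => by simp⟩
  | succ k ih =>
    refine ⟨(ih α).decayBound, ?_⟩
    have : diagDiff (0 : ℤ → ℤ → ℂ) = 0 := by funext m n; simp [diagDiff]
    rw [this]
    exact ih _

theorem norm_mul_bracket_le_of_bound {D : ℤ → ℤ → ℂ} {α C : ℝ} {N : ℕ}
    (h : ∀ m n : ℤ, bracket (m : ℝ) ^ (N + ⌈|α|⌉₊) * bracket (n : ℝ) ^ (N + ⌈|α|⌉₊) * ‖D m n‖ ≤ C)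
    (m n : ℤ) : bracket ((m : ℝ) - n) ^ N * ‖D m n‖ ≤ C * bracket (n : ℝ) ^ α := by
  have h1 : bracket ((m : ℝ) - n) ≤ bracket (m : ℝ) * bracket (n : ℝ) := by
    simpa [sub_eq_add_neg, bracket_neg] using bracket_add_le (m : ℝ) (-n)
  -- This pays for the factor (1 + |n|)^α on the right, whatever the sign of α.
  have h2 : 1 ≤ bracket (n : ℝ) ^ ⌈|α|⌉₊ * bracket (n : ℝ) ^ α := by
    simpa [bracket_neg, bracket_zero] using peetre_pow 0 (n : ℝ) α
  have h3 := h m n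
  set a := bracket (m : ℝ) with ha
  set b := bracket (n : ℝ) with hb
  have ha1 : 1 ≤ a := one_le_bracket _
  have hb1 : 1 ≤ b := one_le_bracket _
  have hbα : 0 ≤ b ^ α := bracket_rpow_nonneg _ _
  calc bracket ((m : ℝ) - n) ^ N * ‖D m n‖ ≤ (a * b) ^ N * ‖D m n‖ := by
        have := bracket_nonneg ((m : ℝ) - n)
        gcongr
    _ = (a ^ N * b ^ N * ‖D m n‖) * 1 := by ring
    _ ≤ (a ^ N * b ^ N * ‖D m n‖) * (b ^ ⌈|α|⌉₊ * b ^ α) := by gcongr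
    _ = (a ^ N * b ^ (N + ⌈|α|⌉₊) * ‖D m n‖) * b ^ α := by ring
    _ ≤ (a ^ (N + ⌈|α|⌉₊) * b ^ (N + ⌈|α|⌉₊) * ‖D m n‖) * b ^ α := by
        gcongr
        omega
    _ ≤ C * b ^ α := by gcongr

theorem norm_diagDiff_bound {D : ℤ → ℤ → ℂ} {C : ℝ} {N : ℕ}
    (h : ∀ m n : ℤ, bracket (m : ℝ) ^ N * bracket (n : ℝ) ^ N * ‖D m n‖ ≤ C) :
    ∃ C' : ℝ, ∀ m n : ℤ, bracket (m : ℝ) ^ N * bracket (n : ℝ) ^ N * ‖diagDiff D m n‖ ≤ C' := by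
  refine ⟨C * (bracket 1 ^ N * bracket 1 ^ N) + C, fun m n => ?_⟩
  have h1 := h (m + 1) (n + 1)
  have h2 := h m n
  have e : ∀ x : ℝ, bracket x ^ N ≤ bracket (x + 1) ^ N * bracket 1 ^ N := by
    intro x
    rw [← mul_pow]
    refine pow_le_pow_left₀ (bracket_nonneg _) ?_ N
    have := bracket_add_le (x + 1) (-1)
    simpa [bracket_neg] using this
  have h3 := mul_le_mul (e m) (e n) (pow_nonneg (bracket_nonneg _) _)
    (mul_nonneg (pow_nonneg (bracket_nonneg _) _) (pow_nonneg (bracket_nonneg _) _))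
  push_cast at h1
  have hq : 0 ≤ bracket (1 : ℝ) ^ N * bracket (1 : ℝ) ^ N :=
    mul_nonneg (pow_nonneg (bracket_nonneg _) _) (pow_nonneg (bracket_nonneg _) _)
  have hp : 0 ≤ bracket (m : ℝ) ^ N * bracket (n : ℝ) ^ N :=
    mul_nonneg (pow_nonneg (bracket_nonneg _) _) (pow_nonneg (bracket_nonneg _) _)
  calc _ ≤ bracket (m : ℝ) ^ N * bracket (n : ℝ) ^ N * (‖D (m + 1) (n + 1)‖ + ‖D m n‖) :=
        mul_le_mul_of_nonneg_left (norm_sub_le _ _) hp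
    _ = bracket (m : ℝ) ^ N * bracket (n : ℝ) ^ N * ‖D (m + 1) (n + 1)‖ +
        bracket (m : ℝ) ^ N * bracket (n : ℝ) ^ N * ‖D m n‖ := by ring
    _ ≤ (bracket ((m : ℝ) + 1) ^ N * bracket ((n : ℝ) + 1) ^ N * ‖D (m + 1) (n + 1)‖) *
          (bracket 1 ^ N * bracket 1 ^ N) + C := by
        refine add_le_add ?_ h2
        have := mul_le_mul_of_nonneg_right h3 (norm_nonneg (D (m + 1) (n + 1)))
        linarith
    _ ≤ _ := by gcongr

/-- A matrix approximated, up to arbitrarily fast decaying errors, by matrices of order `α` is of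
order `α`. -/
theorem IsPDMatrix.of_approx {α : ℝ} {M : ℤ → ℤ → ℂ}
    (h : ∀ N : ℕ, ∃ S : ℤ → ℤ → ℂ, IsPDMatrix α S ∧ ∃ C : ℝ, ∀ m n : ℤ,
      bracket (m : ℝ) ^ N * bracket (n : ℝ) ^ N * ‖(M - S) m n‖ ≤ C) : IsPDMatrix α M := by
  intro k
  induction k generalizing M α with
  | zero =>
    intro N
    obtain ⟨S, hS, C, hC⟩ := h (N + ⌈|α|⌉₊)
    obtain ⟨D, hD⟩ := hS.decayBound N
    refine ⟨C + D, fun m n => ?_⟩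
    have h1 := norm_mul_bracket_le_of_bound hC m n
    have h2 := hD m n
    have h3 : ‖M m n‖ ≤ ‖(M - S) m n‖ + ‖S m n‖ := by
      simpa using norm_add_le ((M - S) m n) (S m n)
    have h4 := mul_le_mul_of_nonneg_left h3 (pow_nonneg (bracket_nonneg ((m : ℝ) - n)) N)
    linarith
  | succ k ih =>
    -- The differences of the approximants approximate the difference matrix and have order α - 1,
    -- so the hypothesis reproduces itself.
    refine ⟨(ih h).decayBound, ih fun N => ?_⟩
    obtain ⟨S, hS, C, hC⟩ := h N
    refine ⟨_root_.diagDiff S, hS.diagDiff, ?_⟩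
    have : _root_.diagDiff M - _root_.diagDiff S = _root_.diagDiff (M - S) := by
      funext m n; simp only [_root_.diagDiff, Pi.sub_apply]; ring
    rw [this]
    exact norm_diagDiff_bound hC

theorem IsPDMatrix.of_forall_bound {M : ℤ → ℤ → ℂ}
    (h : ∀ N : ℕ, ∃ C : ℝ, ∀ m n : ℤ, bracket (m : ℝ) ^ N * bracket (n : ℝ) ^ N * ‖M m n‖ ≤ C)
    (α : ℝ) : IsPDMatrix α M :=
  IsPDMatrix.of_approx fun N => ⟨0, isPDMatrix_zero α, by simpa using h N⟩

/-- The columns of `M` with index `n` such that `|n| < L`. -/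
def lowColumns (L : ℕ) (M : ℤ → ℤ → ℂ) (m n : ℤ) : ℂ := if n.natAbs < L then M m n else 0

/-- On columns with |n| < L, decay in m - n is decay in m, and every power of 1 + |n| is bounded. -/
theorem DecayBound.lowColumns {α : ℝ} {M : ℤ → ℤ → ℂ} (hM : DecayBound α M) (L : ℕ) (β : ℝ) :
    IsPDMatrix β (lowColumns L M) := by
  refine IsPDMatrix.of_forall_bound (fun N => ?_) β
  obtain ⟨C, hC⟩ := hM N
  have hC0 := DecayBound.const_nonneg hC
  refine ⟨C * bracket (L : ℝ) ^ (2 * N + ⌈|α|⌉₊), fun m n => ?_⟩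
  unfold _root_.lowColumns
  split_ifs with hn
  · have h1 : bracket (m : ℝ) ^ N ≤ bracket ((m : ℝ) - n) ^ N * bracket (n : ℝ) ^ N := by
      rw [← mul_pow]
      exact pow_le_pow_left₀ (bracket_nonneg _) (bracket_le_mul_sub _ _) N
    have h2 : bracket (n : ℝ) ^ α ≤ bracket (n : ℝ) ^ ⌈|α|⌉₊ := by
      simpa [bracket_zero] using peetre_pow (n : ℝ) 0 α
    have h3 : bracket (n : ℝ) ≤ bracket (L : ℝ) := by
      have : |(n : ℝ)| = (n.natAbs : ℝ) := by rw [Nat.cast_natAbs, Int.cast_abs]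
      rw [bracket, bracket, this, Nat.abs_cast]
      have : (n.natAbs : ℝ) ≤ L := by exact_mod_cast hn.le
      linarith
    have h4 := hC m n
    have hb := bracket_nonneg (n : ℝ)
    have hb' := bracket_nonneg ((m : ℝ) - n)
    calc bracket (m : ℝ) ^ N * bracket (n : ℝ) ^ N * ‖M m n‖
        ≤ (bracket ((m : ℝ) - n) ^ N * bracket (n : ℝ) ^ N) * bracket (n : ℝ) ^ N * ‖M m n‖ := by
          gcongr
      _ = bracket (n : ℝ) ^ (2 * N) * (bracket ((m : ℝ) - n) ^ N * ‖M m n‖) := by ring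
      _ ≤ bracket (n : ℝ) ^ (2 * N) * (C * bracket (n : ℝ) ^ ⌈|α|⌉₊) := by
          refine mul_le_mul_of_nonneg_left (h4.trans ?_) (pow_nonneg hb _)
          gcongr
      _ = C * bracket (n : ℝ) ^ (2 * N + ⌈|α|⌉₊) := by ring
      _ ≤ _ := by gcongr
  · rw [norm_zero, mul_zero]
    exact mul_nonneg hC0 (pow_nonneg (bracket_nonneg _) _)

theorem IsPDMatrix.lowColumns {α : ℝ} {M : ℤ → ℤ → ℂ} (hM : IsPDMatrix α M) (L : ℕ) (β : ℝ) :
    IsPDMatrix β (lowColumns L M) := hM.decayBound.lowColumns L β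

/-! ### Unit, bilinearity and associativity of the matrix product. -/

/-- The identity matrix. -/
def matOne (m n : ℤ) : ℂ := if m = n then 1 else 0

theorem isPDMatrix_matOne : IsPDMatrix 0 matOne := by
  have hd : diagDiff matOne = 0 := by funext m n; simp [diagDiff, matOne]
  have hb : DecayBound 0 matOne := by
    intro N
    refine ⟨1, fun m n => ?_⟩
    unfold matOne
    split_ifs with h
    · simp [h, bracket_zero]
    · simp
  intro k
  cases k with
  | zero => exact hb
  | succ k => exact ⟨hb, by rw [hd]; exact isPDMatrix_zero _ k⟩

theorem matMul_matOne (A : ℤ → ℤ → ℂ) : matMul A matOne = A := by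
  funext m n
  rw [matMul, tsum_eq_single n (fun l hl => by simp [matOne, hl])]
  simp [matOne]

theorem matOne_matMul (A : ℤ → ℤ → ℂ) : matMul matOne A = A := by
  funext m n
  rw [matMul, tsum_eq_single m (fun l hl => by simp [matOne, hl.symm])]
  simp [matOne]

theorem matMul_add_right {α β γ : ℝ} {A B B' : ℤ → ℤ → ℂ} (hA : DecayBound α A)
    (hB : DecayBound β B) (hB' : DecayBound γ B') :
    matMul A (B + B') = matMul A B + matMul A B' := by
  funext m n
  simp only [Pi.add_apply, matMul, mul_add]
  exact (hA.summable_mul hB m n).of_norm.tsum_add (hA.summable_mul hB' m n).of_norm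

theorem matMul_add_left {α β γ : ℝ} {A A' B : ℤ → ℤ → ℂ} (hA : DecayBound α A)
    (hA' : DecayBound γ A') (hB : DecayBound β B) :
    matMul (A + A') B = matMul A B + matMul A' B := by
  funext m n
  simp only [Pi.add_apply, matMul, add_mul]
  exact (hA.summable_mul hB m n).of_norm.tsum_add (hA'.summable_mul hB m n).of_norm

theorem matMul_sub_right {α β γ : ℝ} {A B B' : ℤ → ℤ → ℂ} (hA : DecayBound α A)
    (hB : DecayBound β B) (hB' : DecayBound γ B') :
    matMul A (B - B') = matMul A B - matMul A B' := by
  funext m n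
  simp only [Pi.sub_apply, matMul, mul_sub]
  exact (hA.summable_mul hB m n).of_norm.tsum_sub (hA.summable_mul hB' m n).of_norm

theorem matMul_sub_left {α β γ : ℝ} {A A' B : ℤ → ℤ → ℂ} (hA : DecayBound α A)
    (hA' : DecayBound γ A') (hB : DecayBound β B) :
    matMul (A - A') B = matMul A B - matMul A' B := by
  funext m n
  simp only [Pi.sub_apply, matMul, sub_mul]
  exact (hA.summable_mul hB m n).of_norm.tsum_sub (hA'.summable_mul hB m n).of_norm

theorem DecayBound.norm {α : ℝ} {A : ℤ → ℤ → ℂ} (hA : DecayBound α A) :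
    DecayBound α (fun m n => (‖A m n‖ : ℂ)) := by
  intro N
  obtain ⟨C, hC⟩ := hA N
  exact ⟨C, fun m n => by simpa using hC m n⟩

/-- Fubini for the double series. Only row m of A and column n of C occur, so a vector can take the
place of C; `matVec_matMul` uses this. -/
theorem matMul_assoc_apply {A B C : ℤ → ℤ → ℂ} {m n : ℤ}
    (h : Summable fun p : ℤ × ℤ => A m p.1 * B p.1 p.2 * C p.2 n) :
    matMul (matMul A B) C m n = matMul A (matMul B C) m n := by
  simp only [matMul, ← tsum_mul_left, ← tsum_mul_right]
  rw [Summable.tsum_comm (f := fun l k => A m l * B l k * C k n) h]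
  exact tsum_congr fun l => tsum_congr fun k => by ring

theorem matMul_assoc {α β γ : ℝ} {A B C : ℤ → ℤ → ℂ} (hA : DecayBound α A)
    (hB : DecayBound β B) (hC : DecayBound γ C) :
    matMul (matMul A B) C = matMul A (matMul B C) := by
  funext m n
  refine matMul_assoc_apply (Summable.of_norm ?_)
  refine (summable_prod_of_nonneg fun _ => norm_nonneg _).mpr ⟨fun l => ?_, ?_⟩
  · refine ((hB.summable_mul hC l n).mul_left ‖A m l‖).congr fun k => ?_
    simp only [norm_mul]; ring
  · refine (hA.summable_mul (hB.norm.matMul hC.norm) m n).congr fun l => ?_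
    -- The matrices of absolute values satisfy the same decay bounds, so absolute summability of the
    -- double series is an instance of the estimate for products.
    have h1 : matMul (fun m n => (‖B m n‖ : ℂ)) (fun m n => (‖C m n‖ : ℂ)) l n =
        ((∑' k, ‖B l k * C k n‖ : ℝ) : ℂ) := by
      rw [matMul, Complex.ofReal_tsum]
      exact tsum_congr fun k => by rw [norm_mul, Complex.ofReal_mul]
    rw [norm_mul, h1, Complex.norm_real,
      Real.norm_of_nonneg (tsum_nonneg fun _ => norm_nonneg _), ← tsum_mul_left]
    exact tsum_congr fun k => by simp only [norm_mul]; ring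

/-! ### Boundedness on Sobolev spaces -/

theorem one_add_sq_le_bracket_sq (x : ℝ) : 1 + x ^ 2 ≤ bracket x ^ 2 := by
  unfold bracket
  nlinarith [abs_nonneg x, sq_abs x]

theorem bracket_sq_le (x : ℝ) : bracket x ^ 2 ≤ 2 * (1 + x ^ 2) := by
  unfold bracket
  nlinarith [sq_abs x, sq_nonneg (1 - |x|)]

/-- The weights 1 + x² and (1 + |x|)² agree up to a factor 2, so their powers agree up to 2^|s|. -/
theorem rpow_one_add_sq_le (x s : ℝ) : (1 + x ^ 2) ^ s ≤ 2 ^ |s| * (bracket x ^ s) ^ 2 := by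
  have hx : 0 < 1 + x ^ 2 := by positivity
  rw [← Real.rpow_natCast (bracket x ^ s), ← Real.rpow_mul (bracket_nonneg x), mul_comm s,
    Real.rpow_mul (bracket_nonneg x), Real.rpow_natCast]
  rcases le_total 0 s with hs | hs
  · have h1 : (1 : ℝ) ≤ 2 ^ |s| := Real.one_le_rpow (by norm_num) (abs_nonneg s)
    have h2 := Real.rpow_le_rpow hx.le (one_add_sq_le_bracket_sq x) hs
    have h3 : 0 ≤ (bracket x ^ 2) ^ s := Real.rpow_nonneg (sq_nonneg _) s
    nlinarith
  · have h2 := Real.rpow_le_rpow_of_nonpos (pow_pos (bracket_pos x) 2) (bracket_sq_le x) hs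
    rw [Real.mul_rpow (by norm_num) hx.le] at h2
    rw [abs_of_nonpos hs]
    have h3 := mul_le_mul_of_nonneg_left h2 (Real.rpow_nonneg (by norm_num : (0 : ℝ) ≤ 2) (-s))
    rwa [← mul_assoc, ← Real.rpow_add (by norm_num), neg_add_cancel, Real.rpow_zero, one_mul] at h3

theorem bracket_rpow_sq_le (x s : ℝ) : (bracket x ^ s) ^ 2 ≤ 2 ^ |s| * (1 + x ^ 2) ^ s := by
  have hx : 0 < 1 + x ^ 2 := by positivity
  rw [← Real.rpow_natCast (bracket x ^ s), ← Real.rpow_mul (bracket_nonneg x), mul_comm s,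
    Real.rpow_mul (bracket_nonneg x), Real.rpow_natCast]
  rcases le_total 0 s with hs | hs
  · have h2 := Real.rpow_le_rpow (sq_nonneg _) (bracket_sq_le x) hs
    rw [Real.mul_rpow (by norm_num) hx.le] at h2
    rwa [abs_of_nonneg hs]
  · have h1 : (1 : ℝ) ≤ 2 ^ |s| := Real.one_le_rpow (by norm_num) (abs_nonneg s)
    have h2 := Real.rpow_le_rpow_of_nonpos hx (one_add_sq_le_bracket_sq x) hs
    have h3 : 0 ≤ (1 + x ^ 2) ^ s := Real.rpow_nonneg hx.le s
    nlinarith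

theorem mem_seqSobolev_iff_bracket {ι : Type} {c : ι → ℝ} {s : ℝ} {v : ι → ℂ} :
    v ∈ seqSobolev c s ↔ Summable fun i => (bracket (c i) ^ s * ‖v i‖) ^ 2 := by
  constructor
  · intro h
    refine Summable.of_nonneg_of_le (fun _ => sq_nonneg _) (fun i => ?_)
      (Summable.mul_left (2 ^ |s|) h)
    rw [mul_pow, ← mul_assoc]
    exact mul_le_mul_of_nonneg_right (bracket_rpow_sq_le _ _) (sq_nonneg _)
  · intro h
    refine Summable.of_nonneg_of_le (fun i => by positivity) (fun i => ?_) (h.mul_left (2 ^ |s|))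
    rw [mul_pow, ← mul_assoc]
    exact mul_le_mul_of_nonneg_right (rpow_one_add_sq_le _ _) (sq_nonneg _)

theorem bracketSum_pos : 0 < bracketSum := by
  have h := summable_bracket_inv_sq.le_tsum 0 (fun n _ => inv_nonneg.mpr (sq_nonneg _))
  simp only [Int.cast_zero, bracket_zero, one_pow, inv_one] at h
  exact lt_of_lt_of_le one_pos h

theorem summable_bracket_mul_of_sq {g : ℤ → ℝ} (hg : Summable fun n => g n ^ 2) (m : ℤ) :
    (Summable fun n : ℤ => (bracket ((m : ℝ) - n) ^ 2)⁻¹ * g n) ∧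
    (Summable fun n : ℤ => (bracket ((m : ℝ) - n) ^ 2)⁻¹ * g n ^ 2) := by
  have hK := (hasSum_bracket_sub' m).summable
  have hK0 : ∀ n : ℤ, 0 ≤ (bracket ((m : ℝ) - n) ^ 2)⁻¹ := fun n => inv_nonneg.mpr (sq_nonneg _)
  have hK1 : ∀ n : ℤ, (bracket ((m : ℝ) - n) ^ 2)⁻¹ ≤ 1 :=
    fun n => inv_le_one_of_one_le₀ (one_le_bracket_pow _ 2)
  have h2 : Summable fun n : ℤ => (bracket ((m : ℝ) - n) ^ 2)⁻¹ * g n ^ 2 :=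
    Summable.of_nonneg_of_le (fun n => mul_nonneg (hK0 n) (sq_nonneg _))
      (fun n => mul_le_of_le_one_left (sq_nonneg _) (hK1 n)) hg
  -- The elementary bound |g| ≤ 1 + g² is used under the summable kernel.
  refine ⟨Summable.of_norm_bounded (hK.add h2) (fun n => ?_), h2⟩
  rw [norm_mul, Real.norm_of_nonneg (hK0 n), Real.norm_eq_abs, ← mul_one_add]
  refine mul_le_mul_of_nonneg_left ?_ (hK0 n)
  nlinarith [sq_abs (g n), sq_nonneg (|g n| - 1)]

/-- Young's inequality for the kernel `(1 + |n|)⁻²`. -/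
theorem young_bracket {f g : ℤ → ℝ} (hf0 : ∀ m, 0 ≤ f m) (hg : Summable fun n => g n ^ 2)
    (hf : ∀ m, f m ≤ ∑' n : ℤ, (bracket ((m : ℝ) - n) ^ 2)⁻¹ * g n) :
    (Summable fun m => f m ^ 2) ∧ ∑' m, f m ^ 2 ≤ bracketSum ^ 2 * ∑' n, g n ^ 2 := by
  have hS := bracketSum_pos
  have hcs : ∀ m, f m ^ 2 ≤ bracketSum * ∑' n : ℤ, (bracket ((m : ℝ) - n) ^ 2)⁻¹ * g n ^ 2 := by
    intro m
    obtain ⟨h1, h2⟩ := summable_bracket_mul_of_sq hg m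
    set t := ∑' n : ℤ, (bracket ((m : ℝ) - n) ^ 2)⁻¹ * g n with ht
    set Q := ∑' n : ℤ, (bracket ((m : ℝ) - n) ^ 2)⁻¹ * g n ^ 2
    have h3 := ((h2.hasSum.mul_left (bracketSum ^ 2)).sub
      (h1.hasSum.mul_left (2 * t * bracketSum))).add ((hasSum_bracket_sub' m).mul_left (t ^ 2))
    -- Cauchy–Schwarz: with S the total mass of the kernel K, this is the expansion of ∑ K (S g -
    -- t)² ≥ 0, and it factors as S (S Q - t²).
    have h4 : 0 ≤ bracketSum ^ 2 * Q - 2 * t * bracketSum * t + t ^ 2 * bracketSum := by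
      refine h3.nonneg (fun n => ?_)
      have : bracketSum ^ 2 * ((bracket ((m : ℝ) - n) ^ 2)⁻¹ * g n ^ 2) -
          2 * t * bracketSum * ((bracket ((m : ℝ) - n) ^ 2)⁻¹ * g n) +
          t ^ 2 * (bracket ((m : ℝ) - n) ^ 2)⁻¹ =
          (bracket ((m : ℝ) - n) ^ 2)⁻¹ * (bracketSum * g n - t) ^ 2 := by ring
      rw [this]
      exact mul_nonneg (inv_nonneg.mpr (sq_nonneg _)) (sq_nonneg _)
    have h5 : 0 ≤ bracketSum * (bracketSum * Q - t ^ 2) := by linarith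
    have h6 := nonneg_of_mul_nonneg_right h5 hS
    have h7 : f m ^ 2 ≤ t ^ 2 := pow_le_pow_left₀ (hf0 m) (hf m) 2
    linarith
  obtain ⟨K, hK⟩ : ∃ K : ℤ → ℤ → ℝ, ∀ m n, K m n = (bracket ((m : ℝ) - n) ^ 2)⁻¹ := ⟨_, fun _ _ => rfl⟩
  have hKs : ∀ n, HasSum (fun m => K m n) bracketSum := by
    intro n; simpa only [hK] using hasSum_bracket_sub n
  have hK0 : ∀ m n, 0 ≤ K m n := fun m n => by rw [hK]; exact inv_nonneg.mpr (sq_nonneg _)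
  simp only [← hK] at hcs
  -- The other half of the Schur test: for fixed n the kernel has the same mass S as a function of
  -- m, and the order of summation may be exchanged.
  have hprod : Summable fun p : ℤ × ℤ => K p.2 p.1 * g p.1 ^ 2 := by
    refine (summable_prod_of_nonneg (fun p => mul_nonneg (hK0 _ _) (sq_nonneg _))).mpr
      ⟨fun n => ?_, ?_⟩
    · have h := (hKs n).summable.mul_right (g n ^ 2)
      exact h
    refine (hg.mul_left bracketSum).congr fun n => ?_
    change _ = ∑' m, K m n * g n ^ 2
    rw [tsum_mul_right, (hKs n).tsum_eq]
  have hsw : Summable fun p : ℤ × ℤ => K p.1 p.2 * g p.2 ^ 2 := hprod.prod_symm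
  have hsum : Summable fun m : ℤ => ∑' n : ℤ, K m n * g n ^ 2 := hsw.prod
  have hf2 : Summable fun m => f m ^ 2 :=
    Summable.of_nonneg_of_le (fun _ => sq_nonneg _) hcs (hsum.mul_left _)
  refine ⟨hf2, (hf2.tsum_le_tsum hcs (hsum.mul_left _)).trans (le_of_eq ?_)⟩
  rw [tsum_mul_left, Summable.tsum_comm (f := fun n m : ℤ => K m n * g n ^ 2) hprod, sq, mul_assoc,
    ← tsum_mul_left (a := bracketSum) (f := fun n => g n ^ 2)]
  congr 1
  exact tsum_congr fun n => by rw [tsum_mul_right, (hKs n).tsum_eq]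

/-- The product of an infinite matrix and a sequence. -/
noncomputable def matVec (M : ℤ → ℤ → ℂ) (v : ℤ → ℂ) (m : ℤ) : ℂ := ∑' n, M m n * v n

theorem DecayBound.norm_mul_vec_le {α : ℝ} {M : ℤ → ℤ → ℂ} (hM : DecayBound α M) (s : ℝ) :
    ∃ C : ℝ, 0 ≤ C ∧ ∀ (v : ℤ → ℂ) (m n : ℤ), bracket (m : ℝ) ^ (s - α) * ‖M m n * v n‖ ≤
      (bracket ((m : ℝ) - n) ^ 2)⁻¹ * (C * (bracket (n : ℝ) ^ s * ‖v n‖)) := by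
  -- The first exponent is the cost of moving the weight s - α from m to n; the 2 leaves the Young
  -- kernel.
  obtain ⟨C, hC⟩ := hM (⌈|s - α|⌉₊ + 2)
  have hC0 := DecayBound.const_nonneg hC
  refine ⟨C, hC0, fun v m n => ?_⟩
  have h1 := peetre_pow (m : ℝ) n (s - α)
  have h2 := hC m n
  have hb : 0 < bracket ((m : ℝ) - n) ^ 2 := pow_pos (bracket_pos _) 2
  rw [inv_mul_eq_div, le_div_iff₀ hb, norm_mul]
  have h3 : bracket (n : ℝ) ^ s = bracket (n : ℝ) ^ (s - α) * bracket (n : ℝ) ^ α := by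
    rw [← bracket_rpow_add, sub_add_cancel]
  have hn := bracket_rpow_nonneg (n : ℝ) (s - α)
  calc bracket (m : ℝ) ^ (s - α) * (‖M m n‖ * ‖v n‖) * bracket ((m : ℝ) - n) ^ 2
      ≤ (bracket ((m : ℝ) - n) ^ ⌈|s - α|⌉₊ * bracket (n : ℝ) ^ (s - α)) *
        (‖M m n‖ * ‖v n‖) * bracket ((m : ℝ) - n) ^ 2 := by gcongr
    _ = bracket (n : ℝ) ^ (s - α) * ‖v n‖ *
        (bracket ((m : ℝ) - n) ^ (⌈|s - α|⌉₊ + 2) * ‖M m n‖) := by ring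
    _ ≤ bracket (n : ℝ) ^ (s - α) * ‖v n‖ * (C * bracket (n : ℝ) ^ α) := by gcongr
    _ = C * (bracket (n : ℝ) ^ s * ‖v n‖) := by rw [h3]; ring

theorem DecayBound.summable_mul_vec {α : ℝ} {M : ℤ → ℤ → ℂ} (hM : DecayBound α M) {v : ℤ → ℂ}
    (hv : v ∈ HPerNegInf) (m : ℤ) : Summable fun n => ‖M m n * v n‖ := by
  obtain ⟨s, hs⟩ := hv
  obtain ⟨C, hC0, hC⟩ := hM.norm_mul_vec_le s
  have hg : Summable fun n : ℤ => (C * (bracket (n : ℝ) ^ s * ‖v n‖)) ^ 2 := by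
    simpa only [mul_pow C] using (mem_seqSobolev_iff_bracket.mp hs).mul_left (C ^ 2)
  have h1 : Summable fun n : ℤ => bracket (m : ℝ) ^ (s - α) * ‖M m n * v n‖ :=
    Summable.of_nonneg_of_le (fun n => mul_nonneg (bracket_rpow_nonneg _ _) (norm_nonneg _))
      (hC v m) (summable_bracket_mul_of_sq hg m).1
  exact (summable_mul_left_iff (bracket_rpow_pos _ _).ne').mp h1

/-- A matrix of order `α` is bounded from `H^s` to `H^{s-α}`. -/
theorem DecayBound.matVec_bound {α : ℝ} {M : ℤ → ℤ → ℂ} (hM : DecayBound α M) (s : ℝ) :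
    ∃ C : ℝ, 0 ≤ C ∧ ∀ v : ℤ → ℂ, v ∈ seqSobolev (fun m : ℤ => (m : ℝ)) s →
      matVec M v ∈ seqSobolev (fun m : ℤ => (m : ℝ)) (s - α) ∧
      ∑' m : ℤ, (1 + (m : ℝ) ^ 2) ^ (s - α) * ‖matVec M v m‖ ^ 2 ≤
        C * ∑' n : ℤ, (1 + (n : ℝ) ^ 2) ^ s * ‖v n‖ ^ 2 := by
  obtain ⟨C, hC0, hC⟩ := hM.norm_mul_vec_le s
  refine ⟨2 ^ |s - α| * (bracketSum ^ 2 * (C ^ 2 * 2 ^ |s|)), by positivity, fun v hv => ?_⟩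
  have hvb := mem_seqSobolev_iff_bracket.mp hv
  have hg : Summable fun n : ℤ => (C * (bracket (n : ℝ) ^ s * ‖v n‖)) ^ 2 := by
    simpa only [mul_pow C] using hvb.mul_left (C ^ 2)
  obtain ⟨h1, h2⟩ := young_bracket
    (f := fun m : ℤ => bracket (m : ℝ) ^ (s - α) * ‖matVec M v m‖)
    (fun m => mul_nonneg (bracket_rpow_nonneg _ _) (norm_nonneg _)) hg (fun m => by
      have hs := hM.summable_mul_vec ⟨s, hv⟩ m
      refine (mul_le_mul_of_nonneg_left (norm_tsum_le_tsum_norm hs)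
        (bracket_rpow_nonneg _ _)).trans ?_
      rw [← tsum_mul_left]
      exact (hs.mul_left _).tsum_le_tsum (hC v m) (summable_bracket_mul_of_sq hg m).1)
  have hmem := mem_seqSobolev_iff_bracket.mpr h1
  refine ⟨hmem, ?_⟩
  have h3 : ∑' m : ℤ, (1 + (m : ℝ) ^ 2) ^ (s - α) * ‖matVec M v m‖ ^ 2 ≤
      2 ^ |s - α| * ∑' m : ℤ, (bracket (m : ℝ) ^ (s - α) * ‖matVec M v m‖) ^ 2 := by
    rw [← tsum_mul_left]
    refine Summable.tsum_le_tsum (fun m => ?_) hmem (h1.mul_left _)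
    rw [mul_pow, ← mul_assoc]
    exact mul_le_mul_of_nonneg_right (rpow_one_add_sq_le _ _) (sq_nonneg _)
  have h4 : ∑' n : ℤ, (C * (bracket (n : ℝ) ^ s * ‖v n‖)) ^ 2 ≤
      C ^ 2 * 2 ^ |s| * ∑' n : ℤ, (1 + (n : ℝ) ^ 2) ^ s * ‖v n‖ ^ 2 := by
    rw [← tsum_mul_left]
    refine Summable.tsum_le_tsum (fun m => ?_) hg (Summable.mul_left _ hv)
    rw [mul_pow, mul_pow, mul_assoc]
    refine mul_le_mul_of_nonneg_left ?_ (sq_nonneg _)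
    rw [← mul_assoc]
    exact mul_le_mul_of_nonneg_right (bracket_rpow_sq_le _ _) (sq_nonneg _)
  calc _ ≤ _ := h3
    _ ≤ 2 ^ |s - α| * (bracketSum ^ 2 * (C ^ 2 * 2 ^ |s| *
          ∑' n : ℤ, (1 + (n : ℝ) ^ 2) ^ s * ‖v n‖ ^ 2)) := by
        refine mul_le_mul_of_nonneg_left (h2.trans ?_) (by positivity)
        exact mul_le_mul_of_nonneg_left h4 (by positivity)
    _ = _ := by ring

theorem DecayBound.matVec_mem {α : ℝ} {M : ℤ → ℤ → ℂ} (hM : DecayBound α M) {v : ℤ → ℂ}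
    (hv : v ∈ HPerNegInf) : matVec M v ∈ HPerNegInf := by
  obtain ⟨s, hs⟩ := hv
  obtain ⟨C, -, hC⟩ := hM.matVec_bound s
  exact ⟨s - α, (hC v hs).1⟩

/-- The operator on periodic distributions with matrix `M`. -/
noncomputable def opPer (M : ℤ → ℤ → ℂ) (hM : ∃ α, DecayBound α M) :
    HPerNegInf →ₗ[ℂ] HPerNegInf where
  toFun v := ⟨matVec M v.1, hM.choose_spec.matVec_mem v.2⟩
  map_add' u v := by
    ext m
    change matVec M (u.1 + v.1) m = matVec M u.1 m + matVec M v.1 m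
    simp only [matVec, Pi.add_apply, mul_add]
    exact (hM.choose_spec.summable_mul_vec u.2 m).of_norm.tsum_add
      (hM.choose_spec.summable_mul_vec v.2 m).of_norm
  map_smul' a v := by
    ext m
    change matVec M (a • v.1) m = a * matVec M v.1 m
    simp only [matVec, Pi.smul_apply, smul_eq_mul, mul_left_comm _ a, tsum_mul_left]

theorem opPer_apply (M : ℤ → ℤ → ℂ) (hM : ∃ α, DecayBound α M) (v : HPerNegInf) (m : ℤ) :
    (opPer M hM v).1 m = matVec M v.1 m := rfl

theorem matVec_single (M : ℤ → ℤ → ℂ) (n m : ℤ) : matVec M (Pi.single n 1) m = M m n := by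
  rw [matVec, tsum_eq_single n (fun l hl => by simp [Pi.single_eq_of_ne hl])]
  simp

theorem opPer_expPer (M : ℤ → ℤ → ℂ) (hM : ∃ α, DecayBound α M) (n m : ℤ) :
    (opPer M hM (expPer n)).1 m = M m n := matVec_single M n m

theorem matVec_matMul {α β : ℝ} {A B : ℤ → ℤ → ℂ} (hA : DecayBound α A) (hB : DecayBound β B)
    {v : ℤ → ℂ} (hv : v ∈ HPerNegInf) : matVec (matMul A B) v = matVec A (matVec B v) := by
  have hv' : (fun n => (‖v n‖ : ℂ)) ∈ HPerNegInf := by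
    obtain ⟨s, hs⟩ := hv
    refine ⟨s, ?_⟩
    change Summable _ at hs
    change Summable _
    simpa using hs
  funext m
  refine matMul_assoc_apply (C := fun n _ => v n) (n := 0) (Summable.of_norm ?_)
  refine (summable_prod_of_nonneg fun _ => norm_nonneg _).mpr ⟨fun l => ?_, ?_⟩
  · refine ((hB.summable_mul_vec hv l).mul_left ‖A m l‖).congr fun k => ?_
    simp only [norm_mul]; ring
  · refine (hA.summable_mul_vec (hB.norm.matVec_mem hv') m).congr fun l => ?_
    have h1 : matVec (fun m n => (‖B m n‖ : ℂ)) (fun n => (‖v n‖ : ℂ)) l =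
        ((∑' k, ‖B l k * v k‖ : ℝ) : ℂ) := by
      rw [matVec, Complex.ofReal_tsum]
      exact tsum_congr fun k => by rw [norm_mul, Complex.ofReal_mul]
    rw [norm_mul, h1, Complex.norm_real,
      Real.norm_of_nonneg (tsum_nonneg fun _ => norm_nonneg _), ← tsum_mul_left]
    exact tsum_congr fun k => by simp only [norm_mul]; ring

theorem opPer_comp {A B : ℤ → ℤ → ℂ} (hA : ∃ α, DecayBound α A) (hB : ∃ β, DecayBound β B)
    (hAB : ∃ γ, DecayBound γ (matMul A B)) :
    opPer A hA ∘ₗ opPer B hB = opPer (matMul A B) hAB := by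
  ext v m
  exact (congrFun (matVec_matMul hA.choose_spec hB.choose_spec v.2) m).symm

/-- The matrix of `Op(σ)`. -/
noncomputable def symbolMatrix (σ : ℝ → ℤ → ℂ) (m n : ℤ) : ℂ :=
  fourierCoef (fun θ => σ θ n * Complex.exp (n * θ * Complex.I)) m

theorem isOpPer_opPer (σ : ℝ → ℤ → ℂ) (h : ∃ α, DecayBound α (symbolMatrix σ)) :
    IsOpPer σ (opPer (symbolMatrix σ) h) := by
  intro u m
  exact (h.choose_spec.summable_mul_vec u.2 m).of_norm.hasSum

theorem IsOpPer.apply_eq {σ : ℝ → ℤ → ℂ} {A : HPerNegInf →ₗ[ℂ] HPerNegInf} (hA : IsOpPer σ A)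
    (u : HPerNegInf) (m : ℤ) : (A u).1 m = matVec (symbolMatrix σ) u.1 m :=
  (hA u m).tsum_eq.symm

/-! ### Fourier coefficients -/

theorem norm_exp_int_mul_I (n : ℤ) (θ : ℝ) : ‖Complex.exp (n * θ * Complex.I)‖ = 1 := by
  have := Complex.norm_exp_ofReal_mul_I (n * θ)
  simpa using this

theorem norm_exp_neg_int_mul_I (n : ℤ) (θ : ℝ) : ‖Complex.exp (-(n * θ * Complex.I))‖ = 1 := by
  have := norm_exp_int_mul_I (-n) θ
  simpa using this

theorem fourierCoef_mul_exp (f : ℝ → ℂ) (n m : ℤ) :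
    fourierCoef (fun θ => f θ * Complex.exp (n * θ * Complex.I)) m = fourierCoef f (m - n) := by
  unfold fourierCoef
  congr 1
  refine intervalIntegral.integral_congr fun θ _ => ?_
  simp only
  rw [mul_assoc, ← Complex.exp_add]
  congr 2
  push_cast
  ring

theorem symbolMatrix_apply (σ : ℝ → ℤ → ℂ) (m n : ℤ) :
    symbolMatrix σ m n = fourierCoef (fun θ => σ θ n) (m - n) := fourierCoef_mul_exp _ _ _

theorem norm_fourierCoef_le {f : ℝ → ℂ} {B : ℝ} (h : ∀ θ, ‖f θ‖ ≤ B) (m : ℤ) :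
    ‖fourierCoef f m‖ ≤ B := by
  have h1 : ‖∫ θ in (-Real.pi)..Real.pi, f θ * Complex.exp (-(m * θ * Complex.I))‖ ≤
      B * |Real.pi - -Real.pi| := by
    refine intervalIntegral.norm_integral_le_of_norm_le_const fun θ _ => ?_
    rw [norm_mul, norm_exp_neg_int_mul_I, mul_one]
    exact h θ
  have hpi := Real.pi_pos
  rw [abs_of_pos (by linarith)] at h1
  unfold fourierCoef
  have h2 : ‖(1 / (2 * Real.pi : ℝ) : ℂ)‖ = 1 / (2 * Real.pi) := by
    rw [norm_div, norm_one, Complex.norm_real, Real.norm_of_nonneg (by positivity)]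
  rw [norm_mul, h2]
  calc _ ≤ 1 / (2 * Real.pi) * (B * (Real.pi - -Real.pi)) := by gcongr
    _ = B := by field_simp; ring

theorem fourierCoef_deriv {f : ℝ → ℂ} (hf : Differentiable ℝ f) (hf' : Continuous (deriv f))
    (hper : ∀ θ, f (θ + 2 * Real.pi) = f θ) (m : ℤ) :
    fourierCoef (deriv f) m = m * Complex.I * fourierCoef f m := by
  have he : ∀ θ : ℝ, HasDerivAt (fun θ : ℝ => Complex.exp (-(m * θ * Complex.I)))
      (-(m * Complex.I) * Complex.exp (-(m * θ * Complex.I))) θ := by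
    intro θ
    have h1 : HasDerivAt (fun z : ℂ => Complex.exp (-(m * z * Complex.I)))
        (Complex.exp (-(m * θ * Complex.I)) * -(m * 1 * Complex.I)) (θ : ℂ) :=
      (((hasDerivAt_id (θ : ℂ)).const_mul (m : ℂ)).mul_const Complex.I).neg.cexp
    have h2 := h1.comp_ofReal
    rw [mul_one, mul_comm] at h2
    exact h2
  have hc : Continuous fun θ : ℝ => Complex.exp (-(m * θ * Complex.I)) := by fun_prop
  have h := intervalIntegral.integral_mul_deriv_eq_deriv_mul (a := -Real.pi) (b := Real.pi)
    (fun θ _ => (hf θ).hasDerivAt) (fun θ _ => he θ) (hf'.intervalIntegrable _ _)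
    ((hc.const_mul _).intervalIntegrable _ _)
  have hend : f Real.pi * Complex.exp (-(m * (Real.pi : ℝ) * Complex.I)) -
      f (-Real.pi) * Complex.exp (-(m * ((-Real.pi : ℝ) : ℂ) * Complex.I)) = 0 := by
    have h1 : f Real.pi = f (-Real.pi) := by rw [← hper (-Real.pi)]; congr 1; ring
    have h2 : Complex.exp (-(m * ((-Real.pi : ℝ) : ℂ) * Complex.I)) =
        Complex.exp (-(m * (Real.pi : ℝ) * Complex.I)) := by
      rw [Complex.exp_eq_exp_iff_exists_int]
      exact ⟨m, by push_cast; ring⟩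
    rw [h1, h2, sub_self]
  rw [hend, zero_sub] at h
  unfold fourierCoef
  rw [← neg_eq_iff_eq_neg] at h
  rw [← h]
  have : ∀ θ : ℝ, f θ * (-(m * Complex.I) * Complex.exp (-(m * θ * Complex.I))) =
      -(m * Complex.I) * (f θ * Complex.exp (-(m * θ * Complex.I))) := fun θ => by ring
  simp only [this, intervalIntegral.integral_const_mul]
  ring

theorem periodic_deriv {f : ℝ → ℂ} (hper : ∀ θ, f (θ + 2 * Real.pi) = f θ) (θ : ℝ) :
    deriv f (θ + 2 * Real.pi) = deriv f θ := by
  rw [← deriv_comp_add_const]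
  simp only [hper]

/-- The Fourier coefficients of a smooth periodic function decay rapidly. -/
theorem bracket_pow_mul_fourierCoef_le {f : ℝ → ℂ} (hf : ContDiff ℝ ∞ f)
    (hper : ∀ θ, f (θ + 2 * Real.pi) = f θ) {N : ℕ} {B : ℝ}
    (hB : ∀ i ≤ N, ∀ θ, ‖iteratedDeriv i f θ‖ ≤ B) (m : ℤ) :
    bracket (m : ℝ) ^ N * ‖fourierCoef f m‖ ≤ 2 ^ N * B := by
  induction N generalizing f with
  | zero => simpa using norm_fourierCoef_le (fun θ => by simpa using hB 0 le_rfl θ) m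
  | succ N ih =>
    have h1 := ih hf hper (fun i hi => hB i (by omega))
    have hd : ContDiff ℝ ∞ (deriv f) := (contDiff_infty_iff_deriv.mp hf).2
    have h2 := ih hd (periodic_deriv hper) (fun i hi θ => by
      rw [← iteratedDeriv_succ']; exact hB (i + 1) (by omega) θ)
    rw [fourierCoef_deriv (contDiff_infty_iff_deriv.mp hf).1 hd.continuous hper] at h2
    rw [norm_mul, norm_mul, Complex.norm_I, mul_one, Complex.norm_intCast] at h2
    rw [pow_succ, bracket] at *
    -- One further factor 1 + |m| costs the function plus its derivative; this doubles the constant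
    -- at each step.
    calc _ = (1 + |(m : ℝ)|) ^ N * ‖fourierCoef f m‖ +
          (1 + |(m : ℝ)|) ^ N * (|(m : ℝ)| * ‖fourierCoef f m‖) := by ring
      _ ≤ 2 ^ N * B + 2 ^ N * B := add_le_add h1 h2
      _ = _ := by ring

/-- Fourier inversion. -/
theorem hasSum_fourierCoef {f : ℝ → ℂ} (hf : Continuous f)
    (hper : ∀ θ, f (θ + 2 * Real.pi) = f θ) (hs : Summable fun m => ‖fourierCoef f m‖) (θ : ℝ) :
    HasSum (fun m : ℤ => fourierCoef f m * Complex.exp (m * θ * Complex.I)) (f θ) := by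
  have : Fact (0 < 2 * Real.pi) := ⟨Real.two_pi_pos⟩
  have hp : Function.Periodic f (2 * Real.pi) := hper
  let F : C(AddCircle (2 * Real.pi), ℂ) := ⟨hp.lift, continuous_coinduced_dom.mpr hf⟩
  have hF : ∀ x : ℝ, F (x : AddCircle (2 * Real.pi)) = f x := fun x => rfl
  have hfe : ∀ (n : ℤ) (x : ℝ), fourier n (x : AddCircle (2 * Real.pi)) =
      Complex.exp (n * x * Complex.I) := by
    intro n x
    rw [fourier_coe_apply]
    congr 1
    have : (Real.pi : ℂ) ≠ 0 := Complex.ofReal_ne_zero.mpr Real.pi_ne_zero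
    push_cast
    field_simp
  have hcoef : ∀ n, fourierCoeff F n = fourierCoef f n := by
    intro n
    rw [fourierCoeff_eq_intervalIntegral _ _ (-Real.pi), fourierCoef, Complex.real_smul]
    congr 1
    · push_cast; rfl
    · rw [show -Real.pi + 2 * Real.pi = Real.pi by ring]
      refine intervalIntegral.integral_congr fun x _ => ?_
      simp only [hfe, hF, smul_eq_mul]
      rw [mul_comm]
      congr 2
      push_cast
      ring
  have h := has_pointwise_sum_fourier_series_of_summable (f := F)
    (by rw [funext hcoef]; exact hs.of_norm) (θ : AddCircle (2 * Real.pi))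
  simpa only [hcoef, hfe, hF, smul_eq_mul] using h

/-- The Fourier coefficients of a product are given by a convolution. -/
theorem fourierCoef_tsum_mul {a : ℤ → ℂ} (ha : Summable fun l => ‖a l‖) {g : ℝ → ℂ}
    (hg : Continuous g) {B : ℝ} (hB : ∀ θ, ‖g θ‖ ≤ B) (m : ℤ) :
    fourierCoef (fun θ => (∑' l : ℤ, a l * Complex.exp (l * θ * Complex.I)) * g θ) m =
      ∑' l, a l * fourierCoef g (m - l) := by
  have h := intervalIntegral.hasSum_integral_of_dominated_convergence (a := -Real.pi)
    (b := Real.pi) (μ := volume)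
    (F := fun (l : ℤ) θ => a l * (g θ * Complex.exp (-((m - l : ℤ) * θ * Complex.I))))
    (f := fun θ => (∑' l : ℤ, a l * Complex.exp (l * θ * Complex.I)) * g θ *
      Complex.exp (-(m * θ * Complex.I)))
    (fun l _ => ‖a l‖ * B)
    (fun l => (by fun_prop : Continuous fun θ : ℝ =>
      a l * (g θ * Complex.exp (-((m - l : ℤ) * θ * Complex.I)))).aestronglyMeasurable)
    (fun l => ae_of_all _ fun θ _ => by
      rw [norm_mul, norm_mul, norm_exp_neg_int_mul_I, mul_one]
      exact mul_le_mul_of_nonneg_left (hB θ) (norm_nonneg _))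
    (ae_of_all _ fun θ _ => ha.mul_right B) intervalIntegrable_const
    (ae_of_all _ fun θ _ => by
      have h1 : Summable fun l : ℤ => a l * Complex.exp (l * θ * Complex.I) := by
        refine Summable.of_norm (ha.congr fun l => ?_)
        rw [norm_mul, norm_exp_int_mul_I, mul_one]
      rw [mul_assoc]
      refine (h1.hasSum.mul_right (g θ * Complex.exp (-(m * θ * Complex.I)))).congr_fun fun l => ?_
      have : Complex.exp (-((m - l : ℤ) * θ * Complex.I)) =
          Complex.exp (l * θ * Complex.I) * Complex.exp (-(m * θ * Complex.I)) := by
        rw [← Complex.exp_add]; congr 1; push_cast; ring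
      rw [this]; ring)
  unfold fourierCoef
  rw [← h.tsum_eq, ← tsum_mul_left]
  refine tsum_congr fun l => ?_
  rw [intervalIntegral.integral_const_mul]
  ring

theorem fourierCoef_one (m : ℤ) : fourierCoef (fun _ => 1) m = if m = 0 then 1 else 0 := by
  by_cases hm : m = 0
  · subst hm
    simp only [fourierCoef, Int.cast_zero, zero_mul, neg_zero, Complex.exp_zero, mul_one,
      intervalIntegral.integral_const, if_true, Complex.real_smul]
    rw [show Real.pi - -Real.pi = 2 * Real.pi by ring]
    have : (Real.pi : ℂ) ≠ 0 := Complex.ofReal_ne_zero.mpr Real.pi_ne_zero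
    push_cast
    field_simp
  -- The derivative of a constant vanishes, so i m times the coefficient is 0.
  · have h := fourierCoef_deriv (f := fun _ => (1 : ℂ)) (differentiable_const _)
      (by simpa using continuous_const) (fun _ => rfl) m
    have h0 : fourierCoef (deriv fun _ : ℝ => (1 : ℂ)) m = 0 := by
      simp [fourierCoef]
    rw [h0] at h
    have hm' : (m : ℂ) * Complex.I ≠ 0 :=
      mul_ne_zero (Int.cast_ne_zero.mpr hm) Complex.I_ne_zero
    rw [if_neg hm]
    exact (mul_eq_zero.mp h.symm).resolve_left hm'

theorem fourierCoef_tsum {a : ℤ → ℂ} (ha : Summable fun l => ‖a l‖) (m : ℤ) :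
    fourierCoef (fun θ => ∑' l : ℤ, a l * Complex.exp (l * θ * Complex.I)) m = a m := by
  have h := fourierCoef_tsum_mul ha (g := fun _ => 1) continuous_const (B := 1) (by simp) m
  simp only [mul_one] at h
  rw [h, tsum_eq_single m (fun l hl => by
    rw [fourierCoef_one, if_neg (sub_ne_zero.mpr hl.symm), mul_zero])]
  rw [fourierCoef_one, if_pos (sub_self m), mul_one]

theorem fourierCoef_comp_neg (f : ℝ → ℂ) (m : ℤ) :
    fourierCoef (fun θ => f (-θ)) m = fourierCoef f (-m) := by
  unfold fourierCoef
  congr 1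
  have h := intervalIntegral.integral_comp_neg (a := -Real.pi) (b := Real.pi)
    (fun θ : ℝ => f θ * Complex.exp (-((-m : ℤ) * θ * Complex.I)))
  rw [neg_neg] at h
  rw [← h]
  refine intervalIntegral.integral_congr fun θ _ => ?_
  simp only
  congr 2
  push_cast
  ring

/-! ### The symbol of a matrix -/

/-- The symbol `∑ₘ M(m, n) e^{i(m-n)θ}` of the operator with matrix `M`. -/
noncomputable def matSymbol (M : ℤ → ℤ → ℂ) (θ : ℝ) (n : ℤ) : ℂ :=
  ∑' l : ℤ, M (n + l) n * Complex.exp (l * θ * Complex.I)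

theorem DecayBound.diag_le {α : ℝ} {M : ℤ → ℤ → ℂ} (hM : DecayBound α M) (N : ℕ) :
    ∃ C : ℝ, 0 ≤ C ∧ ∀ l n : ℤ,
      bracket (l : ℝ) ^ N * ‖M (n + l) n‖ ≤ C * bracket (n : ℝ) ^ α := by
  obtain ⟨C, hC⟩ := hM N
  refine ⟨C, DecayBound.const_nonneg hC, fun l n => ?_⟩
  have h := hC (n + l) n
  push_cast at h
  rwa [add_sub_cancel_left] at h

theorem DecayBound.summable_diag {α : ℝ} {M : ℤ → ℤ → ℂ} (hM : DecayBound α M) (n : ℤ) :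
    Summable fun l => ‖M (n + l) n‖ := by
  obtain ⟨C, -, hC⟩ := hM.diag_le 2
  exact summable_norm_of_bracket (n := 0) (fun l => by simpa using hC l n)

theorem DecayBound.norm_matSymbol_le {α : ℝ} {M : ℤ → ℤ → ℂ} (hM : DecayBound α M) :
    ∃ C : ℝ, 0 ≤ C ∧ ∀ (θ : ℝ) (n : ℤ), ‖matSymbol M θ n‖ ≤ C * bracket (n : ℝ) ^ α := by
  obtain ⟨C, hC0, hC⟩ := hM.diag_le 2
  refine ⟨C * bracketSum, mul_nonneg hC0 bracketSum_nonneg, fun θ n => ?_⟩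
  refine (norm_tsum_le_of_bracket (n := 0) (K := C * bracket (n : ℝ) ^ α) (fun l => ?_)).trans
    (le_of_eq (by ring))
  rw [norm_mul, norm_exp_int_mul_I, mul_one]
  simpa using hC l n

/-- Matrix and symbol determine each other: here by term-by-term integration, in
`matSymbol_symbolMatrix` by Fourier inversion. -/
theorem symbolMatrix_matSymbol {α : ℝ} {M : ℤ → ℤ → ℂ} (hM : DecayBound α M) :
    symbolMatrix (matSymbol M) = M := by
  funext m n
  rw [symbolMatrix_apply]
  unfold matSymbol
  rw [fourierCoef_tsum (hM.summable_diag n)]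
  congr 1
  ring

theorem matSymbol_symbolMatrix {α : ℝ} {σ : ℝ → ℤ → ℂ} (hσ : DecayBound α (symbolMatrix σ))
    (hc : ∀ n, Continuous fun θ => σ θ n) (hper : ∀ θ n, σ (θ + 2 * Real.pi) n = σ θ n) :
    matSymbol (symbolMatrix σ) = σ := by
  funext θ n
  have hs := hσ.summable_diag n
  simp only [symbolMatrix_apply, add_sub_cancel_left] at hs
  have h := hasSum_fourierCoef (hc n) (fun θ => hper θ n) hs θ
  rw [← h.tsum_eq, matSymbol]
  simp only [symbolMatrix_apply, add_sub_cancel_left]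

theorem matSymbol_add {α β : ℝ} {M M' : ℤ → ℤ → ℂ} (hM : DecayBound α M)
    (hM' : DecayBound β M') (θ : ℝ) (n : ℤ) :
    matSymbol (M + M') θ n = matSymbol M θ n + matSymbol M' θ n := by
  have h : ∀ {γ : ℝ} {M : ℤ → ℤ → ℂ}, DecayBound γ M →
      Summable fun l : ℤ => M (n + l) n * Complex.exp (l * θ * Complex.I) := by
    intro γ M hM
    refine Summable.of_norm ((hM.summable_diag n).congr fun l => ?_)
    rw [norm_mul, norm_exp_int_mul_I, mul_one]
  simp only [matSymbol, Pi.add_apply, add_mul]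
  exact (h hM).tsum_add (h hM')

/-- The matrix of `∂_θ σ`, where `σ` is the symbol of `M`. -/
noncomputable def diagDeriv (M : ℤ → ℤ → ℂ) (m n : ℤ) : ℂ := (m - n) * Complex.I * M m n

theorem DecayBound.diagDeriv {α : ℝ} {M : ℤ → ℤ → ℂ} (hM : DecayBound α M) :
    DecayBound α (diagDeriv M) := by
  intro N
  obtain ⟨C, hC⟩ := hM (N + 1)
  refine ⟨C, fun m n => le_trans ?_ (hC m n)⟩
  have h1 : ‖((m : ℂ) - n)‖ ≤ bracket ((m : ℝ) - n) := by
    have h := abs_le_bracket ((m : ℝ) - n)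
    rw [← Int.cast_sub, Complex.norm_intCast]
    simpa using h
  rw [_root_.diagDeriv, norm_mul, norm_mul, Complex.norm_I, mul_one, pow_succ, mul_assoc]
  have := pow_nonneg (bracket_nonneg ((m : ℝ) - n)) N
  gcongr

theorem diagDiff_diagDeriv (M : ℤ → ℤ → ℂ) : diagDiff (diagDeriv M) = diagDeriv (diagDiff M) := by
  funext m n
  simp only [diagDiff, diagDeriv]
  push_cast
  ring

theorem hasDerivAt_matSymbol {α : ℝ} {M : ℤ → ℤ → ℂ} (hM : DecayBound α M) (θ : ℝ) (n : ℤ) :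
    HasDerivAt (fun θ => matSymbol M θ n) (matSymbol (diagDeriv M) θ n) θ := by
  have he : ∀ (l : ℤ) (θ : ℝ), HasDerivAt (fun θ : ℝ => M (n + l) n * Complex.exp (l * θ * Complex.I))
      (diagDeriv M (n + l) n * Complex.exp (l * θ * Complex.I)) θ := by
    intro l θ
    have h1 : HasDerivAt (fun z : ℂ => M (n + l) n * Complex.exp (l * z * Complex.I))
        (M (n + l) n * (Complex.exp (l * θ * Complex.I) * (l * 1 * Complex.I))) (θ : ℂ) :=
      (((hasDerivAt_id (θ : ℂ)).const_mul (l : ℂ)).mul_const Complex.I).cexp.const_mul _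
    refine h1.comp_ofReal.congr_deriv ?_
    simp only [diagDeriv]
    push_cast
    ring
  have hs : Summable fun l : ℤ => M (n + l) n * Complex.exp (l * (0 : ℝ) * Complex.I) := by
    refine Summable.of_norm ((hM.summable_diag n).congr fun l => ?_)
    rw [norm_mul, norm_exp_int_mul_I, mul_one]
  exact hasDerivAt_tsum (hM.diagDeriv.summable_diag n) he
    (fun l y => by rw [norm_mul, norm_exp_int_mul_I, mul_one]) hs θ

theorem matSymbol_periodic (M : ℤ → ℤ → ℂ) (θ : ℝ) (n : ℤ) :
    matSymbol M (θ + 2 * Real.pi) n = matSymbol M θ n := by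
  refine tsum_congr fun l => ?_
  congr 1
  rw [Complex.exp_eq_exp_iff_exists_int]
  exact ⟨l, by push_cast; ring⟩

/-! ### From prolonged symbols to matrices -/

/-- A family `e k j`, where `e (k + 1) j` is the derivative of `e k j`, with the bounds satisfied by
the Fourier coefficients in `θ` of the derivatives `∂_ξ^k σ` of a symbol of order `α`. -/
structure IsSymbolJet (α : ℝ) (e : ℕ → ℤ → ℝ → ℂ) : Prop where
  hasDerivAt : ∀ k j ξ, HasDerivAt (e k j) (e (k + 1) j ξ) ξ
  bound : ∀ k N : ℕ, ∃ C : ℝ, ∀ (j : ℤ) (ξ : ℝ),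
    bracket (j : ℝ) ^ N * ‖e k j ξ‖ ≤ C * bracket ξ ^ (α - k)

/-- By the mean value inequality on [ξ, ξ + 1] a unit difference is bounded by the next derivative,
and the weight changes by a bounded factor on this interval. -/
theorem IsSymbolJet.diff {α : ℝ} {e : ℕ → ℤ → ℝ → ℂ} (he : IsSymbolJet α e) :
    IsSymbolJet (α - 1) (fun k j ξ => e k j (ξ + 1) - e k j ξ) := by
  refine ⟨fun k j ξ => ((he.hasDerivAt k j (ξ + 1)).comp_add_const ξ 1).sub (he.hasDerivAt k j ξ),
    fun k N => ?_⟩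
  obtain ⟨C, hC⟩ := he.bound (k + 1) N
  have hC0 : 0 ≤ C := by
    have h := hC 0 0
    rw [Int.cast_zero, bracket_zero, one_pow, one_mul, Real.one_rpow, mul_one] at h
    exact (norm_nonneg _).trans h
  set a := α - (k + 1 : ℕ) with ha
  refine ⟨C * bracket 1 ^ ⌈|a|⌉₊, fun j ξ => ?_⟩
  have hb : 0 < bracket (j : ℝ) ^ N := pow_pos (bracket_pos _) N
  have h1 : ∀ η ∈ Icc ξ (ξ + 1), ‖e (k + 1) j η‖ ≤
      C * bracket 1 ^ ⌈|a|⌉₊ * bracket ξ ^ a / bracket (j : ℝ) ^ N := by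
    intro η hη
    rw [le_div_iff₀ hb, mul_comm, mul_assoc C]
    refine (hC j η).trans (mul_le_mul_of_nonneg_left ((peetre_pow η ξ a).trans ?_) hC0)
    refine mul_le_mul_of_nonneg_right (pow_le_pow_left₀ (bracket_nonneg _) ?_ _)
      (bracket_rpow_nonneg _ _)
    unfold bracket
    rw [abs_of_nonneg (by linarith [hη.1]), abs_one]
    linarith [hη.2]
  have h2 := (convex_Icc ξ (ξ + 1)).norm_image_sub_le_of_norm_hasDerivWithin_le
    (fun η _ => (he.hasDerivAt k j η).hasDerivWithinAt) h1
    (left_mem_Icc.mpr (by linarith)) (right_mem_Icc.mpr (by linarith))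
  rw [add_sub_cancel_left, norm_one, mul_one, le_div_iff₀ hb] at h2
  rw [mul_comm]
  rwa [show α - 1 - (k : ℝ) = a by rw [ha]; push_cast; ring]

/-- Along a diagonal m - n is fixed, so the matrix difference is the unit difference in ξ of the
same coefficient, to which `IsSymbolJet.diff` applies repeatedly. -/
theorem IsSymbolJet.isPDMatrix {α : ℝ} {e : ℕ → ℤ → ℝ → ℂ} (he : IsSymbolJet α e) :
    IsPDMatrix α (fun m n => e 0 (m - n) n) := by
  have h0 : ∀ {α : ℝ} {e : ℕ → ℤ → ℝ → ℂ}, IsSymbolJet α e →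
      DecayBound α (fun m n => e 0 (m - n) n) := by
    intro α e he N
    obtain ⟨C, hC⟩ := he.bound 0 N
    exact ⟨C, fun m n => by simpa using hC (m - n) n⟩
  intro k
  induction k generalizing α e with
  | zero => exact h0 he
  | succ k ih =>
    refine ⟨h0 he, ?_⟩
    convert ih he.diff using 1
    funext m n
    simp only [diagDiff, add_sub_add_right_eq_sub, Int.cast_add, Int.cast_one]

theorem contDiff_deriv_snd {F : ℝ → ℝ → ℂ} (hF : ContDiff ℝ ∞ fun p : ℝ × ℝ => F p.1 p.2) :
    ContDiff ℝ ∞ fun p : ℝ × ℝ => deriv (F p.1) p.2 := by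
  have h1 : ContDiff ℝ ∞ fun p : ℝ × ℝ => fderiv ℝ (fun p : ℝ × ℝ => F p.1 p.2) p (0, 1) :=
    (hF.fderiv_right (m := ∞) (by simp)).clm_apply contDiff_const
  convert h1 using 2 with p
  have h2 : HasFDerivAt (fun p : ℝ × ℝ => F p.1 p.2) (fderiv ℝ (fun p : ℝ × ℝ => F p.1 p.2) p)
      (p.1, p.2) := (hF.differentiable (by simp) p).hasFDerivAt
  have h3 : HasDerivAt (fun ξ : ℝ => (p.1, ξ)) ((0 : ℝ), (1 : ℝ)) p.2 :=
    (hasDerivAt_const p.2 p.1).prodMk (hasDerivAt_id p.2)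
  exact (h2.comp_hasDerivAt p.2 h3).deriv

theorem contDiff_iteratedDeriv_snd {F : ℝ → ℝ → ℂ}
    (hF : ContDiff ℝ ∞ fun p : ℝ × ℝ => F p.1 p.2) (k : ℕ) :
    ContDiff ℝ ∞ fun p : ℝ × ℝ => iteratedDeriv k (F p.1) p.2 := by
  induction k with
  | zero => simpa using hF
  | succ k ih =>
    simp only [iteratedDeriv_succ]
    exact contDiff_deriv_snd (F := fun θ ξ => iteratedDeriv k (F θ) ξ) ih

/-- Differentiation in ξ passes under the Fourier integral, since Peetre's inequality gives a
constant majorant for |η - ξ| < 1. Decay in j comes from the derivatives in θ. -/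
theorem IsProlongedSymbol.isSymbolJet {α : ℝ} {τ : ℝ → ℝ → ℂ} (hτ : IsProlongedSymbol α τ) :
    IsSymbolJet α (fun k j ξ => fourierCoef (fun θ => iteratedDeriv k (τ θ) ξ) j) := by
  obtain ⟨hsm, hper, hbd⟩ := hτ
  have hθ : ∀ k ξ, ContDiff ℝ ∞ fun θ => iteratedDeriv k (τ θ) ξ := fun k ξ =>
    (contDiff_iteratedDeriv_snd hsm k).comp (contDiff_id.prodMk contDiff_const)
  refine ⟨fun k j ξ => ?_, fun k N => ?_⟩
  · obtain ⟨C, hC⟩ := hbd 0 (k + 1)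
    have hderiv : ∀ θ ξ, HasDerivAt (iteratedDeriv k (τ θ)) (iteratedDeriv (k + 1) (τ θ) ξ) ξ := by
      intro θ ξ
      rw [iteratedDeriv_succ]
      have h : ContDiff ℝ ∞ (iteratedDeriv k (τ θ)) :=
        (contDiff_iteratedDeriv_snd hsm k).comp (contDiff_const.prodMk contDiff_id)
      exact (h.differentiable (by simp) ξ).hasDerivAt
    have hC0 : 0 ≤ C := by
      have h := hC 0 0
      rw [abs_zero, add_zero, Real.one_rpow, mul_one] at h
      exact (norm_nonneg _).trans h
    set a := α - (k + 1 : ℕ)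
    have h := intervalIntegral.hasDerivAt_integral_of_dominated_loc_of_deriv_le
      (μ := volume) (a := -Real.pi) (b := Real.pi) (x₀ := ξ) (s := Metric.ball ξ 1)
      (F := fun ξ θ => iteratedDeriv k (τ θ) ξ * Complex.exp (-(j * θ * Complex.I)))
      (F' := fun ξ θ => iteratedDeriv (k + 1) (τ θ) ξ * Complex.exp (-(j * θ * Complex.I)))
      (bound := fun _ => C * (bracket 1 ^ ⌈|a|⌉₊ * bracket ξ ^ a))
      (Metric.ball_mem_nhds ξ one_pos)
      (Eventually.of_forall fun η =>
        ((hθ k η).continuous.mul (by fun_prop)).aestronglyMeasurable)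
      (((hθ k ξ).continuous.mul (by fun_prop)).intervalIntegrable _ _)
      (((hθ (k + 1) ξ).continuous.mul (by fun_prop)).aestronglyMeasurable)
      (ae_of_all _ fun θ _ η hη => by
        rw [norm_mul, norm_exp_neg_int_mul_I, mul_one]
        have h1 := hC θ η
        rw [iteratedDeriv_zero] at h1
        refine h1.trans (mul_le_mul_of_nonneg_left ((peetre_pow η ξ a).trans ?_) hC0)
        refine mul_le_mul_of_nonneg_right (pow_le_pow_left₀ (bracket_nonneg _) ?_ _)
          (bracket_rpow_nonneg _ _)
        have h2 : |η - ξ| < 1 := by simpa [Real.dist_eq] using hη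
        unfold bracket
        rw [abs_one]
        linarith)
      intervalIntegrable_const
      (ae_of_all _ fun θ _ η _ => (hderiv θ η).mul_const _)
    exact h.2.const_mul _
  · choose C hC using fun i => hbd i k
    -- The sum of the constants for 0 to N derivatives in θ bounds all of them at once.
    refine ⟨2 ^ N * ∑ i ∈ Finset.range (N + 1), |C i|, fun j ξ => ?_⟩
    have h := bracket_pow_mul_fourierCoef_le (N := N)
      (B := (∑ i ∈ Finset.range (N + 1), |C i|) * bracket ξ ^ (α - k)) (hθ k ξ)
      (fun θ => by rw [show τ (θ + 2 * Real.pi) = τ θ from funext (hper θ)])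
      (fun i hi θ => by
        refine (hC i θ ξ).trans (mul_le_mul_of_nonneg_right ?_ (bracket_rpow_nonneg ξ _))
        exact (le_abs_self _).trans (Finset.single_le_sum (f := fun i => |C i|)
          (fun _ _ => abs_nonneg _) (Finset.mem_range.mpr (by omega)))) j
    rw [mul_assoc]
    exact h

theorem isPDMatrix_symbolMatrix {α : ℝ} {σ : ℝ → ℤ → ℂ} (hσ : σ ∈ SigmaClass α) :
    IsPDMatrix α (symbolMatrix σ) := by
  obtain ⟨τ, hτ, h⟩ := hσ
  have h1 := hτ.isSymbolJet.isPDMatrix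
  convert h1 using 1
  funext m n
  rw [symbolMatrix_apply]
  simp only [h, iteratedDeriv_zero]

theorem matSymbol_symbolMatrix_of_mem {α : ℝ} {σ : ℝ → ℤ → ℂ} (hσ : σ ∈ SigmaClass α) :
    matSymbol (symbolMatrix σ) = σ := by
  refine matSymbol_symbolMatrix (isPDMatrix_symbolMatrix hσ).decayBound (fun n => ?_) ?_
  · obtain ⟨τ, hτ, h⟩ := hσ
    simp only [h]
    exact (hτ.1.comp (contDiff_id.prodMk contDiff_const)).continuous
  · obtain ⟨τ, hτ, h⟩ := hσ
    intro θ n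
    rw [h, h, hτ.2.1]

section

/-! ### Interpolation kernels -/

open scoped FourierTransform

/-- Smooth functions supported in `[-3/4, 3/4]`. -/
structure IsBandFunction (f : ℝ → ℂ) : Prop where
  contDiff : ContDiff ℝ ∞ f
  eq_zero : ∀ x, 3 / 4 < |x| → f x = 0

theorem IsBandFunction.hasCompactSupport {f : ℝ → ℂ} (hf : IsBandFunction f) :
    HasCompactSupport f := by
  refine HasCompactSupport.of_support_subset_isCompact (isCompact_Icc (a := -(3 / 4 : ℝ))
    (b := 3 / 4)) fun x hx => ?_
  refine abs_le.mp ?_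
  by_contra h
  exact hx (hf.eq_zero x (not_le.mp h))

theorem IsBandFunction.fourier_decay {f : ℝ → ℂ} (hf : IsBandFunction f) (N : ℕ) :
    ∃ C : ℝ, ∀ x : ℝ, bracket x ^ N * ‖𝓕 f x‖ ≤ C := by
  let F : SchwartzMap ℝ ℂ := hf.hasCompactSupport.toSchwartzMap hf.contDiff
  have h := fun x => SchwartzMap.one_add_le_sup_seminorm_apply (𝕜 := ℝ) (m := (N, 0)) (k := N)
    (n := 0) le_rfl le_rfl (𝓕 F) x
  simp only [norm_iteratedFDeriv_zero] at h
  exact ⟨_, fun x => h x⟩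

theorem IsBandFunction.integrable {f : ℝ → ℂ} (hf : IsBandFunction f) : Integrable f :=
  hf.contDiff.continuous.integrable_of_hasCompactSupport hf.hasCompactSupport

theorem dslope_exp_mul (v : ℂ) (c : ℂ) :
    v * dslope (fun z : ℂ => Complex.exp (c * z)) 0 v = Complex.exp (c * v) - 1 := by
  have h := sub_smul_dslope (fun z : ℂ => Complex.exp (c * z)) 0 v
  simpa using h

/-- The zeros of e^{-2πiv} - 1 are the integers, so only v = 0 matters for |v| < 1, and there the
quotient by v has the value -2πi. The support bound 3/4 < 1 for band functions leaves room for this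
division. -/
theorem dslope_exp_ne_zero {v : ℝ} (hv : |v| < 1) :
    dslope (fun z : ℂ => Complex.exp (-2 * Real.pi * Complex.I * z)) 0 v ≠ 0 := by
  have hpi : (Real.pi : ℂ) ≠ 0 := Complex.ofReal_ne_zero.mpr Real.pi_ne_zero
  have hc : -2 * (Real.pi : ℂ) * Complex.I ≠ 0 :=
    mul_ne_zero (mul_ne_zero (by norm_num) hpi) Complex.I_ne_zero
  rcases eq_or_ne v 0 with rfl | h0
  · rw [Complex.ofReal_zero, dslope_same]
    have h : HasDerivAt (fun z : ℂ => Complex.exp (-2 * Real.pi * Complex.I * z))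
        (Complex.exp (-2 * Real.pi * Complex.I * 0) * (-2 * Real.pi * Complex.I * 1)) 0 :=
      ((hasDerivAt_id (0 : ℂ)).const_mul (-2 * (Real.pi : ℂ) * Complex.I)).cexp
    rw [h.deriv]
    simp [hpi]
  · intro h
    have h1 := dslope_exp_mul (v : ℂ) (-2 * Real.pi * Complex.I)
    rw [h, mul_zero, eq_comm, sub_eq_zero, Complex.exp_eq_one_iff] at h1
    obtain ⟨n, hn⟩ := h1
    have h2 : (v : ℂ) = -n := by
      have : (-2 * (Real.pi : ℂ) * Complex.I) * v = (-2 * (Real.pi : ℂ) * Complex.I) * (-n) := by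
        rw [hn]; ring
      exact mul_left_cancel₀ hc this
    have h3 : v = -n := by exact_mod_cast h2
    rw [h3, abs_neg] at hv
    have h4 : |n| < 1 := by exact_mod_cast hv
    rw [Int.abs_lt_one_iff] at h4
    exact h0 (by rw [h3, h4]; simp)

/-- The derivative of the Fourier transform of a band function is the difference of a function of
the same kind. -/
theorem IsBandFunction.exists_hasDerivAt {f : ℝ → ℂ} (hf : IsBandFunction f) :
    ∃ g : ℝ → ℂ, IsBandFunction g ∧ ∀ x : ℝ, HasDerivAt (𝓕 f) (𝓕 g (x + 1) - 𝓕 g x) x := by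
  set c : ℂ := -2 * Real.pi * Complex.I with hc
  set d : ℂ → ℂ := dslope (fun z : ℂ => Complex.exp (c * z)) 0 with hd
  have hdsm : ContDiff ℝ ∞ fun v : ℝ => d v := by
    have h1 : Differentiable ℂ d := by
      rw [← differentiableOn_univ]
      exact (Complex.differentiableOn_dslope univ_mem).mpr (by fun_prop)
    exact (h1.contDiff (n := ∞)).restrict_scalars ℝ |>.comp Complex.ofRealCLM.contDiff
  -- With c = -2πi and d(v) = (e^{cv} - 1)/v, this g solves (e^{cv} - 1) g = c v f. Under the
  -- Fourier transform multiplication by e^{cv} is a shift by 1, and c v f becomes the derivative of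
  -- 𝓕 f.
  set g : ℝ → ℂ := fun v => c * f v * (d v)⁻¹ with hg
  have hband : IsBandFunction g := by
    refine ⟨contDiff_iff_contDiffAt.mpr fun v => ?_, fun x hx => by simp [hg, hf.eq_zero x hx]⟩
    rcases lt_or_ge |v| 1 with hv | hv
    · exact (contDiffAt_const.mul hf.contDiff.contDiffAt).mul
        (hdsm.contDiffAt.inv (dslope_exp_ne_zero hv))
    · have h0 : g =ᶠ[𝓝 v] fun _ => 0 := by
        have : ∀ᶠ x in 𝓝 v, 3 / 4 < |x| :=
          continuous_abs.continuousAt.eventually_const_lt (by linarith)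
        filter_upwards [this] with x hx
        simp [hg, hf.eq_zero x hx]
      exact contDiffAt_const.congr_of_eventuallyEq h0
  refine ⟨g, hband, fun x => ?_⟩
  have hxf : Integrable fun x : ℝ => x • f x :=
    (continuous_id.smul hf.contDiff.continuous).integrable_of_hasCompactSupport
      hf.hasCompactSupport.smul_left
  refine (Real.hasDerivAt_fourier hf.integrable hxf x).congr_deriv ?_
  have hint : ∀ y : ℝ, Integrable fun v : ℝ =>
      Complex.exp (↑(-2 * Real.pi * v * y) * Complex.I) • g v := fun y =>
    ((by fun_prop : Continuous fun v : ℝ =>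
      Complex.exp (↑(-2 * Real.pi * v * y) * Complex.I)).smul
        hband.contDiff.continuous).integrable_of_hasCompactSupport hband.hasCompactSupport.smul_left
  rw [Real.fourier_real_eq_integral_exp_smul, Real.fourier_real_eq_integral_exp_smul,
    Real.fourier_real_eq_integral_exp_smul, ← integral_sub (hint _) (hint _)]
  refine integral_congr_ae (ae_of_all _ fun v => ?_)
  have hkey : (Complex.exp (c * v) - 1) * g v = c * v * f v := by
    rw [← dslope_exp_mul]
    -- Where d vanishes, |v| ≥ 1 and f is zero, so the convention 0⁻¹ = 0 is harmless.
    rcases eq_or_ne (d v) 0 with h | h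
    · have hv : 1 ≤ |v| := by
        by_contra hv
        exact dslope_exp_ne_zero (not_le.mp hv) h
      rw [hf.eq_zero v (by linarith)]
      simp [hg, hf.eq_zero v (by linarith)]
    · simp only [hg, ← hd]
      field_simp
  have hexp : Complex.exp (↑(-2 * Real.pi * v * (x + 1)) * Complex.I) =
      Complex.exp (↑(-2 * Real.pi * v * x) * Complex.I) * Complex.exp (c * v) := by
    rw [← Complex.exp_add]
    congr 1
    rw [hc]
    push_cast
    ring
  simp only [smul_eq_mul]
  rw [hexp, ← hc]
  linear_combination -Complex.exp (↑(-2 * Real.pi * v * x) * Complex.I) * hkey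

/-- A smooth transition from `0` on `(-∞, 1/4]` to `1` on `[3/4, ∞)`. -/
noncomputable def innerTransition (x : ℝ) : ℝ := Real.smoothTransition (2 * x - 1 / 2)

theorem innerTransition_zero {x : ℝ} (hx : x ≤ 1 / 4) : innerTransition x = 0 :=
  Real.smoothTransition.zero_of_nonpos (by linarith)

theorem innerTransition_one {x : ℝ} (hx : 3 / 4 ≤ x) : innerTransition x = 1 :=
  Real.smoothTransition.one_of_one_le (by linarith)

theorem contDiff_innerTransition : ContDiff ℝ ∞ innerTransition :=
  Real.smoothTransition.contDiff.comp (by fun_prop)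

/-- A band function whose integer translates add up to `1`. -/
noncomputable def partitionBand (x : ℝ) : ℂ :=
  ((innerTransition (x + 1) - innerTransition x : ℝ) : ℂ)

theorem isBandFunction_partitionBand : IsBandFunction partitionBand := by
  constructor
  · refine Complex.ofRealCLM.contDiff.comp ?_
    exact (contDiff_innerTransition.comp (by fun_prop)).sub contDiff_innerTransition
  · intro x hx
    unfold partitionBand
    rcases lt_abs.mp hx with h | h
    · rw [innerTransition_one (by linarith), innerTransition_one (by linarith)]
      simp
    · rw [innerTransition_zero (by linarith), innerTransition_zero (by linarith)]
      simp

/-- At an integer frequency the exponential has period 1, so the part of the integral over [-1, 0]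
folds onto [0, 1]. The two transition functions cancel there and ∫₀¹ e^{-2πinv} dv remains. -/
theorem fourier_partitionBand_int (n : ℤ) : 𝓕 partitionBand (n : ℝ) = if n = 0 then 1 else 0 := by
  rw [Real.fourier_real_eq_integral_exp_smul]
  set E : ℝ → ℂ := fun v => Complex.exp (↑(-2 * Real.pi * v * n) * Complex.I) with hE
  have hEc : Continuous E := by fun_prop
  have hTc : Continuous fun v : ℝ => ((innerTransition v : ℝ) : ℂ) :=
    Complex.continuous_ofReal.comp contDiff_innerTransition.continuous
  have hEper : ∀ v, E (v + 1) = E v := by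
    intro v
    simp only [hE]
    rw [Complex.exp_eq_exp_iff_exists_int]
    exact ⟨-n, by push_cast; ring⟩
  have hsupp : Function.support (fun v => E v • partitionBand v) ⊆ Ioc (-1) 1 := by
    intro v hv
    by_contra h
    refine hv ?_
    have : 3 / 4 < |v| := by
      rw [mem_Ioc, not_and_or, not_lt, not_le] at h
      rcases h with h | h
      · exact lt_abs.mpr (Or.inr (by linarith))
      · exact lt_abs.mpr (Or.inl (by linarith))
    simp [isBandFunction_partitionBand.eq_zero v this]
  have hcont : Continuous fun v => E v • partitionBand v :=
    hEc.smul isBandFunction_partitionBand.contDiff.continuous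
  rw [← intervalIntegral.integral_eq_integral_of_support_subset hsupp,
    ← intervalIntegral.integral_add_adjacent_intervals (b := 0)
      (hcont.intervalIntegrable _ _) (hcont.intervalIntegrable _ _)]
  have h1 : ∫ v in (-1 : ℝ)..0, E v • partitionBand v =
      ∫ v in (0 : ℝ)..1, E v * (innerTransition v : ℝ) := by
    have h := intervalIntegral.integral_comp_add_right (a := -1) (b := 0)
      (fun v => E v * ((innerTransition v : ℝ) : ℂ)) 1
    rw [show (-1 : ℝ) + 1 = 0 by norm_num, zero_add] at h
    rw [← h]
    refine intervalIntegral.integral_congr fun v hv => ?_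
    rw [uIcc_of_le (by norm_num)] at hv
    simp only [hEper, partitionBand, smul_eq_mul]
    rw [innerTransition_zero (x := v) (by linarith [hv.2]), sub_zero]
  have h2 : ∫ v in (0 : ℝ)..1, E v • partitionBand v =
      ∫ v in (0 : ℝ)..1, (E v - E v * (innerTransition v : ℝ)) := by
    refine intervalIntegral.integral_congr fun v hv => ?_
    rw [uIcc_of_le (by norm_num)] at hv
    simp only [partitionBand, smul_eq_mul]
    rw [innerTransition_one (x := v + 1) (by linarith [hv.1])]
    push_cast
    ring
  have h12 : Continuous fun v => E v * ((innerTransition v : ℝ) : ℂ) := hEc.mul hTc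
  rw [h1, h2, intervalIntegral.integral_sub (hEc.intervalIntegrable _ _)
    (h12.intervalIntegrable _ _), add_sub_cancel]
  have hE' : ∀ v : ℝ, E v = Complex.exp ((-2 * Real.pi * n * Complex.I) * v) := by
    intro v; simp only [hE]; congr 1; push_cast; ring
  by_cases hn : n = 0
  · simp [hE, hn]
  · have hpi : (Real.pi : ℂ) ≠ 0 := Complex.ofReal_ne_zero.mpr Real.pi_ne_zero
    have hc : (-2 * Real.pi * n * Complex.I : ℂ) ≠ 0 :=
      mul_ne_zero (mul_ne_zero (mul_ne_zero (by norm_num) hpi) (Int.cast_ne_zero.mpr hn))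
        Complex.I_ne_zero
    simp only [hE']
    rw [integral_exp_mul_complex hc, if_neg hn]
    have : Complex.exp (-2 * Real.pi * n * Complex.I * (1 : ℝ)) = 1 := by
      rw [Complex.exp_eq_one_iff]
      exact ⟨-n, by push_cast; ring⟩
    rw [this]
    simp

/-- Rapidly decaying functions `Φ 0, Φ 1, …` such that `Φ 0` interpolates the unit sequence and each
derivative `Φ k'` is the forward difference of `Φ (k + 1)`. -/
theorem exists_interpolation_kernels : ∃ Φ : ℕ → ℝ → ℂ,
    (∀ n : ℤ, Φ 0 n = if n = 0 then 1 else 0) ∧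
    (∀ k x, HasDerivAt (Φ k) (Φ (k + 1) (x + 1) - Φ (k + 1) x) x) ∧
    ∀ k N : ℕ, ∃ C : ℝ, ∀ x, bracket x ^ N * ‖Φ k x‖ ≤ C := by
  -- Division by d keeps a function in the band class, so the step can be iterated from the
  -- partition of unity to give all kernels.
  choose! nxt h1 h2 using fun (f : ℝ → ℂ) (hf : IsBandFunction f) => hf.exists_hasDerivAt
  have hb : ∀ k : ℕ, IsBandFunction (nxt^[k] partitionBand) := by
    intro k
    induction k with
    | zero => exact isBandFunction_partitionBand
    | succ k ih => rw [Function.iterate_succ_apply']; exact h1 _ ih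
  refine ⟨fun k => 𝓕 (nxt^[k] partitionBand), fourier_partitionBand_int, fun k x => ?_,
    fun k N => (hb k).fourier_decay N⟩
  simp only [Function.iterate_succ_apply']
  exact h2 _ (hb k) x

end

/-! ### Interpolation of matrices along the diagonals -/

/-- The kernel supplies P powers for moving the weight from n to ξ and two for summability around
⌊ξ⌋. The argument x may lie within 2 of ξ because differentiation needs both y and y + 1 with |y -
ξ| < 1. The constants are 1 + |x - ξ| ≤ 3 and a further factor 2 for replacing ξ by ⌊ξ⌋. -/
theorem interpolation_term_le {a : ℝ} {M : ℤ → ℤ → ℂ} (hM : DecayBound a M) {Φ : ℝ → ℂ}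
    (hΦ : ∀ N : ℕ, ∃ C : ℝ, ∀ x, bracket x ^ N * ‖Φ x‖ ≤ C) (N : ℕ) :
    ∃ C : ℝ, ∀ (j n : ℤ) (x ξ : ℝ), |x - ξ| ≤ 2 → bracket ((n : ℝ) - (⌊ξ⌋ : ℤ)) ^ 2 *
      (bracket (j : ℝ) ^ N * ‖M (n + j) n * Φ (x - n)‖) ≤ C * bracket ξ ^ a := by
  obtain ⟨C, hC0, hC⟩ := hM.diag_le N
  set P := ⌈|a|⌉₊
  obtain ⟨D, hD⟩ := hΦ (P + 2)
  refine ⟨6 ^ 2 * 3 ^ P * C * D, fun j n x ξ hx => ?_⟩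
  set b := bracket (x - n) with hb
  have hb0 : 0 ≤ b := bracket_nonneg _
  have h1 : bracket (x - ξ) ≤ 3 := by unfold bracket; linarith
  have h2 : bracket ((n : ℝ) - ξ) ≤ 3 * b := by
    have h := bracket_add_le ((n : ℝ) - x) (x - ξ)
    rw [sub_add_sub_cancel, bracket_sub_comm (n : ℝ) x] at h
    nlinarith
  have h3 : bracket ((n : ℝ) - (⌊ξ⌋ : ℤ)) ≤ 6 * b := by
    have h := bracket_add_le ((n : ℝ) - ξ) (ξ - (⌊ξ⌋ : ℤ))
    rw [sub_add_sub_cancel] at h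
    have h4 : bracket (ξ - (⌊ξ⌋ : ℤ)) ≤ 2 := by
      unfold bracket
      rw [abs_of_nonneg (by linarith [Int.floor_le ξ])]
      linarith [Int.lt_floor_add_one ξ]
    have := bracket_nonneg ((n : ℝ) - ξ)
    nlinarith
  have h5 := hC j n
  have h6 : bracket (n : ℝ) ^ a ≤ (3 * b) ^ P * bracket ξ ^ a := by
    refine (peetre_pow (n : ℝ) ξ a).trans ?_
    have := bracket_rpow_nonneg ξ a
    have := bracket_nonneg ((n : ℝ) - ξ)
    gcongr
  have h7 := hD (x - n)
  have hξ := bracket_rpow_nonneg ξ a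
  have h30 := bracket_nonneg ((n : ℝ) - (⌊ξ⌋ : ℤ))
  calc bracket ((n : ℝ) - (⌊ξ⌋ : ℤ)) ^ 2 * (bracket (j : ℝ) ^ N * ‖M (n + j) n * Φ (x - n)‖)
      ≤ (6 * b) ^ 2 * (bracket (j : ℝ) ^ N * ‖M (n + j) n * Φ (x - n)‖) := by
        have := bracket_nonneg (j : ℝ)
        gcongr
    _ = (6 * b) ^ 2 * ‖Φ (x - n)‖ * (bracket (j : ℝ) ^ N * ‖M (n + j) n‖) := by
        rw [norm_mul]; ring
    _ ≤ (6 * b) ^ 2 * ‖Φ (x - n)‖ * (C * ((3 * b) ^ P * bracket ξ ^ a)) := by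
        refine mul_le_mul_of_nonneg_left (h5.trans ?_) (by positivity)
        gcongr
    _ = 6 ^ 2 * 3 ^ P * C * bracket ξ ^ a * (b ^ (P + 2) * ‖Φ (x - n)‖) := by
        rw [mul_pow, mul_pow, pow_add]; ring
    _ ≤ 6 ^ 2 * 3 ^ P * C * bracket ξ ^ a * D := by gcongr
    _ = _ := by ring

theorem DecayBound.interpolation_bound {a : ℝ} {M : ℤ → ℤ → ℂ} (hM : DecayBound a M) {Φ : ℝ → ℂ}
    (hΦ : ∀ N : ℕ, ∃ C : ℝ, ∀ x, bracket x ^ N * ‖Φ x‖ ≤ C) (N : ℕ) :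
    ∃ C : ℝ, ∀ (j : ℤ) (ξ : ℝ),
      bracket (j : ℝ) ^ N * ‖∑' n : ℤ, M (n + j) n * Φ (ξ - n)‖ ≤ C * bracket ξ ^ a := by
  obtain ⟨C, hC⟩ := interpolation_term_le hM hΦ N
  refine ⟨C * bracketSum, fun j ξ => ?_⟩
  have hj : 0 ≤ bracket (j : ℝ) ^ N := pow_nonneg (bracket_nonneg _) _
  have h := norm_tsum_le_of_bracket (n := ⌊ξ⌋) (K := C * bracket ξ ^ a)
    (F := fun n : ℤ => ((bracket (j : ℝ) ^ N : ℝ) : ℂ) * (M (n + j) n * Φ (ξ - n))) (fun n => by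
      rw [norm_mul, Complex.norm_real, Real.norm_of_nonneg hj]
      exact hC j n ξ ξ (by simp))
  rw [tsum_mul_left, norm_mul, Complex.norm_real, Real.norm_of_nonneg hj] at h
  linarith

theorem DecayBound.interpolation_summable {a : ℝ} {M : ℤ → ℤ → ℂ} (hM : DecayBound a M) {Φ : ℝ → ℂ}
    (hΦ : ∀ N : ℕ, ∃ C : ℝ, ∀ x, bracket x ^ N * ‖Φ x‖ ≤ C) (j : ℤ) (ξ : ℝ) :
    Summable fun n : ℤ => M (n + j) n * Φ (ξ - n) := by
  obtain ⟨C, hC⟩ := interpolation_term_le hM hΦ 0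
  exact (summable_norm_of_bracket (n := ⌊ξ⌋) (fun n => by
    simpa using hC j n ξ ξ (by simp))).of_norm

/-- Summation by parts: replacing n by n + 1 in the terms with Ψ(ξ - n + 1) moves the difference
from the kernel to the matrix. -/
theorem DecayBound.interpolation_hasDerivAt {a : ℝ} {M : ℤ → ℤ → ℂ} (hM : DecayBound a M)
    {Φ Ψ : ℝ → ℂ} (hΦ : ∀ N : ℕ, ∃ C : ℝ, ∀ x, bracket x ^ N * ‖Φ x‖ ≤ C)
    (hΨ : ∀ N : ℕ, ∃ C : ℝ, ∀ x, bracket x ^ N * ‖Ψ x‖ ≤ C)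
    (h : ∀ x, HasDerivAt Φ (Ψ (x + 1) - Ψ x) x) (j : ℤ) (ξ : ℝ) :
    HasDerivAt (fun ξ => ∑' n : ℤ, M (n + j) n * Φ (ξ - n))
      (∑' n : ℤ, _root_.diagDiff M (n + j) n * Ψ (ξ - n)) ξ := by
  obtain ⟨C, hC⟩ := interpolation_term_le hM hΨ 0
  simp only [pow_zero, one_mul] at hC
  have hle : ∀ (n : ℤ) (x : ℝ), |x - ξ| ≤ 2 → ‖M (n + j) n * Ψ (x - n)‖ ≤
      C * bracket ξ ^ a * (bracket ((n : ℝ) - (⌊ξ⌋ : ℤ)) ^ 2)⁻¹ := by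
    intro n x hx
    rw [← div_eq_mul_inv, le_div_iff₀ (pow_pos (bracket_pos _) 2), mul_comm]
    exact hC j n x ξ hx
  have hs := (hasSum_bracket_sub ⌊ξ⌋).summable.mul_left (C * bracket ξ ^ a)
  have h1 := hasDerivAt_tsum_of_isPreconnected (t := Metric.ball ξ 1) (hs.add hs)
    (g := fun (n : ℤ) ξ => M (n + j) n * Φ (ξ - n))
    (g' := fun (n : ℤ) ξ => M (n + j) n * (Ψ (ξ - n + 1) - Ψ (ξ - n)))
    Metric.isOpen_ball (convex_ball ξ 1).isPreconnected
    (fun n y _ => ((h (y - n)).comp_sub_const y n).const_mul _)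
    (fun n y hy => by
      have hy' : |y - ξ| < 1 := by simpa [Real.dist_eq] using hy
      rw [mul_sub]
      refine (norm_sub_le _ _).trans (add_le_add ?_ (hle n y (by linarith)))
      rw [show y - (n : ℝ) + 1 = (y + 1) - n by ring]
      refine hle n (y + 1) ?_
      rw [add_sub_right_comm]
      refine (abs_add_le _ _).trans ?_
      rw [abs_one]
      linarith)
    (Metric.mem_ball_self one_pos) (hM.interpolation_summable hΦ j ξ)
    (Metric.mem_ball_self one_pos)
  refine h1.congr_deriv ?_
  have s1 := hM.diagShift.interpolation_summable hΨ j ξ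
  have s2 := hM.interpolation_summable hΨ j ξ
  have s3 : Summable fun n : ℤ => M (n + j) n * Ψ (ξ - n + 1) := by
    refine (Equiv.addRight (1 : ℤ)).summable_iff.mp (s1.congr fun n => ?_)
    simp only [_root_.diagShift, Function.comp_apply, Equiv.coe_addRight]
    rw [add_right_comm n j 1]
    congr 2
    push_cast
    ring
  have e1 : ∑' n : ℤ, M (n + j) n * Ψ (ξ - n + 1) =
      ∑' n : ℤ, _root_.diagShift M (n + j) n * Ψ (ξ - n) := by
    rw [← (Equiv.addRight (1 : ℤ)).tsum_eq]
    refine tsum_congr fun n => ?_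
    simp only [_root_.diagShift, Equiv.coe_addRight]
    rw [add_right_comm n j 1]
    congr 2
    push_cast
    ring
  simp only [mul_sub]
  rw [s3.tsum_sub s2, e1, ← s1.tsum_sub s2]
  exact tsum_congr fun n => by simp only [_root_.diagShift, _root_.diagDiff]; ring

theorem IsPDMatrix.iterate_diagDiff {α : ℝ} {M : ℤ → ℤ → ℂ} (hM : IsPDMatrix α M) (k : ℕ) :
    IsPDMatrix (α - k) (_root_.diagDiff^[k] M) := by
  induction k with
  | zero => simpa using hM
  | succ k ih =>
    rw [Function.iterate_succ_apply']
    have h := ih.diagDiff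
    rwa [show α - k - 1 = α - (k + 1 : ℕ) by push_cast; ring] at h

/-- The diagonals of a matrix of order `α` extend to smooth functions on the line. -/
theorem IsPDMatrix.exists_jet {α : ℝ} {M : ℤ → ℤ → ℂ} (hM : IsPDMatrix α M) :
    ∃ e : ℕ → ℤ → ℝ → ℂ, IsSymbolJet α e ∧ ∀ j n : ℤ, e 0 j n = M (n + j) n := by
  obtain ⟨Φ, h0, hd, hb⟩ := exists_interpolation_kernels
  -- The k-th derivative interpolates the k-th diagonal difference with the kernel Φ_k, which yields
  -- the order α - k.
  refine ⟨fun k j ξ => ∑' n : ℤ, (_root_.diagDiff^[k] M) (n + j) n * Φ k (ξ - n),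
    ⟨fun k j ξ => ?_, fun k N => ?_⟩, fun j n => ?_⟩
  · simp only [Function.iterate_succ_apply']
    exact (hM.iterate_diagDiff k).decayBound.interpolation_hasDerivAt (hb k) (hb (k + 1)) (hd k) j ξ
  · exact (hM.iterate_diagDiff k).decayBound.interpolation_bound (hb k) N
  · have h1 : ∀ m : ℤ, Φ 0 ((n : ℝ) - m) = if n - m = 0 then 1 else 0 := by
      intro m
      rw [← h0]
      push_cast
      rfl
    simp only [Function.iterate_zero, id_eq, h1]
    rw [tsum_eq_single n (fun m hm => by rw [if_neg (sub_ne_zero.mpr hm.symm), mul_zero])]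
    simp

/-! ### Jets and prolonged symbols -/

/-- The function `∑ⱼ e 0 j ξ e^{ijθ}`. -/
noncomputable def jetSum (e : ℕ → ℤ → ℝ → ℂ) (θ ξ : ℝ) : ℂ :=
  ∑' j : ℤ, e 0 j ξ * Complex.exp (j * θ * Complex.I)

/-- This is differentiation of the sum in ξ. -/
theorem IsSymbolJet.tail {α : ℝ} {e : ℕ → ℤ → ℝ → ℂ} (he : IsSymbolJet α e) :
    IsSymbolJet (α - 1) (fun k => e (k + 1)) := by
  refine ⟨fun k => he.hasDerivAt (k + 1), fun k N => ?_⟩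
  have h := he.bound (k + 1) N
  rwa [show α - (k + 1 : ℕ) = α - 1 - k by push_cast; ring] at h

/-- This is differentiation of the sum in θ; the factor j is absorbed by one more power of decay. -/
theorem IsSymbolJet.angular {α : ℝ} {e : ℕ → ℤ → ℝ → ℂ} (he : IsSymbolJet α e) :
    IsSymbolJet α (fun k j ξ => j * Complex.I * e k j ξ) := by
  refine ⟨fun k j ξ => (he.hasDerivAt k j ξ).const_mul _, fun k N => ?_⟩
  obtain ⟨C, hC⟩ := he.bound k (N + 1)
  refine ⟨C, fun j ξ => le_trans ?_ (hC j ξ)⟩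
  rw [norm_mul, norm_mul, Complex.norm_I, mul_one, Complex.norm_intCast, pow_succ, mul_assoc]
  have := pow_nonneg (bracket_nonneg (j : ℝ)) N
  have := abs_le_bracket (j : ℝ)
  gcongr

theorem IsSymbolJet.bound_nonneg {α : ℝ} {e : ℕ → ℤ → ℝ → ℂ} (he : IsSymbolJet α e) (k N : ℕ) :
    ∃ C : ℝ, 0 ≤ C ∧ ∀ (j : ℤ) (ξ : ℝ),
      bracket (j : ℝ) ^ N * ‖e k j ξ‖ ≤ C * bracket ξ ^ (α - k) := by
  obtain ⟨C, hC⟩ := he.bound k N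
  refine ⟨C, ?_, hC⟩
  have h := hC 0 0
  rw [Int.cast_zero, bracket_zero, one_pow, one_mul, Real.one_rpow, mul_one] at h
  exact (norm_nonneg _).trans h

theorem IsSymbolJet.summable {α : ℝ} {e : ℕ → ℤ → ℝ → ℂ} (he : IsSymbolJet α e) (θ ξ : ℝ) :
    Summable fun j : ℤ => e 0 j ξ * Complex.exp (j * θ * Complex.I) := by
  obtain ⟨C, -, hC⟩ := he.bound_nonneg 0 2
  refine (summable_norm_of_bracket (n := 0) (K := C * bracket ξ ^ (α - (0 : ℕ))) fun j => ?_).of_norm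
  rw [norm_mul, norm_exp_int_mul_I, mul_one]
  simpa using hC j ξ

theorem IsSymbolJet.norm_jetSum_le {α : ℝ} {e : ℕ → ℤ → ℝ → ℂ} (he : IsSymbolJet α e) :
    ∃ C : ℝ, ∀ θ ξ : ℝ, ‖jetSum e θ ξ‖ ≤ C * bracket ξ ^ α := by
  obtain ⟨C, -, hC⟩ := he.bound_nonneg 0 2
  refine ⟨C * bracketSum, fun θ ξ => ?_⟩
  refine (norm_tsum_le_of_bracket (n := 0) (K := C * bracket ξ ^ α) fun j => ?_).trans
    (le_of_eq (by ring))
  rw [norm_mul, norm_exp_int_mul_I, mul_one]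
  simpa using hC j ξ

/-- The continuous linear map `(s, t) ↦ s a + t b`. -/
noncomputable def linComb (a b : ℂ) : ℝ × ℝ →L[ℝ] ℂ :=
  (ContinuousLinearMap.fst ℝ ℝ ℝ).smulRight a + (ContinuousLinearMap.snd ℝ ℝ ℝ).smulRight b

/-- `linComb` as a continuous linear map of the pair `(a, b)`. -/
noncomputable def linCombL : ℂ × ℂ →L[ℝ] (ℝ × ℝ →L[ℝ] ℂ) :=
  (ContinuousLinearMap.smulRightL ℝ (ℝ × ℝ) ℂ (ContinuousLinearMap.fst ℝ ℝ ℝ)).comp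
    (ContinuousLinearMap.fst ℝ ℂ ℂ) +
  (ContinuousLinearMap.smulRightL ℝ (ℝ × ℝ) ℂ (ContinuousLinearMap.snd ℝ ℝ ℝ)).comp
    (ContinuousLinearMap.snd ℝ ℂ ℂ)

theorem linComb_apply (a b : ℂ) (p : ℝ × ℝ) : linComb a b p = p.1 * a + p.2 * b := by
  simp [linComb]

theorem norm_linComb_le (a b : ℂ) : ‖linComb a b‖ ≤ ‖a‖ + ‖b‖ := by
  refine ContinuousLinearMap.opNorm_le_bound _ (by positivity) fun p => ?_
  rw [linComb_apply, add_mul]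
  refine (norm_add_le _ _).trans (add_le_add ?_ ?_)
  · rw [norm_mul, Complex.norm_real, mul_comm]
    exact mul_le_mul_of_nonneg_left (norm_fst_le p) (norm_nonneg _)
  · rw [norm_mul, Complex.norm_real, mul_comm]
    exact mul_le_mul_of_nonneg_left (norm_snd_le p) (norm_nonneg _)

/-- The series is differentiated term by term on the convex strip |ξ - ξ₀| < 1, where the weights
are comparable to their values at ξ₀ and decay in j gives a summable majorant. -/
theorem IsSymbolJet.hasFDerivAt_jetSum {α : ℝ} {e : ℕ → ℤ → ℝ → ℂ} (he : IsSymbolJet α e)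
    (p : ℝ × ℝ) : HasFDerivAt (fun p : ℝ × ℝ => jetSum e p.1 p.2)
      (linComb (jetSum (fun k j ξ => j * Complex.I * e k j ξ) p.1 p.2)
        (jetSum (fun k => e (k + 1)) p.1 p.2)) p := by
  obtain ⟨C, hC0, hC⟩ := he.angular.bound_nonneg 0 2
  obtain ⟨D, hD0, hD⟩ := he.tail.bound_nonneg 0 2
  simp only [Nat.cast_zero, sub_zero] at hC hD
  set ξ₀ := p.2
  have hloc : ∀ a ξ : ℝ, |ξ - ξ₀| < 1 → bracket ξ ^ a ≤ bracket 1 ^ ⌈|a|⌉₊ * bracket ξ₀ ^ a := by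
    intro a ξ hξ
    refine (peetre_pow ξ ξ₀ a).trans (mul_le_mul_of_nonneg_right
      (pow_le_pow_left₀ (bracket_nonneg _) ?_ _) (bracket_rpow_nonneg _ _))
    unfold bracket
    rw [abs_one]
    linarith
  set K := C * (bracket 1 ^ ⌈|α|⌉₊ * bracket ξ₀ ^ α) +
    D * (bracket 1 ^ ⌈|α - 1|⌉₊ * bracket ξ₀ ^ (α - 1))
  have hE : ∀ (j : ℤ) (θ : ℝ), HasDerivAt (fun θ : ℝ => Complex.exp (j * θ * Complex.I))
      (j * Complex.I * Complex.exp (j * θ * Complex.I)) θ := by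
    intro j θ
    have h1 : HasDerivAt (fun z : ℂ => Complex.exp (j * z * Complex.I))
        (Complex.exp (j * θ * Complex.I) * (j * 1 * Complex.I)) (θ : ℂ) :=
      (((hasDerivAt_id (θ : ℂ)).const_mul (j : ℂ)).mul_const Complex.I).cexp
    exact h1.comp_ofReal.congr_deriv (by ring)
  have h := hasFDerivAt_tsum_of_isPreconnected (s := {q : ℝ × ℝ | |q.2 - ξ₀| < 1}) (x₀ := p)
    (x := p) (f := fun (j : ℤ) (q : ℝ × ℝ) => e 0 j q.2 * Complex.exp (j * q.1 * Complex.I))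
    (f' := fun (j : ℤ) (q : ℝ × ℝ) =>
      linComb (j * Complex.I * e 0 j q.2 * Complex.exp (j * q.1 * Complex.I))
        (e 1 j q.2 * Complex.exp (j * q.1 * Complex.I)))
    (u := fun j : ℤ => K * (bracket (j : ℝ) ^ 2)⁻¹)
    (summable_bracket_inv_sq.mul_left K)
    (isOpen_lt (by fun_prop) continuous_const)
    (by
      have hcv : {q : ℝ × ℝ | |q.2 - ξ₀| < 1} =
          (ContinuousLinearMap.snd ℝ ℝ ℝ) ⁻¹' Metric.ball ξ₀ 1 := by
        ext q; simp [Real.dist_eq]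
      rw [hcv]
      exact ((convex_ball ξ₀ 1).is_linear_preimage
        (ContinuousLinearMap.snd ℝ ℝ ℝ).toLinearMap.isLinear).isPreconnected)
    (fun j q _ => by
      have h1 := ((he.hasDerivAt 0 j q.2).hasFDerivAt.comp q
        (ContinuousLinearMap.snd ℝ ℝ ℝ).hasFDerivAt).mul
        ((hE j q.1).hasFDerivAt.comp q (ContinuousLinearMap.fst ℝ ℝ ℝ).hasFDerivAt)
      refine h1.congr_fderiv (ContinuousLinearMap.ext fun v => ?_)
      rw [linComb_apply]
      simp
      ring)
    (fun j q hq => by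
      refine (norm_linComb_le _ _).trans ?_
      rw [norm_mul _ (Complex.exp _), norm_exp_int_mul_I, mul_one, norm_mul (e 1 j q.2),
        norm_exp_int_mul_I, mul_one, ← div_eq_mul_inv, le_div_iff₀ (pow_pos (bracket_pos _) 2), mul_comm, mul_add]
      refine add_le_add ((hC j q.2).trans ?_) ((hD j q.2).trans ?_)
      · exact mul_le_mul_of_nonneg_left (hloc _ _ hq) hC0
      · exact mul_le_mul_of_nonneg_left (hloc _ _ hq) hD0)
    (by simp [ξ₀]) (he.summable p.1 p.2) (by simp [ξ₀])
  refine h.congr_fderiv ?_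
  have hp := ((he.angular.summable p.1 p.2).hasSum.prodMk
    (he.tail.summable p.1 p.2).hasSum).mapL linCombL
  exact hp.tsum_eq

/-- The total derivative is a fixed linear expression in two sums of the same kind, so smoothness
follows by induction. -/
theorem IsSymbolJet.contDiff_jetSum {α : ℝ} {e : ℕ → ℤ → ℝ → ℂ} (he : IsSymbolJet α e) :
    ContDiff ℝ ∞ fun p : ℝ × ℝ => jetSum e p.1 p.2 := by
  rw [contDiff_infty]
  intro k
  induction k generalizing α e with
  | zero =>
    exact contDiff_zero.mpr (continuous_iff_continuousAt.mpr fun p =>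
      (he.hasFDerivAt_jetSum p).continuousAt)
  | succ k ih =>
    push_cast
    rw [contDiff_succ_iff_hasFDerivAt]
    exact ⟨_, linCombL.contDiff.comp ((ih he.angular).prodMk (ih he.tail)), he.hasFDerivAt_jetSum⟩

theorem IsSymbolJet.hasDerivAt_fst {α : ℝ} {e : ℕ → ℤ → ℝ → ℂ} (he : IsSymbolJet α e) (θ ξ : ℝ) :
    HasDerivAt (fun θ => jetSum e θ ξ) (jetSum (fun k j ξ => j * Complex.I * e k j ξ) θ ξ) θ := by
  have h := (he.hasFDerivAt_jetSum (θ, ξ)).comp_hasDerivAt (f := fun θ : ℝ => (θ, ξ)) θ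
    ((hasDerivAt_id θ).prodMk (hasDerivAt_const θ ξ))
  exact h.congr_deriv (by simp [linComb_apply])

theorem IsSymbolJet.hasDerivAt_snd {α : ℝ} {e : ℕ → ℤ → ℝ → ℂ} (he : IsSymbolJet α e) (θ ξ : ℝ) :
    HasDerivAt (jetSum e θ) (jetSum (fun k => e (k + 1)) θ ξ) ξ := by
  have h := (he.hasFDerivAt_jetSum (θ, ξ)).comp_hasDerivAt (f := fun ξ : ℝ => (θ, ξ)) ξ
    ((hasDerivAt_const ξ θ).prodMk (hasDerivAt_id ξ))
  exact h.congr_deriv (by simp [linComb_apply])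

theorem IsSymbolJet.iterate_fst {α : ℝ} {e : ℕ → ℤ → ℝ → ℂ} (he : IsSymbolJet α e) (j : ℕ) :
    ∃ C : ℝ, ∀ θ ξ : ℝ, ‖iteratedDeriv j (fun t => jetSum e t ξ) θ‖ ≤ C * bracket ξ ^ α := by
  induction j generalizing e with
  | zero => simpa using he.norm_jetSum_le
  | succ j ih =>
    obtain ⟨C, hC⟩ := ih he.angular
    refine ⟨C, fun θ ξ => ?_⟩
    rw [iteratedDeriv_succ', funext fun t => (he.hasDerivAt_fst t ξ).deriv]
    exact hC θ ξ

theorem IsSymbolJet.isProlongedSymbol {α : ℝ} {e : ℕ → ℤ → ℝ → ℂ} (he : IsSymbolJet α e) :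
    IsProlongedSymbol α (jetSum e) := by
  refine ⟨he.contDiff_jetSum, fun θ ξ => ?_, fun j k => ?_⟩
  · refine tsum_congr fun j => ?_
    congr 1
    rw [Complex.exp_eq_exp_iff_exists_int]
    exact ⟨j, by push_cast; ring⟩
  · change ∃ C : ℝ, ∀ θ ξ : ℝ,
      ‖iteratedDeriv j (fun t => iteratedDeriv k (jetSum e t) ξ) θ‖ ≤ C * bracket ξ ^ (α - k)
    induction k generalizing α e with
    | zero => simpa using he.iterate_fst j
    | succ k ih =>
      obtain ⟨C, hC⟩ := ih he.tail
      refine ⟨C, fun θ ξ => ?_⟩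
      have h1 : ∀ t, iteratedDeriv (k + 1) (jetSum e t) ξ =
          iteratedDeriv k (jetSum (fun k => e (k + 1)) t) ξ := by
        intro t
        rw [iteratedDeriv_succ', funext fun x => (he.hasDerivAt_snd t x).deriv]
      simp only [h1]
      rw [show α - (k + 1 : ℕ) = α - 1 - k by push_cast; ring]
      exact hC θ ξ

/-- The symbol of a matrix of order `α` can be prolonged. -/
theorem IsPDMatrix.matSymbol_mem {α : ℝ} {M : ℤ → ℤ → ℂ} (hM : IsPDMatrix α M) :
    matSymbol M ∈ SigmaClass α := by
  obtain ⟨e, he, h⟩ := hM.exists_jet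
  refine ⟨jetSum e, he.isProlongedSymbol, fun θ n => ?_⟩
  simp only [matSymbol, jetSum, h]

/-! ### Symbols on `𝕋 × ℤ` defined by differences -/

/-- The bounds of a symbol of order `α` for at most `k` derivatives in `θ` and differences in `n`. -/
def SymbolUpTo : ℕ → ℝ → (ℝ → ℤ → ℂ) → Prop
  | 0, α, f => ∃ C : ℝ, ∀ θ (n : ℤ), ‖f θ n‖ ≤ C * bracket (n : ℝ) ^ α
  | k + 1, α, f => (∃ C : ℝ, ∀ θ (n : ℤ), ‖f θ n‖ ≤ C * bracket (n : ℝ) ^ α) ∧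
      (∀ n, Differentiable ℝ fun θ => f θ n) ∧
      SymbolUpTo k α (fun θ n => deriv (fun t => f t n) θ) ∧
      SymbolUpTo k (α - 1) (fun θ n => f θ (n + 1) - f θ n)

namespace SymbolUpTo

theorem bound {k : ℕ} {α : ℝ} {f : ℝ → ℤ → ℂ} (h : SymbolUpTo k α f) :
    ∃ C : ℝ, 0 ≤ C ∧ ∀ θ (n : ℤ), ‖f θ n‖ ≤ C * bracket (n : ℝ) ^ α := by
  have h1 : ∃ C : ℝ, ∀ θ (n : ℤ), ‖f θ n‖ ≤ C * bracket (n : ℝ) ^ α := by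
    cases k with
    | zero => exact h
    | succ k => exact h.1
  obtain ⟨C, hC⟩ := h1
  refine ⟨C, ?_, hC⟩
  have h0 := hC 0 0
  rw [Int.cast_zero, bracket_zero, Real.one_rpow, mul_one] at h0
  exact (norm_nonneg _).trans h0

theorem of_succ {k : ℕ} {α : ℝ} {f : ℝ → ℤ → ℂ} (h : SymbolUpTo (k + 1) α f) :
    SymbolUpTo k α f := by
  induction k generalizing α f with
  | zero => exact h.1
  | succ k ih => exact ⟨h.1, h.2.1, ih h.2.2.1, ih h.2.2.2⟩

theorem bound_add {α : ℝ} {f g : ℝ → ℤ → ℂ}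
    (hf : ∃ C : ℝ, ∀ θ (n : ℤ), ‖f θ n‖ ≤ C * bracket (n : ℝ) ^ α)
    (hg : ∃ C : ℝ, ∀ θ (n : ℤ), ‖g θ n‖ ≤ C * bracket (n : ℝ) ^ α) :
    ∃ C : ℝ, ∀ θ (n : ℤ), ‖f θ n + g θ n‖ ≤ C * bracket (n : ℝ) ^ α := by
  obtain ⟨C, hC⟩ := hf
  obtain ⟨D, hD⟩ := hg
  exact ⟨C + D, fun θ n => (norm_add_le _ _).trans (by linarith [hC θ n, hD θ n])⟩

theorem add {k : ℕ} {α : ℝ} {f g : ℝ → ℤ → ℂ} (hf : SymbolUpTo k α f) (hg : SymbolUpTo k α g) :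
    SymbolUpTo k α (fun θ n => f θ n + g θ n) := by
  induction k generalizing α f g with
  | zero => exact bound_add hf hg
  | succ k ih =>
    refine ⟨bound_add hf.1 hg.1, fun n => (hf.2.1 n).add (hg.2.1 n), ?_, ?_⟩
    · convert ih hf.2.2.1 hg.2.2.1 using 3 with θ n
      exact deriv_fun_add (hf.2.1 n θ) (hg.2.1 n θ)
    · convert ih hf.2.2.2 hg.2.2.2 using 3 with θ n
      ring

theorem neg {k : ℕ} {α : ℝ} {f : ℝ → ℤ → ℂ} (hf : SymbolUpTo k α f) :
    SymbolUpTo k α (fun θ n => -f θ n) := by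
  induction k generalizing α f with
  | zero => obtain ⟨C, hC⟩ := hf; exact ⟨C, fun θ n => by rw [norm_neg]; exact hC θ n⟩
  | succ k ih =>
    refine ⟨?_, fun n => (hf.2.1 n).neg, ?_, ?_⟩
    · obtain ⟨C, hC⟩ := hf.1
      exact ⟨C, fun θ n => by rw [norm_neg]; exact hC θ n⟩
    · convert ih hf.2.2.1 using 3 with θ n
      exact deriv.fun_neg
    · convert ih hf.2.2.2 using 3 with θ n
      ring

theorem bound_shift {α : ℝ} {f : ℝ → ℤ → ℂ}
    (hf : ∃ C : ℝ, 0 ≤ C ∧ ∀ θ (n : ℤ), ‖f θ n‖ ≤ C * bracket (n : ℝ) ^ α) :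
    ∃ C : ℝ, ∀ θ (n : ℤ), ‖f θ (n + 1)‖ ≤ C * bracket (n : ℝ) ^ α := by
  obtain ⟨C, hC0, hC⟩ := hf
  refine ⟨C * bracket 1 ^ ⌈|α|⌉₊, fun θ n => (hC θ (n + 1)).trans ?_⟩
  rw [mul_assoc]
  refine mul_le_mul_of_nonneg_left ?_ hC0
  simpa using peetre_pow ((n + 1 : ℤ) : ℝ) n α

theorem shift {k : ℕ} {α : ℝ} {f : ℝ → ℤ → ℂ} (hf : SymbolUpTo k α f) :
    SymbolUpTo k α (fun θ n => f θ (n + 1)) := by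
  induction k generalizing α f with
  | zero => exact bound_shift hf.bound
  | succ k ih =>
    exact ⟨bound_shift hf.bound, fun n => hf.2.1 (n + 1), ih hf.2.2.1, ih hf.2.2.2⟩

theorem bound_mul {k l : ℕ} {α β : ℝ} {f g : ℝ → ℤ → ℂ} (hf : SymbolUpTo k α f)
    (hg : SymbolUpTo l β g) :
    ∃ C : ℝ, ∀ θ (n : ℤ), ‖f θ n * g θ n‖ ≤ C * bracket (n : ℝ) ^ (α + β) := by
  obtain ⟨C, hC0, hC⟩ := hf.bound
  obtain ⟨D, hD0, hD⟩ := hg.bound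
  refine ⟨C * D, fun θ n => ?_⟩
  rw [norm_mul, bracket_rpow_add]
  refine (mul_le_mul (hC θ n) (hD θ n) (norm_nonneg _)
    (mul_nonneg hC0 (bracket_rpow_nonneg _ _))).trans (le_of_eq (by ring))

theorem mul {k : ℕ} {α β : ℝ} {f g : ℝ → ℤ → ℂ} (hf : SymbolUpTo k α f)
    (hg : SymbolUpTo k β g) : SymbolUpTo k (α + β) (fun θ n => f θ n * g θ n) := by
  induction k generalizing α β f g with
  | zero => exact bound_mul hf hg
  | succ k ih =>
    refine ⟨bound_mul hf hg, fun n => (hf.2.1 n).mul (hg.2.1 n), ?_, ?_⟩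
    · convert (ih hf.2.2.1 hg.of_succ).add (ih hf.of_succ hg.2.2.1) using 3 with θ n
      exact deriv_fun_mul (hf.2.1 n θ) (hg.2.1 n θ)
    · have h1 := ih hf.2.2.2 hg.of_succ
      have h2 := ih hf.of_succ.shift hg.2.2.2
      rw [show α - 1 + β = α + β - 1 by ring] at h1
      rw [show α + (β - 1) = α + β - 1 by ring] at h2
      convert h1.add h2 using 3 with θ n
      ring

/-- Reciprocals are the reason for this class: the lower bound is available only at integer n, and
here nothing else is needed. The derivative is -f' f⁻¹ f⁻¹, and the difference is -Δf times the
reciprocals at n and n + 1; both are products of functions already controlled. -/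
theorem inv {α : ℝ} {f : ℝ → ℤ → ℂ} (hf : ∀ k, SymbolUpTo k α f) {c : ℝ} (hc : 0 < c)
    (hlow : ∀ θ (n : ℤ), c * bracket (n : ℝ) ^ α ≤ ‖f θ n‖) (k : ℕ) :
    SymbolUpTo k (-α) (fun θ n => (f θ n)⁻¹) := by
  have hne : ∀ θ n, f θ n ≠ 0 := fun θ n =>
    norm_pos_iff.mp (lt_of_lt_of_le (mul_pos hc (bracket_rpow_pos _ _)) (hlow θ n))
  have hb : ∃ C : ℝ, ∀ θ (n : ℤ), ‖(f θ n)⁻¹‖ ≤ C * bracket (n : ℝ) ^ (-α) := by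
    refine ⟨c⁻¹, fun θ n => ?_⟩
    rw [norm_inv, Real.rpow_neg (bracket_nonneg _), ← mul_inv]
    exact inv_anti₀ (mul_pos hc (bracket_rpow_pos _ _)) (hlow θ n)
  induction k with
  | zero => exact hb
  | succ k ih =>
    refine ⟨hb, fun n => ((hf 1).2.1 n).inv fun θ => hne θ n, ?_, ?_⟩
    · have h := (((hf (k + 1)).2.2.1.mul ih).mul ih).neg
      rw [show α + -α + -α = -α by ring] at h
      convert h using 3 with θ n
      rw [deriv_fun_inv'' ((hf 1).2.1 n θ) (hne θ n)]
      field_simp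
    · have h := (((hf (k + 1)).2.2.2.mul ih).mul ih.shift).neg
      rw [show α - 1 + -α + -α = -α - 1 by ring] at h
      convert h using 3 with θ n
      have := hne θ n
      have := hne θ (n + 1)
      field_simp
      ring

end SymbolUpTo

theorem PDMatrixUpTo.diagDeriv {k : ℕ} {α : ℝ} {M : ℤ → ℤ → ℂ} (h : PDMatrixUpTo k α M) :
    PDMatrixUpTo k α (diagDeriv M) := by
  induction k generalizing α M with
  | zero => exact DecayBound.diagDeriv h
  | succ k ih => exact ⟨h.1.diagDeriv, by rw [diagDiff_diagDeriv]; exact ih h.2⟩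

/-- Derivatives in θ of the symbol belong to `diagDeriv M`, differences in n to `diagDiff M`, and
both matrices stay in the calculus. -/
theorem IsPDMatrix.symbolUpTo {α : ℝ} {M : ℤ → ℤ → ℂ} (hM : IsPDMatrix α M) (k : ℕ) :
    SymbolUpTo k α (matSymbol M) := by
  induction k generalizing α M with
  | zero => obtain ⟨C, -, hC⟩ := hM.decayBound.norm_matSymbol_le; exact ⟨C, hC⟩
  | succ k ih =>
    refine ⟨(ih hM).bound.imp fun C hC => hC.2, fun n θ =>
      (hasDerivAt_matSymbol hM.decayBound θ n).differentiableAt, ?_, ?_⟩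
    · convert ih (M := diagDeriv M) (fun k => (hM k).diagDeriv) using 3 with θ n
      exact (hasDerivAt_matSymbol hM.decayBound θ n).deriv
    · convert ih hM.diagDiff using 3 with θ n
      rw [sub_eq_iff_eq_add,
        ← matSymbol_add hM.diagDiff.decayBound hM.decayBound θ n]
      refine tsum_congr fun l => ?_
      simp only [Pi.add_apply, _root_.diagDiff, sub_add_cancel, add_right_comm n l 1]

theorem SymbolUpTo.fourierCoef_decay {α : ℝ} {f : ℝ → ℤ → ℂ} (hf : ∀ k, SymbolUpTo k α f)
    (hper : ∀ θ n, f (θ + 2 * Real.pi) n = f θ n) (N : ℕ) : ∃ C : ℝ, ∀ j n : ℤ,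
      bracket (j : ℝ) ^ N * ‖fourierCoef (fun θ => f θ n) j‖ ≤ C * bracket (n : ℝ) ^ α := by
  induction N generalizing f with
  | zero =>
    obtain ⟨C, -, hC⟩ := (hf 0).bound
    exact ⟨C, fun j n => by simpa using norm_fourierCoef_le (fun θ => hC θ n) j⟩
  | succ N ih =>
    obtain ⟨C, hC⟩ := ih hf hper
    obtain ⟨D, hD⟩ := ih (fun k => (hf (k + 1)).2.2.1)
      (fun θ n => periodic_deriv (fun θ => hper θ n) θ)
    refine ⟨C + D, fun j n => ?_⟩
    have h1 := hC j n
    have h2 := hD j n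
    rw [fourierCoef_deriv ((hf 1).2.1 n) ((hf 2).2.2.1.2.1 n).continuous (fun θ => hper θ n),
      norm_mul, norm_mul, Complex.norm_I, mul_one, Complex.norm_intCast] at h2
    rw [pow_succ]
    calc _ = bracket (j : ℝ) ^ N * ‖fourierCoef (fun θ => f θ n) j‖ +
          bracket (j : ℝ) ^ N * (|(j : ℝ)| * ‖fourierCoef (fun θ => f θ n) j‖) := by
          simp only [bracket]; ring
      _ ≤ _ := by linarith

theorem SymbolUpTo.isPDMatrix {α : ℝ} {f : ℝ → ℤ → ℂ} (hf : ∀ k, SymbolUpTo k α f)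
    (hper : ∀ θ n, f (θ + 2 * Real.pi) n = f θ n) : IsPDMatrix α (symbolMatrix f) := by
  have h0 : ∀ {α : ℝ} {f : ℝ → ℤ → ℂ}, (∀ k, SymbolUpTo k α f) →
      (∀ θ n, f (θ + 2 * Real.pi) n = f θ n) → DecayBound α (symbolMatrix f) := by
    intro α f hf hper N
    obtain ⟨C, hC⟩ := SymbolUpTo.fourierCoef_decay hf hper N
    refine ⟨C, fun m n => ?_⟩
    rw [symbolMatrix_apply]
    simpa using hC (m - n) n
  intro k
  induction k generalizing α f with
  | zero => exact h0 hf hper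
  | succ k ih =>
    refine ⟨h0 hf hper, ?_⟩
    -- The offset m - n is unchanged along a diagonal, so the matrix difference is the Fourier
    -- coefficient of the difference of the symbol in n.
    convert ih (fun k => (hf (k + 1)).2.2.2) (fun θ n => by rw [hper, hper]) using 1
    funext m n
    have hc : ∀ n, Continuous fun θ => f θ n := fun n => ((hf 1).2.1 n).continuous
    rw [diagDiff, symbolMatrix_apply, symbolMatrix_apply, symbolMatrix_apply,
      add_sub_add_right_eq_sub]
    have hI : ∀ j : ℤ, IntervalIntegrable
        (fun θ : ℝ => f θ j * Complex.exp (-(((m - n : ℤ) : ℂ) * θ * Complex.I))) volume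
        (-Real.pi) Real.pi := fun j => by
      have hE : Continuous fun θ : ℝ => Complex.exp (-(((m - n : ℤ) : ℂ) * θ * Complex.I)) := by
        fun_prop
      exact ((hc j).mul hE).intervalIntegrable _ _
    unfold fourierCoef
    rw [← mul_sub, ← intervalIntegral.integral_sub (hI (n + 1)) (hI n)]
    simp only [sub_mul]

/-! ### Parametrices -/

/-- Matrices invariant under the reflection of the basis `e_n ↦ e_{-n}`. -/
def IsReflectionInvariant (M : ℤ → ℤ → ℂ) : Prop := ∀ m n, M (-m) (-n) = M m n

namespace IsReflectionInvariant

theorem matMul {A B : ℤ → ℤ → ℂ} (hA : IsReflectionInvariant A) (hB : IsReflectionInvariant B) :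
    IsReflectionInvariant (matMul A B) := by
  intro m n
  rw [_root_.matMul, ← (Equiv.neg ℤ).tsum_eq]
  exact tsum_congr fun l => by rw [Equiv.neg_apply, hA, hB]

theorem matOne : IsReflectionInvariant matOne := by
  intro m n; simp [_root_.matOne]

theorem sub {A B : ℤ → ℤ → ℂ} (hA : IsReflectionInvariant A) (hB : IsReflectionInvariant B) :
    IsReflectionInvariant (A - B) := by
  intro m n; simp only [Pi.sub_apply, hA m n, hB m n]

theorem lowColumns {A : ℤ → ℤ → ℂ} (hA : IsReflectionInvariant A) (L : ℕ) :
    IsReflectionInvariant (lowColumns L A) := by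
  intro m n; simp only [_root_.lowColumns, Int.natAbs_neg, hA m n]

theorem matSymbol {A : ℤ → ℤ → ℂ} (hA : IsReflectionInvariant A) (θ : ℝ) (n : ℤ) :
    matSymbol A (-θ) (-n) = matSymbol A θ n := by
  rw [_root_.matSymbol, ← (Equiv.neg ℤ).tsum_eq]
  refine tsum_congr fun l => ?_
  rw [Equiv.neg_apply, ← neg_add, hA]
  congr 2
  push_cast
  ring

theorem symbolMatrix {σ : ℝ → ℤ → ℂ} (h : ∀ θ n, σ (-θ) (-n) = σ θ n) :
    IsReflectionInvariant (symbolMatrix σ) := by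
  intro m n
  rw [symbolMatrix_apply, symbolMatrix_apply, show -m - -n = -(m - n) by ring,
    ← fourierCoef_comp_neg]
  simp only [h]

end IsReflectionInvariant

/-- Matrices of order `-∞`. -/
def IsSmoothingMatrix (M : ℤ → ℤ → ℂ) : Prop := ∀ α, IsPDMatrix α M

namespace IsSmoothingMatrix

theorem add {A B : ℤ → ℤ → ℂ} (hA : IsSmoothingMatrix A) (hB : IsSmoothingMatrix B) :
    IsSmoothingMatrix (A + B) := fun α => (hA α).add (hB α)

theorem sub {A B : ℤ → ℤ → ℂ} (hA : IsSmoothingMatrix A) (hB : IsSmoothingMatrix B) :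
    IsSmoothingMatrix (A - B) := fun α => (hA α).sub (hB α)

theorem neg {A : ℤ → ℤ → ℂ} (hA : IsSmoothingMatrix A) : IsSmoothingMatrix (-A) :=
  fun α => (hA α).neg

theorem mul_right {β : ℝ} {A B : ℤ → ℤ → ℂ} (hA : IsSmoothingMatrix A) (hB : IsPDMatrix β B) :
    IsSmoothingMatrix (matMul A B) := fun α => by simpa using (hA (α - β)).matMul hB

theorem mul_left {β : ℝ} {A B : ℤ → ℤ → ℂ} (hA : IsPDMatrix β A) (hB : IsSmoothingMatrix B) :
    IsSmoothingMatrix (matMul A B) := fun α => by simpa using hA.matMul (hB (α - β))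

end IsSmoothingMatrix

/-! ### Neumann series and inversion of 1 - R modulo smoothing matrices. -/

/-- The powers of a matrix. -/
noncomputable def matPow (T : ℤ → ℤ → ℂ) : ℕ → ℤ → ℤ → ℂ
  | 0 => matOne
  | k + 1 => matMul T (matPow T k)

theorem IsPDMatrix.matPow {α : ℝ} {T : ℤ → ℤ → ℂ} (hT : IsPDMatrix α T) (k : ℕ) :
    IsPDMatrix (k * α) (matPow T k) := by
  induction k with
  | zero => simpa [_root_.matPow] using isPDMatrix_matOne
  | succ k ih =>
    have h := hT.matMul ih
    rwa [show α + k * α = (k + 1 : ℕ) * α by push_cast; ring] at h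

theorem matPow_add {α : ℝ} {T : ℤ → ℤ → ℂ} (hT : IsPDMatrix α T) (k l : ℕ) :
    matPow T (k + l) = matMul (matPow T k) (matPow T l) := by
  induction k with
  | zero => rw [zero_add, matPow, matOne_matMul]
  | succ k ih =>
    rw [add_right_comm, matPow, ih, matPow, matMul_assoc hT.decayBound (hT.matPow k).decayBound
      (hT.matPow l).decayBound]

theorem matPow_succ' {α : ℝ} {T : ℤ → ℤ → ℂ} (hT : IsPDMatrix α T) (k : ℕ) :
    matPow T (k + 1) = matMul (matPow T k) T := by
  rw [matPow_add hT]
  congr 1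
  rw [matPow, matPow, matMul_matOne]

/-- Entries of a product are bounded by a row sum times a supremum. This keeps the geometric factor
of the powers while a factor on the left or right contributes decay in m or n. -/
theorem norm_matMul_le {A X : ℤ → ℤ → ℂ} {m n : ℤ} {a b : ℝ} (hA : Summable fun l => ‖A m l‖)
    (ha : ∑' l, ‖A m l‖ ≤ a) (hb0 : 0 ≤ b) (hX : ∀ l, ‖X l n‖ ≤ b) : ‖matMul A X m n‖ ≤ a * b := by
  have hle : ∀ l, ‖A m l * X l n‖ ≤ ‖A m l‖ * b := fun l => by
    rw [norm_mul]; exact mul_le_mul_of_nonneg_left (hX l) (norm_nonneg _)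
  have hs : Summable fun l => ‖A m l * X l n‖ :=
    Summable.of_nonneg_of_le (fun _ => norm_nonneg _) hle (hA.mul_right b)
  calc ‖matMul A X m n‖ ≤ ∑' l, ‖A m l * X l n‖ := norm_tsum_le_tsum_norm hs
    _ ≤ ∑' l, ‖A m l‖ * b := hs.tsum_le_tsum hle (hA.mul_right b)
    _ = (∑' l, ‖A m l‖) * b := tsum_mul_right
    _ ≤ a * b := mul_le_mul_of_nonneg_right ha hb0

theorem norm_matMul_le' {X A : ℤ → ℤ → ℂ} {m n : ℤ} {a b : ℝ} (hA : Summable fun l => ‖A l n‖)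
    (ha : ∑' l, ‖A l n‖ ≤ a) (hb0 : 0 ≤ b) (hX : ∀ l, ‖X m l‖ ≤ b) : ‖matMul X A m n‖ ≤ a * b := by
  have h := norm_matMul_le (A := fun n l => A l n) (X := fun l m => X m l) (m := n) (n := m)
    hA ha hb0 hX
  convert h using 2
  exact tsum_congr fun l => mul_comm _ _

theorem DecayBound.column_sum {α : ℝ} {A : ℤ → ℤ → ℂ} (hA : DecayBound α A) :
    ∃ C : ℝ, 0 ≤ C ∧ ∀ n : ℤ, (Summable fun l => ‖A l n‖) ∧
      ∑' l, ‖A l n‖ ≤ C * bracket (n : ℝ) ^ α := by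
  obtain ⟨C, hC⟩ := hA 2
  refine ⟨C * bracketSum, mul_nonneg (DecayBound.const_nonneg hC) bracketSum_nonneg,
    fun n => ⟨summable_norm_of_bracket fun l => hC l n, ?_⟩⟩
  exact (tsum_norm_le_of_bracket fun l => hC l n).trans (le_of_eq (by ring))

/-- The class measures growth by the column index; Peetre's inequality exchanges it for the row
index, using part of the off-diagonal decay. -/
theorem DecayBound.row_sum {α : ℝ} {A : ℤ → ℤ → ℂ} (hA : DecayBound α A) :
    ∃ C : ℝ, 0 ≤ C ∧ ∀ m : ℤ, (Summable fun l => ‖A m l‖) ∧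
      ∑' l, ‖A m l‖ ≤ C * bracket (m : ℝ) ^ α := by
  obtain ⟨C, hC⟩ := hA (2 + ⌈|α|⌉₊)
  have hC0 := DecayBound.const_nonneg hC
  have h : ∀ m l : ℤ, bracket ((l : ℝ) - m) ^ 2 * ‖A m l‖ ≤ C * bracket (m : ℝ) ^ α := by
    intro m l
    have h1 := hC m l
    have h2 := peetre_pow (l : ℝ) m α
    rw [bracket_sub_comm (m : ℝ)] at h1
    have hb : 0 < bracket ((l : ℝ) - m) ^ ⌈|α|⌉₊ := pow_pos (bracket_pos _) _
    refine le_of_mul_le_mul_left ?_ hb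
    calc _ = bracket ((l : ℝ) - m) ^ (2 + ⌈|α|⌉₊) * ‖A m l‖ := by rw [pow_add]; ring
      _ ≤ C * bracket (l : ℝ) ^ α := h1
      _ ≤ C * (bracket ((l : ℝ) - m) ^ ⌈|α|⌉₊ * bracket (m : ℝ) ^ α) := by gcongr
      _ = _ := by ring
  refine ⟨C * bracketSum, mul_nonneg hC0 bracketSum_nonneg,
    fun m => ⟨summable_norm_of_bracket (n := m) (h m), ?_⟩⟩
  exact (tsum_norm_le_of_bracket (n := m) (h m)).trans (le_of_eq (by ring))

/-- The Neumann series of a matrix. -/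
noncomputable def neumannSeries (T : ℤ → ℤ → ℂ) (m n : ℤ) : ℂ := ∑' k, matPow T k m n

theorem norm_matPow_le {T : ℤ → ℤ → ℂ} (hT : IsPDMatrix (-1) T)
    (hrow : ∀ m, ∑' l, ‖T m l‖ ≤ 1 / 2) (k : ℕ) (m n : ℤ) : ‖matPow T k m n‖ ≤ (1 / 2) ^ k := by
  obtain ⟨C, -, hC⟩ := hT.decayBound.row_sum
  induction k generalizing m n with
  | zero =>
    simp only [matPow, matOne, pow_zero]
    split_ifs <;> simp
  | succ k ih =>
    rw [pow_succ']
    exact norm_matMul_le (hC m).1 (hrow m) (by positivity) (fun l => ih l n)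

theorem summable_matPow {T : ℤ → ℤ → ℂ} (hT : IsPDMatrix (-1) T)
    (hrow : ∀ m, ∑' l, ‖T m l‖ ≤ 1 / 2) (m n : ℤ) : Summable fun k => matPow T k m n :=
  Summable.of_norm_bounded (summable_geometric_of_lt_one (by norm_num) (by norm_num))
    (fun k => norm_matPow_le hT hrow k m n)

theorem neumannSeries_eq_add_left {T : ℤ → ℤ → ℂ} (hT : IsPDMatrix (-1) T)
    (hrow : ∀ m, ∑' l, ‖T m l‖ ≤ 1 / 2) :
    neumannSeries T = matOne + matMul T (neumannSeries T) := by
  obtain ⟨C, -, hC⟩ := hT.decayBound.row_sum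
  funext m n
  rw [neumannSeries, (summable_matPow hT hrow m n).tsum_eq_zero_add, Pi.add_apply, Pi.add_apply]
  congr 1
  simp only [matMul, neumannSeries, matPow, ← tsum_mul_left]
  refine Summable.tsum_comm (f := fun l (k : ℕ) => T m l * matPow T k l n) (Summable.of_norm ?_)
  have hg : Summable fun k : ℕ => (1 / 2 : ℝ) ^ k :=
    summable_geometric_of_lt_one (by norm_num) (by norm_num)
  have hprod := (hC m).1.mul_of_nonneg hg (fun _ => norm_nonneg _) (fun k => by positivity)
  refine Summable.of_nonneg_of_le (fun _ => norm_nonneg _) (fun p => ?_) hprod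
  simp only [Function.uncurry, norm_mul]
  exact mul_le_mul_of_nonneg_left (norm_matPow_le hT hrow p.2 p.1 n) (norm_nonneg _)

theorem neumannSeries_eq_add_right {T : ℤ → ℤ → ℂ} (hT : IsPDMatrix (-1) T)
    (hrow : ∀ m, ∑' l, ‖T m l‖ ≤ 1 / 2) :
    neumannSeries T = matOne + matMul (neumannSeries T) T := by
  obtain ⟨C, -, hC⟩ := hT.decayBound.column_sum
  funext m n
  rw [neumannSeries, (summable_matPow hT hrow m n).tsum_eq_zero_add, Pi.add_apply, Pi.add_apply]
  congr 1
  simp only [matPow_succ' hT]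
  simp only [matMul, neumannSeries, ← tsum_mul_right]
  refine Summable.tsum_comm (f := fun l (k : ℕ) => matPow T k m l * T l n) (Summable.of_norm ?_)
  have hg : Summable fun k : ℕ => (1 / 2 : ℝ) ^ k :=
    summable_geometric_of_lt_one (by norm_num) (by norm_num)
  have hprod := (hC n).1.mul_of_nonneg hg (fun _ => norm_nonneg _) (fun k => by positivity)
  refine Summable.of_nonneg_of_le (fun _ => norm_nonneg _) (fun p => ?_) hprod
  simp only [Function.uncurry, norm_mul]
  rw [mul_comm]
  exact mul_le_mul_of_nonneg_left (norm_matPow_le hT hrow p.2 m p.1) (norm_nonneg _)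

/-- The first 2N powers have order at most 0. Each later one is written T^N T^i T^N: the left factor
gives (1 + |m|)^{-N}, the right one (1 + |n|)^{-N}, and the middle one 2^{-i}. The remainder thus
decays jointly in m and n, as `IsPDMatrix.of_approx` requires. -/
theorem isPDMatrix_neumannSeries {T : ℤ → ℤ → ℂ} (hT : IsPDMatrix (-1) T)
    (hrow : ∀ m, ∑' l, ‖T m l‖ ≤ 1 / 2) : IsPDMatrix 0 (neumannSeries T) := by
  refine IsPDMatrix.of_approx fun N => ⟨∑ i ∈ Finset.range (N + N), matPow T i, ?_, ?_⟩
  · refine Finset.sum_induction _ (IsPDMatrix 0) (fun _ _ h h' => h.add h')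
      (isPDMatrix_zero 0) (fun i _ => (hT.matPow i).mono ?_)
    have : (0 : ℝ) ≤ i := Nat.cast_nonneg i
    linarith
  · obtain ⟨C, hC0, hC⟩ := (hT.matPow N).decayBound.column_sum
    obtain ⟨D, hD0, hD⟩ := (hT.matPow N).decayBound.row_sum
    have hpow : ∀ x : ℝ, bracket x ^ ((N : ℝ) * -1) = (bracket x ^ N)⁻¹ := by
      intro x
      rw [mul_neg_one, Real.rpow_neg (bracket_nonneg _), Real.rpow_natCast]
    simp only [hpow] at hC hD
    refine ⟨2 * (C * D), fun m n => ?_⟩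
    have hm : 0 < bracket (m : ℝ) ^ N := pow_pos (bracket_pos _) N
    have hn : 0 < bracket (n : ℝ) ^ N := pow_pos (bracket_pos _) N
    have hterm : ∀ i : ℕ, ‖matPow T (i + (N + N)) m n‖ ≤
        (1 / 2) ^ i * (C * D * ((bracket (m : ℝ) ^ N)⁻¹ * (bracket (n : ℝ) ^ N)⁻¹)) := by
      intro i
      rw [show i + (N + N) = N + (i + N) by ring, matPow_add hT, matPow_add hT i]
      refine (norm_matMul_le (hD m).1 (hD m).2 (b := C * (bracket (n : ℝ) ^ N)⁻¹ * (1 / 2) ^ i)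
        (by positivity) fun l => ?_).trans (le_of_eq (by ring))
      exact norm_matMul_le' (hC n).1 (hC n).2 (by positivity)
        (fun a => norm_matPow_le hT hrow i l a)
    have heq : (neumannSeries T - ∑ i ∈ Finset.range (N + N), matPow T i) m n =
        ∑' i, matPow T (i + (N + N)) m n := by
      rw [Pi.sub_apply, Pi.sub_apply, Finset.sum_apply, Finset.sum_apply, sub_eq_iff_eq_add',
        neumannSeries, (summable_matPow hT hrow m n).sum_add_tsum_nat_add]
    have hgeo := hasSum_geometric_two.mul_right
      (C * D * ((bracket (m : ℝ) ^ N)⁻¹ * (bracket (n : ℝ) ^ N)⁻¹))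
    rw [heq]
    have h := tsum_of_norm_bounded hgeo hterm
    calc _ ≤ bracket (m : ℝ) ^ N * bracket (n : ℝ) ^ N *
          (2 * (C * D * ((bracket (m : ℝ) ^ N)⁻¹ * (bracket (n : ℝ) ^ N)⁻¹))) := by gcongr
      _ = 2 * (C * D) := by field_simp

theorem IsReflectionInvariant.neumannSeries {T : ℤ → ℤ → ℂ} (hT : IsReflectionInvariant T) :
    IsReflectionInvariant (neumannSeries T) := by
  have hp : ∀ k, IsReflectionInvariant (matPow T k) := by
    intro k
    induction k with
    | zero => exact IsReflectionInvariant.matOne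
    | succ k ih => exact hT.matMul ih
  intro m n
  exact tsum_congr fun k => hp k m n

/-- `1 - R` is invertible modulo smoothing matrices if `R` is of order `-1`. -/
theorem exists_inverse_one_sub {R : ℤ → ℤ → ℂ} (hR : IsPDMatrix (-1) R)
    (hs : IsReflectionInvariant R) : ∃ G : ℤ → ℤ → ℂ, IsPDMatrix 0 G ∧ IsReflectionInvariant G ∧
      IsPDMatrix (-1) (G - matOne) ∧ IsSmoothingMatrix (matMul (matOne - R) G - matOne) ∧
      IsSmoothingMatrix (matMul G (matOne - R) - matOne) := by
  obtain ⟨C, hC⟩ := hR.decayBound 2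
  have hC0 := DecayBound.const_nonneg hC
  have hS := bracketSum_pos
  -- On the remaining columns |l| ≥ L the factor (1 + |l|)⁻¹ is at most 1/(1 + L), so this choice
  -- makes all row sums at most 1/2.
  obtain ⟨L, hL⟩ := exists_nat_ge (2 * C * bracketSum)
  set F := lowColumns L R with hF
  have hFs : IsSmoothingMatrix F := fun β => hR.lowColumns L β
  set T := R - F with hTdef
  have hT : IsPDMatrix (-1) T := hR.sub (hFs _)
  have hTs : IsReflectionInvariant T := hs.sub (hs.lowColumns L)
  have hrow : ∀ m, ∑' l, ‖T m l‖ ≤ 1 / 2 := by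
    intro m
    have h1 : ∀ l : ℤ, bracket ((l : ℝ) - m) ^ 2 * ‖T m l‖ ≤ C / (1 + L) := by
      intro l
      simp only [hTdef, hF, Pi.sub_apply, lowColumns]
      split_ifs with h
      · rw [sub_self, norm_zero, mul_zero]
        positivity
      · rw [sub_zero, bracket_sub_comm]
        refine (hC m l).trans ?_
        rw [Real.rpow_neg_one, ← div_eq_mul_inv]
        refine div_le_div_of_nonneg_left hC0 (by positivity) ?_
        have h2 : |(l : ℝ)| = (l.natAbs : ℝ) := by rw [Nat.cast_natAbs, Int.cast_abs]
        rw [bracket, h2]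
        have : (L : ℝ) ≤ l.natAbs := by exact_mod_cast not_lt.mp h
        linarith
    refine (tsum_norm_le_of_bracket (n := m) h1).trans ?_
    rw [div_mul_eq_mul_div, div_le_iff₀ (by positivity)]
    linarith
  set G := neumannSeries T with hG
  have hG0 : IsPDMatrix 0 G := isPDMatrix_neumannSeries hT hrow
  have e1 : G = matOne + matMul T G := neumannSeries_eq_add_left hT hrow
  have e2 : G = matOne + matMul G T := neumannSeries_eq_add_right hT hrow
  refine ⟨G, hG0, hTs.neumannSeries, ?_, ?_, ?_⟩
  · have h := hT.matMul hG0
    rw [add_zero] at h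
    rwa [← sub_eq_iff_eq_add'.mpr e1] at h
  -- Since R = T + F and G inverts 1 - T exactly, only the smoothing term -FG is left.
  · have h : matMul (matOne - R) G - matOne = -matMul F G := by
      rw [show matOne - R = (matOne - T) - F by rw [hTdef]; abel,
        matMul_sub_left (isPDMatrix_matOne.decayBound.sub (hT.mono (by norm_num)).decayBound)
          (hFs 0).decayBound hG0.decayBound,
        matMul_sub_left isPDMatrix_matOne.decayBound hT.decayBound hG0.decayBound, matOne_matMul,
        ← sub_eq_iff_eq_add.mpr e1]
      abel
    rw [h]
    exact (hFs.mul_right hG0).neg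
  · have h : matMul G (matOne - R) - matOne = -matMul G F := by
      rw [show matOne - R = (matOne - T) - F by rw [hTdef]; abel,
        matMul_sub_right hG0.decayBound
          (isPDMatrix_matOne.decayBound.sub (hT.mono (by norm_num)).decayBound)
          (hFs 0).decayBound,
        matMul_sub_right hG0.decayBound isPDMatrix_matOne.decayBound hT.decayBound, matMul_matOne,
        ← sub_eq_iff_eq_add.mpr e2]
      abel
    rw [h]
    exact (IsSmoothingMatrix.mul_left hG0 hFs).neg

/-! ### Reciprocal symbols and parametrices of elliptic matrices. -/

theorem starMul_symbolMatrix {α : ℝ} {M : ℤ → ℤ → ℂ} (hM : DecayBound α M) {q : ℝ → ℤ → ℂ}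
    (hq : ∀ n, Continuous fun θ => q θ n) (hb : ∀ n, ∃ B : ℝ, ∀ θ, ‖q θ n‖ ≤ B) :
    starMul M (symbolMatrix q) = symbolMatrix fun θ n => matSymbol M θ n * q θ n := by
  funext m n
  obtain ⟨B, hB⟩ := hb n
  rw [symbolMatrix_apply]
  simp only [matSymbol]
  -- The Fourier coefficients of a product are a convolution; l ↦ m - l puts it in the form of
  -- `starMul`.
  rw [fourierCoef_tsum_mul (hM.summable_diag n) (hq n) hB, starMul,
    ← (Equiv.subLeft m).tsum_eq]
  refine tsum_congr fun l => ?_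
  rw [Equiv.subLeft_apply, symbolMatrix_apply]
  congr 2 <;> ring

theorem symbolMatrix_one : symbolMatrix (fun _ _ => 1) = matOne := by
  funext m n
  rw [symbolMatrix_apply, fourierCoef_one, matOne]
  simp only [sub_eq_zero]

/-- Ellipticity is stable under perturbations of lower order. -/
theorem IsEllipticSymbol.of_sub_le {α : ℝ} {σ σ' : ℝ → ℤ → ℂ} (hσ : IsEllipticSymbol α σ) {D : ℝ}
    (h : ∀ θ (n : ℤ), n ≠ 0 → ‖σ' θ n - σ θ n‖ ≤ D * bracket (n : ℝ) ^ (α - 1)) :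
    IsEllipticSymbol α σ' := by
  obtain ⟨c, hc, M, hM⟩ := hσ
  -- Beyond 2D/c the perturbation is at most half of the lower bound; the threshold 1 excludes n =
  -- 0.
  refine ⟨c / 2, by positivity, max (max M (2 * D / c)) 1, fun n hn θ => ?_⟩
  have hn0 : n ≠ 0 := by
    rintro rfl
    have := (le_max_right _ _).trans hn
    norm_num at this
  have h1 := hM n ((le_max_left _ _).trans ((le_max_left _ _).trans hn)) θ
  have h2 : 2 * D / c ≤ |(n : ℝ)| := (le_max_right _ _).trans ((le_max_left _ _).trans hn)
  have h3 := h θ n hn0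
  have h4 : ‖σ θ n‖ ≤ ‖σ' θ n‖ + ‖σ' θ n - σ θ n‖ := by
    have := norm_sub_le (σ' θ n) (σ' θ n - σ θ n)
    simpa using this
  change c * bracket (n : ℝ) ^ α ≤ _ at h1
  change c / 2 * bracket (n : ℝ) ^ α ≤ _
  have h5 : D * bracket (n : ℝ) ^ (α - 1) ≤ c / 2 * bracket (n : ℝ) ^ α := by
    have h6 : bracket (n : ℝ) ^ α = bracket (n : ℝ) ^ (α - 1) * bracket (n : ℝ) := by
      rw [← Real.rpow_add_one (bracket_pos _).ne', sub_add_cancel]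
    rw [h6, mul_comm (bracket (n : ℝ) ^ (α - 1)), ← mul_assoc]
    refine mul_le_mul_of_nonneg_right ?_ (bracket_rpow_nonneg _ _)
    rw [div_le_iff₀ hc] at h2
    have h7 : |(n : ℝ)| ≤ bracket (n : ℝ) := abs_le_bracket _
    nlinarith
  linarith

/-- With Q the matrix of the reciprocal symbol, M ⋆ Q = Q ⋆ M = 1, so MQ and QM differ from 1 by
matrices of order -1. Inverting these products modulo smoothing matrices gives a right parametrix QG
and a left one G'Q; the usual argument shows that they coincide modulo smoothing matrices. -/
theorem exists_parametrix_of_lower_bound {α : ℝ} {M : ℤ → ℤ → ℂ} (hM : IsPDMatrix α M)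
    (hs : IsReflectionInvariant M) {c : ℝ} (hc : 0 < c)
    (hlow : ∀ θ (n : ℤ), c * bracket (n : ℝ) ^ α ≤ ‖matSymbol M θ n‖) :
    ∃ B : ℤ → ℤ → ℂ, IsPDMatrix (-α) B ∧ IsReflectionInvariant B ∧
      IsEllipticSymbol (-α) (matSymbol B) ∧ IsSmoothingMatrix (matMul B M - matOne) ∧
      IsSmoothingMatrix (matMul M B - matOne) := by
  have hne : ∀ θ n, matSymbol M θ n ≠ 0 := fun θ n =>
    norm_pos_iff.mp (lt_of_lt_of_le (mul_pos hc (bracket_rpow_pos _ _)) (hlow θ n))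
  set q : ℝ → ℤ → ℂ := fun θ n => (matSymbol M θ n)⁻¹ with hq
  have hqs : ∀ k, SymbolUpTo k (-α) q := SymbolUpTo.inv hM.symbolUpTo hc hlow
  have hqper : ∀ θ n, q (θ + 2 * Real.pi) n = q θ n := fun θ n => by
    simp only [hq, matSymbol_periodic]
  have hqc : ∀ n, Continuous fun θ => q θ n := fun n => ((hqs 1).2.1 n).continuous
  set Q := symbolMatrix q with hQ
  have hQo : IsPDMatrix (-α) Q := SymbolUpTo.isPDMatrix hqs hqper
  have hQs : IsReflectionInvariant Q := IsReflectionInvariant.symbolMatrix fun θ n => by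
    simp only [hq, hs.matSymbol]
  have hstar : starMul M Q = matOne := by
    rw [hQ, starMul_symbolMatrix hM.decayBound hqc (fun n => by
      obtain ⟨C, -, hC⟩ := (hqs 0).bound
      exact ⟨_, fun θ => hC θ n⟩), ← symbolMatrix_one]
    congr 1
    funext θ n
    exact mul_inv_cancel₀ (hne θ n)
  have hR : IsPDMatrix (-1) (matOne - matMul M Q) := by
    have h := (hM.mulDefect hQo).neg
    rw [mulDefect_eq hM.decayBound hQo.decayBound, hstar, neg_sub,
      show α + -α - 1 = -1 by ring] at h
    exact h
  have hR' : IsPDMatrix (-1) (matOne - matMul Q M) := by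
    have h := (hQo.mulDefect hM).neg
    rw [mulDefect_eq hQo.decayBound hM.decayBound, starMul_comm, hstar, neg_sub,
      show -α + α - 1 = -1 by ring] at h
    exact h
  obtain ⟨G, hG, hGs, hG1, hGr, -⟩ := exists_inverse_one_sub hR
    (IsReflectionInvariant.matOne.sub (hs.matMul hQs))
  obtain ⟨G', hG', -, -, -, hGl⟩ := exists_inverse_one_sub hR'
    (IsReflectionInvariant.matOne.sub (hQs.matMul hs))
  rw [sub_sub_cancel] at hGr hGl
  have dM := hM.decayBound
  have dQ := hQo.decayBound
  have dG := hG.decayBound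
  have dG' := hG'.decayBound
  have d1 := isPDMatrix_matOne.decayBound
  set B := matMul Q G with hB
  have hBo : IsPDMatrix (-α) B := by simpa using hQo.matMul hG
  set B' := matMul G' Q with hB'
  have hBo' : IsPDMatrix (-α) B' := by simpa using hG'.matMul hQo
  have dB := hBo.decayBound
  have dB' := hBo'.decayBound
  have hright : IsSmoothingMatrix (matMul M B - matOne) := by
    rwa [hB, ← matMul_assoc dM dQ dG]
  have hleft' : IsSmoothingMatrix (matMul B' M - matOne) := by
    rwa [hB', matMul_assoc dG' dQ dM]
  refine ⟨B, hBo, hQs.matMul hGs, ?_, ?_, hright⟩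
  · have hσ : IsEllipticSymbol (-α) (matSymbol Q) := by
      rw [hQ, matSymbol_symbolMatrix dQ hqc hqper]
      obtain ⟨C, hC0, hC⟩ := hM.decayBound.norm_matSymbol_le
      refine ⟨(C + 1)⁻¹, by positivity, 0, fun n _ θ => ?_⟩
      change _ * bracket (n : ℝ) ^ (-α) ≤ _
      simp only [hq, norm_inv]
      rw [Real.rpow_neg (bracket_nonneg _), ← mul_inv]
      refine inv_anti₀ (norm_pos_iff.mpr (hne θ n)) ((hC θ n).trans ?_)
      exact mul_le_mul_of_nonneg_right (by linarith) (bracket_rpow_nonneg _ _)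
    -- G is the identity up to order -1, so B differs from Q by lower order terms and inherits its
    -- ellipticity.
    have hd : IsPDMatrix (-α - 1) (matMul Q (G - matOne)) := by
      simpa [sub_eq_add_neg] using hQo.matMul hG1
    have hBQ : B = matMul Q (G - matOne) + Q := by
      rw [matMul_sub_right dQ dG d1, matMul_matOne, sub_add_cancel]
    obtain ⟨D, -, hD⟩ := hd.decayBound.norm_matSymbol_le
    refine hσ.of_sub_le (D := D) fun θ n _ => ?_
    rw [hBQ, matSymbol_add hd.decayBound dQ, add_sub_cancel_right]
    exact hD θ n
  · have dMB := (hM.matMul hBo).decayBound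
    have dBM := (hBo'.matMul hM).decayBound
    -- Both terms on the right contain a smoothing factor; the contributions of B'MB cancel by
    -- associativity.
    have h1 : B - B' = matMul B' (matMul M B - matOne) - matMul (matMul B' M - matOne) B := by
      rw [matMul_sub_right dB' dMB d1, matMul_sub_left dBM d1 dB, matMul_matOne, matOne_matMul,
        matMul_assoc dB' dM dB]
      abel
    have h2 : IsSmoothingMatrix (B - B') := by
      rw [h1]
      exact (IsSmoothingMatrix.mul_left hBo' hright).sub (hleft'.mul_right hBo)
    have h3 : matMul B M - matOne = matMul (B - B') M + (matMul B' M - matOne) := by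
      rw [matMul_sub_left dB dB' dM]
      abel
    rw [h3]
    exact (h2.mul_right hM).add hleft'

/-- An elliptic matrix has a parametrix. -/
theorem exists_parametrix {α : ℝ} {M : ℤ → ℤ → ℂ} (hM : IsPDMatrix α M)
    (hs : IsReflectionInvariant M) (hell : IsEllipticSymbol α (matSymbol M)) :
    ∃ B : ℤ → ℤ → ℂ, IsPDMatrix (-α) B ∧ IsReflectionInvariant B ∧
      IsEllipticSymbol (-α) (matSymbol B) ∧ IsSmoothingMatrix (matMul B M - matOne) ∧
      IsSmoothingMatrix (matMul M B - matOne) := by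
  obtain ⟨c, hc, R, hR⟩ := hell
  obtain ⟨L, hL⟩ := exists_nat_ge R
  -- Subtracting F replaces the columns with |n| < L by those of the identity. The symbol equals 1
  -- there, so the lower bound holds for every n, at the cost of a smoothing change.
  set F := lowColumns L M - lowColumns L matOne with hF
  have hFs : IsSmoothingMatrix F := fun β => (hM.lowColumns L β).sub
    (isPDMatrix_matOne.lowColumns L β)
  set M' := M - F with hM'
  have hM'o : IsPDMatrix α M' := hM.sub (hFs α)
  have hM's : IsReflectionInvariant M' :=
    hs.sub ((hs.lowColumns L).sub (IsReflectionInvariant.matOne.lowColumns L))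
  have hbL : 0 < bracket (L : ℝ) ^ |α| := bracket_rpow_pos _ _
  have hlow : ∀ θ (n : ℤ), min c (bracket (L : ℝ) ^ |α|)⁻¹ * bracket (n : ℝ) ^ α ≤
      ‖matSymbol M' θ n‖ := by
    intro θ n
    by_cases hn : n.natAbs < L
    · have h1 : matSymbol M' θ n = 1 := by
        rw [matSymbol, tsum_eq_single 0]
        · simp [hM', hF, lowColumns, hn, matOne]
        · intro l hl
          simp [hM', hF, lowColumns, hn, matOne, hl]
      rw [h1, norm_one]
      have h2 : bracket (n : ℝ) ≤ bracket (L : ℝ) := by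
        have : |(n : ℝ)| = (n.natAbs : ℝ) := by rw [Nat.cast_natAbs, Int.cast_abs]
        rw [bracket, bracket, this, Nat.abs_cast]
        have : (n.natAbs : ℝ) ≤ L := by exact_mod_cast hn.le
        linarith
      have h3 : bracket (n : ℝ) ^ α ≤ bracket (L : ℝ) ^ |α| :=
        (bracket_rpow_mono _ (le_abs_self α)).trans
          (Real.rpow_le_rpow (bracket_nonneg _) h2 (abs_nonneg α))
      calc _ ≤ (bracket (L : ℝ) ^ |α|)⁻¹ * bracket (L : ℝ) ^ |α| :=
            mul_le_mul (min_le_right _ _) h3 (bracket_rpow_nonneg _ _) (inv_nonneg.mpr hbL.le)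
        _ = 1 := inv_mul_cancel₀ hbL.ne'
    · have h1 : matSymbol M' θ n = matSymbol M θ n := by
        refine tsum_congr fun l => ?_
        simp [hM', hF, lowColumns, hn]
      rw [h1]
      refine le_trans ?_ (hR n (hL.trans ?_) θ)
      · exact mul_le_mul_of_nonneg_right (min_le_left _ _) (bracket_rpow_nonneg _ _)
      · have : |(n : ℝ)| = (n.natAbs : ℝ) := by rw [Nat.cast_natAbs, Int.cast_abs]
        rw [this]
        exact_mod_cast not_lt.mp hn
  obtain ⟨B, hB, hBs, hBe, hl, hr⟩ := exists_parametrix_of_lower_bound hM'o hM's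
    (lt_min hc (inv_pos.mpr hbL)) hlow
  have hMF : M = M' + F := by rw [hM', sub_add_cancel]
  refine ⟨B, hB, hBs, hBe, ?_, ?_⟩
  · have h : matMul B M - matOne = (matMul B M' - matOne) + matMul B F := by
      rw [hMF, matMul_add_right hB.decayBound hM'o.decayBound (hFs 0).decayBound]
      abel
    rw [h]
    exact hl.add (IsSmoothingMatrix.mul_left hB hFs)
  · have h : matMul M B - matOne = (matMul M' B - matOne) + matMul F B := by
      rw [hMF, matMul_add_left hM'o.decayBound (hFs 0).decayBound hB.decayBound]
      abel
    rw [h]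
    exact hr.add (hFs.mul_right hB)

/-! ### Chebyshev series with rapidly decreasing coefficients -/

open Polynomial in
/-- Term-by-term differentiation of a series of polynomials on `[-1, 1]`. -/
theorem hasDerivWithinAt_tsum_polynomial {p : ℤ → ℝ[X]} {c : ℤ → ℂ} {C₀ C₁ : ℝ}
    (h₀ : ∀ (l : ℤ), ∀ x ∈ Icc (-1 : ℝ) 1, bracket (l : ℝ) ^ 2 * ‖c l * ((p l).eval x : ℝ)‖ ≤ C₀)
    (h₁ : ∀ (l : ℤ), ∀ x ∈ Icc (-1 : ℝ) 1,
      bracket (l : ℝ) ^ 2 * ‖c l * ((derivative (p l)).eval x : ℝ)‖ ≤ C₁)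
    {x : ℝ} (hx : x ∈ Icc (-1 : ℝ) 1) :
    HasDerivWithinAt (fun x : ℝ => ∑' l, c l * ((p l).eval x : ℝ))
      (∑' l, c l * ((derivative (p l)).eval x : ℝ)) (Icc (-1) 1) x := by
  have hsum : ∀ C : ℝ, Summable fun l : ℤ => (bracket (l : ℝ) ^ 2)⁻¹ * C :=
    fun C => summable_bracket_inv_sq.mul_right C
  have hle : ∀ {C : ℝ} {l : ℤ} {z : ℂ}, bracket (l : ℝ) ^ 2 * ‖z‖ ≤ C →
      ‖z‖ ≤ (bracket (l : ℝ) ^ 2)⁻¹ * C := by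
    intro C l z h
    rwa [le_inv_mul_iff₀ (pow_pos (bracket_pos _) 2)]
  have hs₀ : ∀ y ∈ Icc (-1 : ℝ) 1, Summable fun l => c l * ((p l).eval y : ℝ) := fun y hy =>
    Summable.of_norm_bounded (hsum C₀) fun l => hle (h₀ l y hy)
  have hs₁ : ∀ y ∈ Icc (-1 : ℝ) 1, Summable fun l => c l * ((derivative (p l)).eval y : ℝ) :=
    fun y hy => Summable.of_norm_bounded (hsum C₁) fun l => hle (h₁ l y hy)
  set F₁ : ℝ → ℂ := fun y => ∑' l, c l * ((derivative (p l)).eval y : ℝ) with hF₁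
  have hcont : ∀ l, Continuous fun y : ℝ => c l * (((derivative (p l)).eval y : ℝ) : ℂ) := fun l =>
    continuous_const.mul (Complex.continuous_ofReal.comp (Polynomial.continuous _))
  have hF₁c : ContinuousOn F₁ (Icc (-1) 1) :=
    continuousOn_tsum (fun l => (hcont l).continuousOn) (hsum C₁) fun l y hy => hle (h₁ l y hy)
  have h11 : (-1 : ℝ) ≤ 1 := by norm_num
  -- The continuous extension to the whole line makes the fundamental theorem of calculus two-sided,
  -- so the endpoints ±1 need no separate treatment.
  set G : ℝ → ℂ := IccExtend h11 ((Icc (-1) 1).domRestrict F₁) with hG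
  have hGc : Continuous G := hF₁c.domRestrict.Icc_extend'
  have hGF : ∀ y ∈ Icc (-1 : ℝ) 1, G y = F₁ y := fun y hy => IccExtend_of_mem h11 _ hy
  have hint : ∀ y ∈ Icc (-1 : ℝ) 1, ∑' l, c l * ((p l).eval y : ℝ) =
      ∑' l, c l * ((p l).eval 0 : ℝ) + ∫ t in (0 : ℝ)..y, G t := by
    intro y hy
    have h0 : (0 : ℝ) ∈ Icc (-1 : ℝ) 1 := by constructor <;> norm_num
    have hsub : ∀ t ∈ uIoc 0 y, t ∈ Icc (-1 : ℝ) 1 := fun t ht =>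
      uIcc_subset_Icc h0 hy (uIoc_subset_uIcc ht)
    have hI := intervalIntegral.hasSum_integral_of_dominated_convergence (μ := volume)
      (a := 0) (b := y) (F := fun l t => c l * (((derivative (p l)).eval t : ℝ) : ℂ)) (f := G)
      (fun l _ => (bracket (l : ℝ) ^ 2)⁻¹ * C₁)
      (fun l => (hcont l).aestronglyMeasurable)
      (fun l => Eventually.of_forall fun t ht => hle (h₁ l t (hsub t ht)))
      (Eventually.of_forall fun t _ => hsum C₁) intervalIntegrable_const
      (Eventually.of_forall fun t ht => by
        rw [hGF t (hsub t ht)]; exact (hs₁ t (hsub t ht)).hasSum)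
    have hterm : ∀ l, ∫ t in (0 : ℝ)..y, c l * (((derivative (p l)).eval t : ℝ) : ℂ) =
        c l * ((p l).eval y : ℝ) - c l * ((p l).eval 0 : ℝ) := by
      intro l
      rw [intervalIntegral.integral_eq_sub_of_hasDerivAt
        (f := fun t : ℝ => c l * (((p l).eval t : ℝ) : ℂ))]
      · intro t _
        exact (((p l).hasDerivAt t).ofReal_comp).const_mul (c l)
      · exact (hcont l).intervalIntegrable _ _
    simp only [hterm] at hI
    rw [← hI.tsum_eq, (hs₀ y hy).tsum_sub (hs₀ 0 h0)]
    ring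
  have hd : HasDerivAt (fun y => ∑' l, c l * ((p l).eval 0 : ℝ) + ∫ t in (0 : ℝ)..y, G t) (G x) x :=
    (hGc.integral_hasStrictDerivAt 0 x).hasDerivAt.const_add _
  rw [hGF x hx] at hd
  exact hd.hasDerivWithinAt.congr hint (hint x hx)

open Polynomial in
theorem contDiffOn_tsum_polynomial {p : ℤ → ℝ[X]} {c : ℤ → ℂ}
    (h : ∀ k : ℕ, ∃ C : ℝ, ∀ (l : ℤ), ∀ x ∈ Icc (-1 : ℝ) 1,
      bracket (l : ℝ) ^ 2 * ‖c l * ((derivative^[k] (p l)).eval x : ℝ)‖ ≤ C) :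
    ContDiffOn ℝ ∞ (fun x : ℝ => ∑' l, c l * ((p l).eval x : ℝ)) (Icc (-1) 1) := by
  rw [contDiffOn_infty]
  intro n
  have hderiv : ∀ {p : ℤ → ℝ[X]}, (∀ k : ℕ, ∃ C : ℝ, ∀ (l : ℤ), ∀ x ∈ Icc (-1 : ℝ) 1,
      bracket (l : ℝ) ^ 2 * ‖c l * ((derivative^[k] (p l)).eval x : ℝ)‖ ≤ C) →
      ∀ x ∈ Icc (-1 : ℝ) 1, HasDerivWithinAt (fun x : ℝ => ∑' l, c l * ((p l).eval x : ℝ))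
      (∑' l, c l * ((derivative (p l)).eval x : ℝ)) (Icc (-1) 1) x := by
    intro p h x hx
    obtain ⟨C₀, hC₀⟩ := h 0
    obtain ⟨C₁, hC₁⟩ := h 1
    exact hasDerivWithinAt_tsum_polynomial hC₀ hC₁ hx
  have hu : UniqueDiffOn ℝ (Icc (-1 : ℝ) 1) := uniqueDiffOn_Icc (by norm_num)
  induction n generalizing p with
  | zero => exact contDiffOn_zero.mpr fun x hx => (hderiv h x hx).continuousWithinAt
  | succ n ih =>
    push_cast
    rw [contDiffOn_succ_iff_derivWithin hu]
    refine ⟨fun x hx => (hderiv h x hx).differentiableWithinAt, by simp, ?_⟩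
    refine (ih (p := fun l => derivative (p l)) fun k => ?_).congr fun x hx =>
      (hderiv h x hx).derivWithin (hu x hx)
    obtain ⟨C, hC⟩ := h (k + 1)
    exact ⟨C, hC⟩

/-- On [-1, 1] the derivatives of T_l are largest at 1, where the k-th one is ∏(l² - i²) / ∏(2i + 1)
over i < k; this grows polynomially in l. -/
theorem abs_iterate_derivative_chebyshevT_le (k : ℕ) (l : ℤ) {x : ℝ} (hx : x ∈ Icc (-1 : ℝ) 1) :
    |(Polynomial.derivative^[k] (Polynomial.Chebyshev.T ℝ l)).eval x| ≤
      bracket (k : ℝ) ^ (2 * k) * bracket (l : ℝ) ^ (2 * k) := by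
  refine (Polynomial.Chebyshev.abs_iterate_derivative_T_real_le l k (abs_le.mpr hx)).trans ?_
  have h := Polynomial.Chebyshev.iterate_derivative_T_eval_one (R := ℝ) l k
  set P : ℝ := ((∏ i ∈ Finset.range k, (2 * i + 1) : ℕ) : ℝ) with hP
  have hP1 : 1 ≤ P := by
    have : 0 < ∏ i ∈ Finset.range k, (2 * i + 1) := Finset.prod_pos fun i _ => by positivity
    rw [hP]
    exact Nat.one_le_cast.mpr this
  have hprod : |((∏ i ∈ Finset.range k, (l ^ 2 - (i : ℤ) ^ 2) : ℤ) : ℝ)| ≤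
      (bracket (k : ℝ) ^ 2 * bracket (l : ℝ) ^ 2) ^ k := by
    push_cast
    rw [Finset.abs_prod]
    calc _ ≤ ∏ i ∈ Finset.range k, (bracket (k : ℝ) ^ 2 * bracket (l : ℝ) ^ 2) := by
          refine Finset.prod_le_prod (fun _ _ => abs_nonneg _) fun i hi => ?_
          have hi' : (i : ℝ) ≤ k := by exact_mod_cast (Finset.mem_range.mp hi).le
          have hi0 : (0 : ℝ) ≤ i := Nat.cast_nonneg i
          have e1 : (l : ℝ) ^ 2 ≤ bracket (l : ℝ) ^ 2 := by
            rw [← sq_abs (l : ℝ)]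
            exact pow_le_pow_left₀ (abs_nonneg _) (abs_le_bracket _) 2
          have e2 : (i : ℝ) ^ 2 ≤ bracket (k : ℝ) ^ 2 :=
            pow_le_pow_left₀ hi0 (hi'.trans ((le_abs_self _).trans (abs_le_bracket _))) 2
          have e3 : 1 ≤ bracket (k : ℝ) ^ 2 := one_le_pow₀ (one_le_bracket _)
          have e4 : 1 ≤ bracket (l : ℝ) ^ 2 := one_le_pow₀ (one_le_bracket _)
          rw [abs_le]
          constructor <;> nlinarith [sq_nonneg (l : ℝ), sq_nonneg (i : ℝ)]
      _ = _ := by simp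
  rw [pow_mul, pow_mul, ← mul_pow]
  refine le_trans ?_ hprod
  have h' : P * (Polynomial.derivative^[k] (Polynomial.Chebyshev.T ℝ l)).eval 1 =
      ((∏ i ∈ Finset.range k, (l ^ 2 - (i : ℤ) ^ 2) : ℤ) : ℝ) := by
    rw [hP]; exact_mod_cast h
  rw [← h', abs_mul, abs_of_nonneg (zero_le_one.trans hP1)]
  have h0 := le_abs_self ((Polynomial.derivative^[k] (Polynomial.Chebyshev.T ℝ l)).eval 1)
  nlinarith [abs_nonneg ((Polynomial.derivative^[k] (Polynomial.Chebyshev.T ℝ l)).eval 1)]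

/-- From T_l' = l U_{l-1}, the bound for T_l with one more derivative suffices when l ≠ 0, and
U_{-1} = 0 covers l = 0. -/
theorem abs_iterate_derivative_chebyshevU_le (k : ℕ) (l : ℤ) {x : ℝ} (hx : x ∈ Icc (-1 : ℝ) 1) :
    |(Polynomial.derivative^[k] (Polynomial.Chebyshev.U ℝ (l - 1))).eval x| ≤
      bracket ((k + 1 : ℕ) : ℝ) ^ (2 * (k + 1)) * bracket (l : ℝ) ^ (2 * (k + 1)) := by
  rcases eq_or_ne l 0 with rfl | hl
  · have : Polynomial.derivative^[k] (Polynomial.Chebyshev.U ℝ (0 - 1)) = 0 := by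
      rw [zero_sub, Polynomial.Chebyshev.U_neg_one, Polynomial.iterate_derivative_zero]
    rw [this, Polynomial.eval_zero, abs_zero]
    exact mul_nonneg (pow_nonneg (bracket_nonneg _) _) (pow_nonneg (bracket_nonneg _) _)
  · refine le_trans ?_ (abs_iterate_derivative_chebyshevT_le (k + 1) l hx)
    rw [Function.iterate_succ_apply, Polynomial.Chebyshev.T_derivative_eq_U,
      ← Polynomial.C_eq_intCast, Polynomial.iterate_derivative_C_mul, Polynomial.eval_C_mul,
      abs_mul]
    refine le_mul_of_one_le_left (abs_nonneg _) ?_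
    rw [← Int.cast_abs]
    exact_mod_cast Int.one_le_abs hl

/-- Rapidly decreasing families of coefficients. -/
def IsRapid (c : ℤ → ℂ) : Prop := ∀ N : ℕ, ∃ C : ℝ, ∀ l : ℤ, bracket (l : ℝ) ^ N * ‖c l‖ ≤ C

theorem DecayBound.isRapid {α : ℝ} {M : ℤ → ℤ → ℂ} (hM : DecayBound α M) (n : ℤ) :
    IsRapid fun l => M (n + l) n := by
  intro N
  obtain ⟨C, -, hC⟩ := hM.diag_le N
  exact ⟨_, fun l => hC l n⟩

theorem IsRapid.contDiffOn_tsum {p : ℤ → Polynomial ℝ} {c : ℤ → ℂ} (hc : IsRapid c)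
    (hp : ∀ k : ℕ, ∃ (D : ℝ) (N : ℕ), ∀ (l : ℤ), ∀ x ∈ Icc (-1 : ℝ) 1,
      |(Polynomial.derivative^[k] (p l)).eval x| ≤ D * bracket (l : ℝ) ^ N) :
    ContDiffOn ℝ ∞ (fun x : ℝ => ∑' l, c l * ((p l).eval x : ℝ)) (Icc (-1) 1) := by
  refine contDiffOn_tsum_polynomial fun k => ?_
  obtain ⟨D, N, hD⟩ := hp k
  obtain ⟨C, hC⟩ := hc (2 + N)
  have hD0 : 0 ≤ D := by
    have := (abs_nonneg _).trans (hD 0 0 (by constructor <;> norm_num))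
    simpa [bracket_zero] using this
  refine ⟨C * D, fun l x hx => ?_⟩
  rw [norm_mul, Complex.norm_real, Real.norm_eq_abs]
  have hb := pow_nonneg (bracket_nonneg (l : ℝ)) 2
  calc _ ≤ bracket (l : ℝ) ^ 2 * (‖c l‖ * (D * bracket (l : ℝ) ^ N)) := by
        gcongr; exact hD l x hx
    _ = bracket (l : ℝ) ^ (2 + N) * ‖c l‖ * D := by rw [pow_add]; ring
    _ ≤ C * D := mul_le_mul_of_nonneg_right (hC l) hD0

theorem IsRapid.contDiffOn_chebyshevT {c : ℤ → ℂ} (hc : IsRapid c) : ContDiffOn ℝ ∞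
    (fun x : ℝ => ∑' l, c l * ((Polynomial.Chebyshev.T ℝ l).eval x : ℝ)) (Icc (-1) 1) :=
  hc.contDiffOn_tsum fun k => ⟨_, _, fun l _ hx => abs_iterate_derivative_chebyshevT_le k l hx⟩

theorem IsRapid.contDiffOn_chebyshevU {c : ℤ → ℂ} (hc : IsRapid c) : ContDiffOn ℝ ∞
    (fun x : ℝ => ∑' l, c l * ((Polynomial.Chebyshev.U ℝ (l - 1)).eval x : ℝ)) (Icc (-1) 1) :=
  hc.contDiffOn_tsum fun k => ⟨_, _, fun l _ hx => abs_iterate_derivative_chebyshevU_le k l hx⟩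

/-! ### Chebyshev coefficients as Fourier coefficients -/

/-- Substitute x = cos θ and use U_m(cos θ) sin θ = sin((m + 1)θ). The function f(cos θ) sin θ is
odd, so its sine integral over [0, π] is a Fourier coefficient up to the factor 2i. -/
theorem chebCoefU_eq_fourierCoef {f : ℝ → ℂ} (hf : ContinuousOn f (Icc (-1) 1)) (m : ℕ) :
    chebCoefU f m =
      fourierCoef (fun θ => 2 * Complex.I * (f (Real.cos θ) * (Real.sin θ : ℂ))) (m + 1) := by
  set g : ℝ → ℂ := fun θ => f (Real.cos θ) * (Real.sin θ : ℂ) with hg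
  have hgc : Continuous g := by
    refine Continuous.mul ?_ (Complex.continuous_ofReal.comp Real.continuous_sin)
    exact hf.comp_continuous Real.continuous_cos fun θ => ⟨Real.neg_one_le_cos θ, Real.cos_le_one θ⟩
  have hgodd : ∀ θ, g (-θ) = -g θ := fun θ => by simp [hg]
  have h1 : ∫ x in (-1 : ℝ)..1, f x * (((Polynomial.Chebyshev.U ℝ (m : ℤ)).eval x : ℝ) : ℂ) *
      (Real.sqrt (1 - x ^ 2) : ℂ) =
      ∫ θ in (0 : ℝ)..Real.pi, g θ * (Real.sin (((m : ℝ) + 1) * θ) : ℂ) := by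
    have h := intervalIntegral.integral_deriv_smul_comp'' (a := 0) (b := Real.pi) (f := Real.cos)
      (f' := fun θ => -Real.sin θ)
      (g := fun x => f x * (((Polynomial.Chebyshev.U ℝ (m : ℤ)).eval x : ℝ) : ℂ) *
        (Real.sqrt (1 - x ^ 2) : ℂ)) Real.continuous_cos.continuousOn
      (fun θ _ => (Real.hasDerivAt_cos θ).hasDerivWithinAt)
      Real.continuous_sin.neg.continuousOn (by
        have hsub : Real.cos '' uIcc 0 Real.pi ⊆ Icc (-1) 1 := by
          rintro _ ⟨θ, -, rfl⟩
          exact ⟨Real.neg_one_le_cos θ, Real.cos_le_one θ⟩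
        refine ContinuousOn.mul (ContinuousOn.mul (hf.mono hsub) ?_) ?_
        · exact (Complex.continuous_ofReal.comp (Polynomial.continuous _)).continuousOn
        · exact (Complex.continuous_ofReal.comp
            (Real.continuous_sqrt.comp (by fun_prop))).continuousOn)
    rw [Real.cos_zero, Real.cos_pi, intervalIntegral.integral_symm (-1) 1] at h
    rw [← neg_eq_iff_eq_neg.mpr h, ← intervalIntegral.integral_neg]
    refine intervalIntegral.integral_congr fun θ hθ => ?_
    rw [uIcc_of_le Real.pi_pos.le] at hθ
    have hs : Real.sqrt (1 - Real.cos θ ^ 2) = Real.sin θ := by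
      rw [← Real.sin_sq, Real.sqrt_sq (Real.sin_nonneg_of_mem_Icc hθ)]
    have hU := Polynomial.Chebyshev.U_real_cos θ (m : ℤ)
    push_cast at hU
    simp only [Function.comp_apply, hs, Complex.real_smul, hg]
    rw [← hU]
    push_cast
    ring
  have h2 : ∫ θ in (-Real.pi)..Real.pi,
      2 * Complex.I * g θ * Complex.exp (-(((m + 1 : ℤ) : ℂ) * θ * Complex.I)) =
      ∫ θ in (0 : ℝ)..Real.pi, 4 * (g θ * (Real.sin (((m : ℝ) + 1) * θ) : ℂ)) := by
    have hE : Continuous fun θ : ℝ =>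
        2 * Complex.I * g θ * Complex.exp (-(((m + 1 : ℤ) : ℂ) * θ * Complex.I)) :=
      (continuous_const.mul hgc).mul (by fun_prop)
    rw [← intervalIntegral.integral_add_adjacent_intervals (b := 0)
      (hE.intervalIntegrable _ _) (hE.intervalIntegrable _ _)]
    have h3 := intervalIntegral.integral_comp_neg (a := 0) (b := Real.pi) fun θ : ℝ =>
        2 * Complex.I * g θ * Complex.exp (-(((m + 1 : ℤ) : ℂ) * θ * Complex.I))
    rw [neg_zero] at h3
    have hE' : Continuous fun θ : ℝ => 2 * Complex.I * g (-θ) *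
        Complex.exp (-(((m + 1 : ℤ) : ℂ) * (-θ : ℝ) * Complex.I)) := hE.comp continuous_neg
    rw [← h3, ← intervalIntegral.integral_add
      (hE'.intervalIntegrable _ _) (hE.intervalIntegrable _ _)]
    refine intervalIntegral.integral_congr fun θ _ => ?_
    simp only [hgodd]
    rw [Complex.ofReal_sin, Complex.sin]
    push_cast
    rw [show -(((m : ℂ) + 1) * -(θ : ℂ) * Complex.I) = ((m : ℂ) + 1) * θ * Complex.I by ring,
      show -(((m : ℂ) + 1) * (θ : ℂ)) * Complex.I = -(((m : ℂ) + 1) * θ * Complex.I) by ring]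
    ring
  rw [chebCoefU, fourierCoef, h1]
  change _ = _ * ∫ θ in (-Real.pi)..Real.pi, 2 * Complex.I * g θ * _
  have h2' := h2
  push_cast at h2'
  push_cast
  rw [h2', intervalIntegral.integral_const_mul]
  have : (Real.pi : ℂ) ≠ 0 := Complex.ofReal_ne_zero.mpr Real.pi_ne_zero
  field_simp
  ring

theorem sigmaTilde_neg_neg (a₁ a₂ : ℝ → ℕ → ℂ) (θ : ℝ) (n : ℤ) :
    sigmaTilde a₁ a₂ (-θ) (-n) = sigmaTilde a₁ a₂ θ n := by
  simp [sigmaTilde]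

theorem isReflectionInvariant_symbolMatrix_sigmaTilde (a₁ a₂ : ℝ → ℕ → ℂ) :
    IsReflectionInvariant (symbolMatrix (sigmaTilde a₁ a₂)) :=
  IsReflectionInvariant.symbolMatrix (sigmaTilde_neg_neg a₁ a₂)

/-- The underlying identity is 2i sin θ (a₁ U_k + a₂ T_{k+1})(cos θ) = σ̃(θ, k+1) e_{k+1} - σ̃(θ,
-(k+1)) e_{-(k+1)}. -/
theorem chebCoefU_symbolPair {a₁ a₂ : ℝ → ℕ → ℂ} {k : ℕ}
    (h₁ : ContinuousOn (fun x => a₁ x (k + 1)) (Icc (-1) 1))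
    (h₂ : ContinuousOn (fun x => a₂ x (k + 1)) (Icc (-1) 1)) (m : ℕ) :
    chebCoefU (fun x =>
      a₁ x (k + 1) * (((Polynomial.Chebyshev.U ℝ (k : ℤ)).eval x : ℝ) : ℂ) +
      a₂ x (k + 1) * (((Polynomial.Chebyshev.T ℝ ((k : ℤ) + 1)).eval x : ℝ) : ℂ)) m =
    symbolMatrix (sigmaTilde a₁ a₂) (m + 1) (k + 1) -
      symbolMatrix (sigmaTilde a₁ a₂) (m + 1) (-(k + 1)) := by
  have hcos : ∀ {f : ℝ → ℂ}, ContinuousOn f (Icc (-1) 1) → Continuous fun θ => f (Real.cos θ) :=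
    fun hf => hf.comp_continuous Real.continuous_cos
      fun θ => ⟨Real.neg_one_le_cos θ, Real.cos_le_one θ⟩
  have hσ : ∀ θ : ℝ, sigmaTilde a₁ a₂ θ (k + 1) =
      a₁ (Real.cos θ) (k + 1) + Complex.I * (Real.sin θ : ℂ) * a₂ (Real.cos θ) (k + 1) := by
    intro θ
    have h0 : ((k : ℤ) + 1) ≠ 0 := by omega
    have hs : ((k : ℤ) + 1).sign = 1 := Int.sign_eq_one_of_pos (by omega)
    have ha : ((k : ℤ) + 1).natAbs = k + 1 := by omega
    rw [sigmaTilde, if_neg h0, hs, ha]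
    push_cast; ring
  have hσ' : ∀ θ : ℝ, sigmaTilde a₁ a₂ θ (-(k + 1)) =
      a₁ (Real.cos θ) (k + 1) - Complex.I * (Real.sin θ : ℂ) * a₂ (Real.cos θ) (k + 1) := by
    intro θ
    have h := sigmaTilde_neg_neg a₁ a₂ (-θ) (k + 1)
    rw [neg_neg, hσ, Real.cos_neg, Real.sin_neg] at h
    rw [h]
    push_cast; ring
  rw [chebCoefU_eq_fourierCoef]
  swap
  · refine ContinuousOn.add (h₁.mul ?_) (h₂.mul ?_) <;>
      exact (Complex.continuous_ofReal.comp (Polynomial.continuous _)).continuousOn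
  have hsc : Continuous fun θ : ℝ => (Real.sin θ : ℂ) :=
    Complex.continuous_ofReal.comp Real.continuous_sin
  have hI : ∀ n : ℤ, (Continuous fun θ => sigmaTilde a₁ a₂ θ n) →
      IntervalIntegrable (fun θ : ℝ => sigmaTilde a₁ a₂ θ n * Complex.exp (n * θ * Complex.I) *
        Complex.exp (-(((m + 1 : ℤ) : ℂ) * θ * Complex.I))) volume (-Real.pi) Real.pi := by
    intro n hn
    have hE : Continuous fun θ : ℝ => Complex.exp (n * θ * Complex.I) := by fun_prop
    have hE' : Continuous fun θ : ℝ => Complex.exp (-(((m + 1 : ℤ) : ℂ) * θ * Complex.I)) := by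
      fun_prop
    exact ((hn.mul hE).mul hE').intervalIntegrable _ _
  have c₁ : Continuous fun θ => sigmaTilde a₁ a₂ θ (k + 1) := by
    simp only [hσ]
    exact (hcos h₁).add ((continuous_const.mul hsc).mul (hcos h₂))
  have c₂ : Continuous fun θ => sigmaTilde a₁ a₂ θ (-(k + 1)) := by
    simp only [hσ']
    exact (hcos h₁).sub ((continuous_const.mul hsc).mul (hcos h₂))
  unfold symbolMatrix fourierCoef
  rw [← mul_sub, ← intervalIntegral.integral_sub (hI _ c₁) (hI _ c₂)]
  congr 1
  refine intervalIntegral.integral_congr fun θ _ => ?_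
  simp only [hσ, hσ']
  have hU := Polynomial.Chebyshev.U_real_cos θ (k : ℤ)
  have hT := Polynomial.Chebyshev.T_real_cos θ ((k : ℤ) + 1)
  have e1 : Complex.exp ((((k : ℤ) + 1 : ℤ) : ℂ) * θ * Complex.I) =
      (Real.cos (((k : ℝ) + 1) * θ) : ℂ) + (Real.sin (((k : ℝ) + 1) * θ) : ℂ) * Complex.I := by
    push_cast
    rw [Complex.exp_mul_I]
  have e2 : Complex.exp ((((-((k : ℤ) + 1)) : ℤ) : ℂ) * θ * Complex.I) =
      (Real.cos (((k : ℝ) + 1) * θ) : ℂ) - (Real.sin (((k : ℝ) + 1) * θ) : ℂ) * Complex.I := by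
    push_cast
    rw [Complex.exp_mul_I, show -((k : ℂ) + 1) * θ = -(((k : ℂ) + 1) * θ) by ring,
      Complex.cos_neg, Complex.sin_neg]
    ring
  rw [e1, e2]
  push_cast at hU hT
  rw [hT, ← hU]
  push_cast
  ring

/-! ### The sine transform between the scales `U^s` and `H^s_per` -/

theorem rpow_le_three_rpow_mul {a b : ℝ} (ha : 0 < a) (hab : a ≤ b) (hba : b ≤ 3 * a) (s : ℝ) :
    a ^ s ≤ 3 ^ |s| * b ^ s ∧ b ^ s ≤ 3 ^ |s| * a ^ s := by
  have hb : 0 < b := ha.trans_le hab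
  have h3 : (1 : ℝ) ≤ 3 ^ |s| := Real.one_le_rpow (by norm_num) (abs_nonneg s)
  rcases le_total 0 s with hs | hs
  · have h1 : a ^ s ≤ b ^ s := Real.rpow_le_rpow ha.le hab hs
    refine ⟨h1.trans (le_mul_of_one_le_left (Real.rpow_nonneg hb.le s) h3), ?_⟩
    rw [abs_of_nonneg hs, ← Real.mul_rpow (by norm_num) ha.le]
    exact Real.rpow_le_rpow hb.le hba hs
  · have h1 : b ^ s ≤ a ^ s := Real.rpow_le_rpow_of_nonpos ha hab hs
    refine ⟨?_, h1.trans (le_mul_of_one_le_left (Real.rpow_nonneg ha.le s) h3)⟩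
    have h2 : (3 * a) ^ s ≤ b ^ s := Real.rpow_le_rpow_of_nonpos hb hba hs
    rw [Real.mul_rpow (by norm_num) ha.le] at h2
    rw [abs_of_nonpos hs, Real.rpow_neg (by norm_num), le_inv_mul_iff₀ (by positivity)]
    exact h2

/-- U_k corresponds to the frequency k + 1, so the two scales are offset by one index; 1 + (k + 1)²
≤ 3(1 + k²) makes this harmless. -/
theorem weight_shift_le (k : ℕ) (s : ℝ) :
    (1 + (k : ℝ) ^ 2) ^ s ≤ 3 ^ |s| * (1 + ((k : ℝ) + 1) ^ 2) ^ s ∧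
      (1 + ((k : ℝ) + 1) ^ 2) ^ s ≤ 3 ^ |s| * (1 + (k : ℝ) ^ 2) ^ s := by
  have hk : (0 : ℝ) ≤ k := Nat.cast_nonneg k
  exact rpow_le_three_rpow_mul (by positivity) (by nlinarith) (by nlinarith [sq_nonneg ((k : ℝ) - 1)])
    s

theorem sineCoef_succ (u : ℕ → ℂ) (k : ℕ) : sineCoef u ((k : ℤ) + 1) = u k / (2 * Complex.I) := rfl

theorem sineCoef_neg_succ (u : ℕ → ℂ) (k : ℕ) :
    sineCoef u (-((k : ℤ) + 1)) = -(u k) / (2 * Complex.I) := by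
  rw [← Int.negSucc_eq]; rfl

theorem sineCoef_zero (u : ℕ → ℂ) : sineCoef u 0 = 0 := rfl

theorem sineCoef_neg (u : ℕ → ℂ) (m : ℤ) : sineCoef u (-m) = -sineCoef u m := by
  match m with
  | Int.ofNat 0 => simp [sineCoef]
  | Int.ofNat (k + 1) => exact (sineCoef_neg_succ u k).trans (neg_div _ _)
  | Int.negSucc k =>
    rw [Int.neg_negSucc, Int.negSucc_eq, sineCoef_neg_succ, neg_div, neg_neg]
    exact sineCoef_succ u k

theorem sineCoef_bound (s : ℝ) {u : ℕ → ℂ} (hu : u ∈ seqSobolev (fun n : ℕ => (n : ℝ)) s) :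
    sineCoef u ∈ seqSobolev (fun m : ℤ => (m : ℝ)) s ∧
      ∑' m : ℤ, (1 + (m : ℝ) ^ 2) ^ s * ‖sineCoef u m‖ ^ 2 ≤
        3 ^ |s| * ∑' n : ℕ, (1 + (n : ℝ) ^ 2) ^ s * ‖u n‖ ^ 2 := by
  have hu' : Summable fun n : ℕ => (1 + (n : ℝ) ^ 2) ^ s * ‖u n‖ ^ 2 := hu
  have hI : ∀ z : ℂ, ‖z / (2 * Complex.I)‖ ^ 2 = ‖z‖ ^ 2 / 4 := by
    intro z
    rw [norm_div, norm_mul, Complex.norm_I, div_pow]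
    norm_num
  set a : ℕ → ℝ := fun k => (1 + ((k : ℝ) + 1) ^ 2) ^ s * (‖u k‖ ^ 2 / 4) with ha
  have hle : ∀ k, a k ≤ 3 ^ |s| / 4 * ((1 + (k : ℝ) ^ 2) ^ s * ‖u k‖ ^ 2) := by
    intro k
    have h := mul_le_mul_of_nonneg_right (weight_shift_le k s).2
      (by positivity : 0 ≤ ‖u k‖ ^ 2 / 4)
    refine h.trans (le_of_eq (by ring))
  have hsum : Summable a := Summable.of_nonneg_of_le (fun k => by positivity) hle
    (hu'.mul_left _)
  have hS : ∑' k, a k ≤ 3 ^ |s| / 4 * ∑' n : ℕ, (1 + (n : ℝ) ^ 2) ^ s * ‖u n‖ ^ 2 := by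
    rw [← tsum_mul_left]
    exact hsum.tsum_le_tsum hle (hu'.mul_left _)
  have h1 : HasSum (fun n : ℕ => (1 + ((n : ℤ) : ℝ) ^ 2) ^ s * ‖sineCoef u n‖ ^ 2)
      (∑' k, a k) := by
    refine (hasSum_nat_add_iff' 1).mp ?_
    rw [Finset.sum_range_one, Nat.cast_zero, sineCoef_zero, norm_zero, zero_pow two_ne_zero,
      mul_zero, sub_zero]
    refine (congrArg (fun f : ℕ → ℝ => HasSum f _) (funext fun k => ?_)).mpr hsum.hasSum
    rw [Nat.cast_succ, sineCoef_succ, hI]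
    push_cast; rfl
  have h2 : HasSum (fun n : ℕ => (1 + ((-((n : ℤ) + 1) : ℤ) : ℝ) ^ 2) ^ s *
      ‖sineCoef u (-((n : ℤ) + 1))‖ ^ 2) (∑' k, a k) := by
    refine (congrArg (fun f : ℕ → ℝ => HasSum f _) (funext fun k => ?_)).mpr hsum.hasSum
    rw [sineCoef_neg_succ, hI, norm_neg, Int.cast_neg, neg_sq]
    push_cast; rfl
  have h := HasSum.of_nat_of_neg_add_one
    (f := fun m : ℤ => (1 + (m : ℝ) ^ 2) ^ s * ‖sineCoef u m‖ ^ 2) h1 h2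
  refine ⟨h.summable, ?_⟩
  rw [h.tsum_eq]
  have h0 : 0 ≤ 3 ^ |s| * ∑' n : ℕ, (1 + (n : ℝ) ^ 2) ^ s * ‖u n‖ ^ 2 :=
    mul_nonneg (by positivity) (tsum_nonneg fun n => by positivity)
  linarith

theorem sineInverse_bound (s : ℝ) {v : ℤ → ℂ} (hv : v ∈ seqSobolev (fun m : ℤ => (m : ℝ)) s) :
    (fun k : ℕ => 2 * Complex.I * v (k + 1)) ∈ seqSobolev (fun n : ℕ => (n : ℝ)) s ∧
      ∑' n : ℕ, (1 + (n : ℝ) ^ 2) ^ s * ‖2 * Complex.I * v (n + 1)‖ ^ 2 ≤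
        4 * 3 ^ |s| * ∑' m : ℤ, (1 + (m : ℝ) ^ 2) ^ s * ‖v m‖ ^ 2 := by
  have hv' : Summable fun m : ℤ => (1 + (m : ℝ) ^ 2) ^ s * ‖v m‖ ^ 2 := hv
  have hinj : Function.Injective fun k : ℕ => (k : ℤ) + 1 := fun a b h => by
    simpa using h
  have hle : ∀ k : ℕ, (1 + (k : ℝ) ^ 2) ^ s * ‖2 * Complex.I * v (k + 1)‖ ^ 2 ≤
      4 * 3 ^ |s| * ((1 + (((k : ℤ) + 1 : ℤ) : ℝ) ^ 2) ^ s * ‖v ((k : ℤ) + 1)‖ ^ 2) := by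
    intro k
    have h := mul_le_mul_of_nonneg_right (weight_shift_le k s).1
      (by positivity : 0 ≤ 4 * ‖v ((k : ℤ) + 1)‖ ^ 2)
    rw [norm_mul, norm_mul, Complex.norm_I, Complex.norm_ofNat]
    push_cast
    calc _ = (1 + (k : ℝ) ^ 2) ^ s * (4 * ‖v ((k : ℤ) + 1)‖ ^ 2) := by ring
      _ ≤ _ := h
      _ = _ := by ring
  have hs2 := (hv'.comp_injective hinj).mul_left (4 * 3 ^ |s|)
  have hs1 := Summable.of_nonneg_of_le (fun k : ℕ => by positivity) hle hs2
  refine ⟨hs1, (hs1.tsum_le_tsum hle hs2).trans ?_⟩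
  rw [tsum_mul_left]
  refine mul_le_mul_of_nonneg_left ?_ (by positivity)
  exact tsum_comp_le_tsum_of_inj hv' (fun m => by positivity) hinj

/-- The left inverse `(v_m)_{m ∈ ℤ} ↦ (2i v_{k+1})_{k ∈ ℕ}` of the sine transform. -/
noncomputable def sineInverse : HPerNegInf →ₗ[ℂ] UNegInf where
  toFun v := ⟨fun k : ℕ => 2 * Complex.I * v.1 (k + 1),
    v.2.imp fun s hs => (sineInverse_bound s hs).1⟩
  map_add' _ _ := Subtype.ext (funext fun _ => mul_add _ _ _)
  map_smul' _ _ := Subtype.ext (funext fun _ => mul_left_comm _ _ _)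

theorem sineInverse_sineTransform (u : UNegInf) : sineInverse (sineTransform u) = u := by
  refine Subtype.ext (funext fun k => ?_)
  have h : ∀ z : ℂ, 2 * Complex.I * (z / (2 * Complex.I)) = z := fun z => by
    have := Complex.I_ne_zero
    field_simp
  exact (congrArg (2 * Complex.I * ·) (sineCoef_succ u.1 k)).trans (h _)

/-- The image of the sine transform consists exactly of the odd sequences, for which the
coefficients of positive index carry all the information. -/
theorem sineTransform_sineInverse {v : HPerNegInf} (hv : ∀ m, v.1 (-m) = -v.1 m) :
    sineTransform (sineInverse v) = v := by
  have h2 : (2 * Complex.I : ℂ) ≠ 0 := mul_ne_zero two_ne_zero Complex.I_ne_zero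
  have hpos : ∀ k : ℕ, (sineTransform (sineInverse v)).1 ((k : ℤ) + 1) = v.1 (k + 1) := fun k =>
    mul_div_cancel_left₀ _ h2
  have hodd : ∀ m, (sineTransform (sineInverse v)).1 (-m) = -(sineTransform (sineInverse v)).1 m :=
    fun m => sineCoef_neg _ m
  refine Subtype.ext (funext fun m => ?_)
  match m with
  | Int.ofNat 0 =>
    have h := hv 0
    rw [neg_zero] at h
    exact (self_eq_neg.mp h).symm
  | Int.ofNat (k + 1) => exact hpos k
  | Int.negSucc k => rw [Int.negSucc_eq, hodd, hv, hpos]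

theorem sineTransform_basisU (k : ℕ) : sineTransform (basisU k) =
    (2 * Complex.I)⁻¹ • (expPer (k + 1) - expPer (-(k + 1))) := by
  refine Subtype.ext (funext fun m => ?_)
  change sineCoef (Pi.single k 1) m = (2 * Complex.I)⁻¹ *
    ((Pi.single ((k : ℤ) + 1) 1 : ℤ → ℂ) m - (Pi.single (-((k : ℤ) + 1)) 1 : ℤ → ℂ) m)
  match m with
  | Int.ofNat 0 =>
    rw [Pi.single_eq_of_ne (by simp; omega), Pi.single_eq_of_ne (by simp; omega), sub_zero,
      mul_zero]
    rfl
  | Int.ofNat (j + 1) =>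
    rw [Pi.single_eq_of_ne (i := -((k : ℤ) + 1)) (by simp; omega), sub_zero]
    change (Pi.single k 1 : ℕ → ℂ) j / _ = _
    simp only [Pi.single_apply, div_eq_inv_mul]
    congr 2
    simp
  | Int.negSucc j =>
    rw [Pi.single_eq_of_ne (i := (k : ℤ) + 1) (by simp; omega), zero_sub]
    change -(Pi.single k 1 : ℕ → ℂ) j / _ = _
    simp only [Pi.single_apply, div_eq_inv_mul]
    congr 3
    simp [Int.negSucc_eq]

/-! ### Continuity on the scale `U^s` -/

/-- Partial sums of the Chebyshev expansion. -/
noncomputable def truncU (u : UNegInf) : ℕ → UNegInf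
  | 0 => 0
  | N + 1 => truncU u N + u.1 N • basisU N

theorem truncU_apply (u : UNegInf) (N j : ℕ) :
    (truncU u N).1 j = if j < N then u.1 j else 0 := by
  induction N with
  | zero => rfl
  | succ N ih =>
    have key : ∀ w : ℕ → ℂ, (if j < N then w j else 0) + w N * (Pi.single N 1 : ℕ → ℂ) j =
        if j < N + 1 then w j else 0 := by
      intro w
      rw [Pi.single_apply]
      rcases lt_trichotomy j N with h | h | h
      · simp [h, h.ne, Nat.lt_succ_of_lt h]
      · simp [h]
      · simp [h.ne', not_lt.mpr h.le, not_lt.mpr (Nat.succ_le_of_lt h)]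
    exact (congrArg (· + u.1 N * (Pi.single N 1 : ℕ → ℂ) j) ih).trans (key u.1)

theorem hasSum_tail {a : ℕ → ℝ} (ha : Summable a) (N : ℕ) :
    HasSum (fun n => if n < N then 0 else a n) (∑' n, a n - ∑ n ∈ Finset.range N, a n) := by
  have h1 : HasSum (fun n => if n < N then a n else 0)
      (∑ n ∈ Finset.range N, if n < N then a n else 0) :=
    hasSum_sum_of_ne_finset_zero fun n hn => if_neg (by simpa using hn)
  rw [Finset.sum_congr rfl fun n hn => if_pos (Finset.mem_range.mp hn)] at h1
  refine (congrArg (fun f : ℕ → ℝ => HasSum f _) (funext fun n => ?_)).mpr (ha.hasSum.sub h1)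
  split_ifs <;> simp

theorem tendsto_normU_sub_truncU {s : ℝ} {u : UNegInf} (hu : u.1 ∈ USpace s) :
    (∀ N, (u - truncU u N).1 ∈ USpace s) ∧
      Tendsto (fun N => normU s (u - truncU u N).1) atTop (𝓝 0) := by
  have hu' : Summable fun n : ℕ => (1 + (n : ℝ) ^ 2) ^ s * ‖u.1 n‖ ^ 2 := hu
  have hval : ∀ N j, (u - truncU u N).1 j = if j < N then 0 else u.1 j := by
    intro N j
    refine (congrArg (u.1 j - ·) (truncU_apply u N j)).trans ?_
    have key : ∀ z : ℂ, (z - if j < N then z else 0) = if j < N then 0 else z := fun z => by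
      split_ifs <;> simp
    exact key _
  have hsum : ∀ N, HasSum (fun n : ℕ => (1 + (n : ℝ) ^ 2) ^ s * ‖(u - truncU u N).1 n‖ ^ 2)
      (∑' n : ℕ, (1 + (n : ℝ) ^ 2) ^ s * ‖u.1 n‖ ^ 2 -
        ∑ n ∈ Finset.range N, (1 + (n : ℝ) ^ 2) ^ s * ‖u.1 n‖ ^ 2) := by
    refine fun N => (congrArg (fun f : ℕ → ℝ => HasSum f _) (funext fun n => ?_)).mpr
      (hasSum_tail hu' N)
    rw [hval]
    split_ifs <;> simp
  refine ⟨fun N => (hsum N).summable, ?_⟩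
  have hlim := (hu'.hasSum.tendsto_sum_nat.const_sub
    (∑' n : ℕ, (1 + (n : ℝ) ^ 2) ^ s * ‖u.1 n‖ ^ 2)).const_mul (1 / 2 : ℝ)
  rw [sub_self, mul_zero] at hlim
  have h := (Real.continuous_sqrt.tendsto 0).comp hlim
  rw [Real.sqrt_zero] at h
  refine h.congr fun N => ?_
  rw [Function.comp_apply, normU, (hsum N).tsum_eq]

theorem norm_coef_le_normU (t : ℝ) (m : ℕ) : ∃ K : ℝ, 0 ≤ K ∧ ∀ v : FormalSeries chebU,
    v ∈ USpace t → ‖v m‖ ≤ K * normU t v := by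
  have hw : 0 < (1 + (m : ℝ) ^ 2) ^ t := by positivity
  refine ⟨Real.sqrt (2 / (1 + (m : ℝ) ^ 2) ^ t), Real.sqrt_nonneg _, fun v hv => ?_⟩
  have hv' : Summable fun n : ℕ => (1 + (n : ℝ) ^ 2) ^ t * ‖v n‖ ^ 2 := hv
  rw [normU, ← Real.sqrt_mul (by positivity)]
  refine Real.le_sqrt_of_sq_le ?_
  have h := hv'.le_tsum m fun n _ => by positivity
  rw [div_mul_eq_mul_div, le_div_iff₀ hw]
  linarith

theorem IsContinuousOpU.tendsto_truncU {A : UNegInf →ₗ[ℂ] UNegInf} (hA : IsContinuousOpU A)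
    (u : UNegInf) (m : ℕ) :
    Tendsto (fun N => (A (truncU u N)).1 m) atTop (𝓝 ((A u).1 m)) := by
  obtain ⟨s, hs⟩ := u.2
  obtain ⟨t, C, h⟩ := hA s
  obtain ⟨K, hK0, hK⟩ := norm_coef_le_normU t m
  obtain ⟨hmem, hlim⟩ := tendsto_normU_sub_truncU (u := u) (s := s) hs
  rw [tendsto_iff_norm_sub_tendsto_zero]
  have hlim' := (hlim.const_mul C).const_mul K
  rw [mul_zero, mul_zero] at hlim'
  refine squeeze_zero (fun _ => norm_nonneg _) (fun N => ?_) hlim'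
  obtain ⟨h1, h2⟩ := h _ (hmem N)
  have h3 : (A (u - truncU u N)).1 m = (A u).1 m - (A (truncU u N)).1 m := by
    rw [map_sub]; rfl
  rw [norm_sub_rev, ← h3]
  exact (hK _ h1).trans (mul_le_mul_of_nonneg_left h2 hK0)

/-- Finite sums of the U_k are dense in each U^s, and norm convergence in U^t implies convergence of
every coefficient. -/
theorem IsContinuousOpU.ext {A B : UNegInf →ₗ[ℂ] UNegInf} (hA : IsContinuousOpU A)
    (hB : IsContinuousOpU B) (h : ∀ k m : ℕ, (A (basisU k)).1 m = (B (basisU k)).1 m) : A = B := by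
  have hb : ∀ k, A (basisU k) = B (basisU k) := fun k => Subtype.ext (funext (h k))
  refine LinearMap.ext fun u => Subtype.ext (funext fun m => ?_)
  have htr : ∀ N, A (truncU u N) = B (truncU u N) := by
    intro N
    induction N with
    | zero => rw [truncU, map_zero, map_zero]
    | succ N ih => rw [truncU, map_add, map_add, map_smul, map_smul, ih, hb]
  refine tendsto_nhds_unique (hA.tendsto_truncU u m) ?_
  simp only [htr]
  exact hB.tendsto_truncU u m

/-! ### Operators on the segment given by matrices -/

/-- The operator on `U^{-∞}` that corresponds to the periodic operator with matrix `M`. -/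
noncomputable def opSegment (M : ℤ → ℤ → ℂ) (hM : ∃ α, DecayBound α M) :
    UNegInf →ₗ[ℂ] UNegInf :=
  sineInverse ∘ₗ opPer M hM ∘ₗ sineTransform

theorem opSegment_bound {α : ℝ} {M : ℤ → ℤ → ℂ} (hM : DecayBound α M) (s : ℝ) :
    ∃ C : ℝ, ∀ u : UNegInf, u.1 ∈ USpace s →
      (opSegment M ⟨α, hM⟩ u).1 ∈ USpace (s - α) ∧
        normU (s - α) (opSegment M ⟨α, hM⟩ u).1 ≤ C * normU s u.1 := by
  obtain ⟨C, hC0, hC⟩ := hM.matVec_bound s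
  refine ⟨Real.sqrt (4 * 3 ^ |s - α| * (C * 3 ^ |s|)), fun u hu => ?_⟩
  obtain ⟨h1, h1'⟩ := sineCoef_bound s hu
  obtain ⟨h2, h2'⟩ := hC _ h1
  obtain ⟨h3, h3'⟩ := sineInverse_bound (s - α) h2
  refine ⟨h3, ?_⟩
  rw [normU, normU, ← Real.sqrt_mul (by positivity)]
  refine Real.sqrt_le_sqrt ?_
  have h4 : ∑' n : ℕ, (1 + (n : ℝ) ^ 2) ^ (s - α) *
      ‖2 * Complex.I * matVec M (sineCoef u.1) (n + 1)‖ ^ 2 ≤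
      4 * 3 ^ |s - α| * (C * (3 ^ |s| * ∑' n : ℕ, (1 + (n : ℝ) ^ 2) ^ s * ‖u.1 n‖ ^ 2)) :=
    h3'.trans (mul_le_mul_of_nonneg_left (h2'.trans (mul_le_mul_of_nonneg_left h1' hC0))
      (by positivity))
  calc _ ≤ 1 / 2 * (4 * 3 ^ |s - α| *
        (C * (3 ^ |s| * ∑' n : ℕ, (1 + (n : ℝ) ^ 2) ^ s * ‖u.1 n‖ ^ 2))) :=
        mul_le_mul_of_nonneg_left h4 (by norm_num)
    _ = _ := by ring

theorem isContinuousOpU_opSegment (M : ℤ → ℤ → ℂ) (hM : ∃ α, DecayBound α M) :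
    IsContinuousOpU (opSegment M hM) := by
  intro s
  obtain ⟨α, h⟩ := hM
  obtain ⟨C, hC⟩ := opSegment_bound h s
  exact ⟨s - α, C, hC⟩

theorem opPer_sineTransform_basisU (M : ℤ → ℤ → ℂ) (hM : ∃ α, DecayBound α M) (k : ℕ) (m : ℤ) :
    (opPer M hM (sineTransform (basisU k))).1 m =
      (2 * Complex.I)⁻¹ * (M m (k + 1) - M m (-(k + 1))) := by
  rw [sineTransform_basisU, map_smul, map_sub]
  change (2 * Complex.I)⁻¹ * ((opPer M hM (expPer (k + 1))).1 m -
    (opPer M hM (expPer (-(k + 1)))).1 m) = _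
  rw [opPer_expPer, opPer_expPer]

theorem opSegment_basisU (M : ℤ → ℤ → ℂ) (hM : ∃ α, DecayBound α M) (k m : ℕ) :
    (opSegment M hM (basisU k)).1 m = M (m + 1) (k + 1) - M (m + 1) (-(k + 1)) := by
  change 2 * Complex.I * (opPer M hM (sineTransform (basisU k))).1 (m + 1) = _
  rw [opPer_sineTransform_basisU, mul_inv_cancel_left₀
    (mul_ne_zero two_ne_zero Complex.I_ne_zero)]

/-- A reflection invariant matrix maps odd sequences to odd sequences, so nothing is lost when
`sineInverse` keeps only the positive frequencies. -/
theorem sineTransform_opSegment {M : ℤ → ℤ → ℂ} (hM : ∃ α, DecayBound α M)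
    (hs : IsReflectionInvariant M) (u : UNegInf) :
    sineTransform (opSegment M hM u) = opPer M hM (sineTransform u) := by
  refine sineTransform_sineInverse fun m => ?_
  change matVec M (sineTransform u).1 (-m) = -matVec M (sineTransform u).1 m
  rw [matVec, matVec, ← tsum_neg, ← (Equiv.neg ℤ).tsum_eq]
  refine tsum_congr fun n => ?_
  rw [Equiv.neg_apply, hs]
  change M m n * sineCoef u.1 (-n) = -(M m n * sineCoef u.1 n)
  exact (congrArg (M m n * ·) (sineCoef_neg u.1 n)).trans (mul_neg _ _)

/-- Only the inner matrix must be reflection invariant: its output has to be odd before it is passed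
to the outer one. -/
theorem opSegment_comp {A B : ℤ → ℤ → ℂ} (hA : ∃ α, DecayBound α A) (hB : ∃ β, DecayBound β B)
    (hs : IsReflectionInvariant B) (hAB : ∃ γ, DecayBound γ (matMul A B)) :
    opSegment A hA ∘ₗ opSegment B hB = opSegment (matMul A B) hAB := by
  refine LinearMap.ext fun u => ?_
  change sineInverse (opPer A hA (sineTransform (opSegment B hB u))) =
    sineInverse (opPer (matMul A B) hAB (sineTransform u))
  rw [sineTransform_opSegment hB hs, ← opPer_comp hA hB hAB]
  rfl

theorem opSegment_sub {A B : ℤ → ℤ → ℂ} (hA : ∃ α, DecayBound α A) (hB : ∃ β, DecayBound β B)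
    (hAB : ∃ γ, DecayBound γ (A - B)) :
    opSegment A hA - opSegment B hB = opSegment (A - B) hAB := by
  refine LinearMap.ext fun u => ?_
  change sineInverse (opPer A hA (sineTransform u)) - sineInverse (opPer B hB (sineTransform u)) =
    sineInverse (opPer (A - B) hAB (sineTransform u))
  rw [← map_sub]
  congr 1
  refine Subtype.ext (funext fun m => ?_)
  change matVec A _ m - matVec B _ m = matVec (A - B) _ m
  obtain ⟨α, hA⟩ := hA
  obtain ⟨β, hB⟩ := hB
  rw [matVec, matVec, matVec,
    ← (hA.summable_mul_vec (sineTransform u).2 m).of_norm.tsum_sub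
      (hB.summable_mul_vec (sineTransform u).2 m).of_norm]
  exact tsum_congr fun n => (sub_mul _ _ _).symm

theorem opSegment_matOne (h : ∃ α, DecayBound α matOne) : opSegment matOne h = LinearMap.id := by
  refine LinearMap.ext fun u => ?_
  change sineInverse (opPer matOne h (sineTransform u)) = u
  conv_rhs => rw [← sineInverse_sineTransform u]
  congr 1
  refine Subtype.ext (funext fun m => ?_)
  rw [opPer_apply, matVec, tsum_eq_single m fun n hn => by simp [matOne, hn.symm]]
  simp [matOne]

/-- An operator with a pair of symbols is determined by the matrix of the periodic symbol. -/
theorem IsOpU.eq_opSegment {a₁ a₂ : ℝ → ℕ → ℂ} {A : UNegInf →ₗ[ℂ] UNegInf} (hA : IsOpU a₁ a₂ A)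
    (h : ∀ n : ℕ, 1 ≤ n → ContDiffOn ℝ ∞ (fun x => a₁ x n) (Icc (-1) 1) ∧
      ContDiffOn ℝ ∞ (fun x => a₂ x n) (Icc (-1) 1))
    (hM : ∃ α, DecayBound α (symbolMatrix (sigmaTilde a₁ a₂))) :
    A = opSegment (symbolMatrix (sigmaTilde a₁ a₂)) hM := by
  refine hA.1.ext (isContinuousOpU_opSegment _ hM) fun k m => ?_
  obtain ⟨h₁, h₂⟩ := h (k + 1) (by omega)
  rw [hA.2, opSegment_basisU, chebCoefU_symbolPair h₁.continuousOn h₂.continuousOn]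

/-! ### The pair of symbols of a periodic operator -/

theorem symbolPer_opPer (M : ℤ → ℤ → ℂ) (hM : ∃ α, DecayBound α M) (θ : ℝ) (n : ℤ) :
    symbolPer (opPer M hM) θ n = matSymbol M θ n := by
  rw [symbolPer, matSymbol, ← (Equiv.addLeft n).tsum_eq, ← tsum_mul_left]
  refine tsum_congr fun l => ?_
  rw [opPer_expPer, Equiv.coe_addLeft, mul_left_comm, ← Complex.exp_add]
  congr 2
  push_cast; ring

theorem symmSymbolPer_opPer {M : ℤ → ℤ → ℂ} (hM : ∃ α, DecayBound α M)
    (hs : IsReflectionInvariant M) (θ : ℝ) (n : ℤ) :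
    symmSymbolPer (opPer M hM) θ n = matSymbol M θ n := by
  rw [symmSymbolPer, symbolPer_opPer, symbolPer_opPer, hs.matSymbol]
  ring

theorem matSymbol_neg {M : ℤ → ℤ → ℂ} (hs : IsReflectionInvariant M) (θ : ℝ) (n : ℤ) :
    matSymbol M θ (-n) = ∑' l : ℤ, M (n + l) n * Complex.exp (-(l * θ * Complex.I)) := by
  have h := hs.matSymbol (-θ) n
  rw [neg_neg] at h
  rw [h, matSymbol]
  refine tsum_congr fun l => ?_
  push_cast
  ring_nf

/-- Euler's formula in Chebyshev form. The even part in θ produces a₁ and the odd part divided by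
sin θ produces a₂, with no singularity at x = ±1. -/
theorem exp_int_mul_eq_chebyshev (θ : ℝ) (l : ℤ) : Complex.exp (l * θ * Complex.I) =
    ((Polynomial.Chebyshev.T ℝ l).eval (Real.cos θ) : ℝ) +
      Complex.I * Real.sin θ * ((Polynomial.Chebyshev.U ℝ (l - 1)).eval (Real.cos θ) : ℝ) := by
  have hU := Polynomial.Chebyshev.U_real_cos θ (l - 1)
  push_cast at hU
  rw [sub_add_cancel] at hU
  have hU' : (((Polynomial.Chebyshev.U ℝ (l - 1)).eval (Real.cos θ) : ℝ) : ℂ) * Real.sin θ =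
      Real.sin (l * θ) := by rw [← Complex.ofReal_mul, hU]
  rw [mul_assoc Complex.I, mul_comm (Real.sin θ : ℂ), hU', Polynomial.Chebyshev.T_real_cos,
    Complex.exp_mul_I]
  push_cast
  ring

theorem exp_neg_int_mul_eq_chebyshev (θ : ℝ) (l : ℤ) : Complex.exp (-(l * θ * Complex.I)) =
    ((Polynomial.Chebyshev.T ℝ l).eval (Real.cos θ) : ℝ) -
      Complex.I * Real.sin θ * ((Polynomial.Chebyshev.U ℝ (l - 1)).eval (Real.cos θ) : ℝ) := by
  have h := exp_int_mul_eq_chebyshev (-θ) l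
  rw [Real.cos_neg, Real.sin_neg] at h
  convert h using 1
  · push_cast; ring_nf
  · push_cast; ring

/-- The Chebyshev series of the first symbol. -/
noncomputable def chebSymbol₁ (M : ℤ → ℤ → ℂ) (x : ℝ) (n : ℤ) : ℂ :=
  ∑' l, M (n + l) n * ((Polynomial.Chebyshev.T ℝ l).eval x : ℝ)

/-- The Chebyshev series of the second symbol. -/
noncomputable def chebSymbol₂ (M : ℤ → ℤ → ℂ) (x : ℝ) (n : ℤ) : ℂ :=
  ∑' l, M (n + l) n * ((Polynomial.Chebyshev.U ℝ (l - 1)).eval x : ℝ)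

theorem IsRapid.summable_of_bound {c : ℤ → ℂ} (hc : IsRapid c) {y : ℤ → ℝ} {D : ℝ} {N : ℕ}
    (hy : ∀ l, |y l| ≤ D * bracket (l : ℝ) ^ N) : Summable fun l => c l * (y l : ℂ) := by
  obtain ⟨C, hC⟩ := hc (2 + N)
  have hD0 : 0 ≤ D := by
    have := (abs_nonneg _).trans (hy 0)
    simpa [bracket_zero] using this
  refine Summable.of_norm (summable_norm_of_bracket (K := C * D) (n := 0) fun l => ?_)
  rw [norm_mul, Complex.norm_real, Real.norm_eq_abs, Int.cast_zero, sub_zero]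
  have hb := pow_nonneg (bracket_nonneg (l : ℝ)) 2
  calc _ ≤ bracket (l : ℝ) ^ 2 * (‖c l‖ * (D * bracket (l : ℝ) ^ N)) := by
        gcongr; exact hy l
    _ = bracket (l : ℝ) ^ (2 + N) * ‖c l‖ * D := by rw [pow_add]; ring
    _ ≤ C * D := mul_le_mul_of_nonneg_right (hC l) hD0

theorem cos_mem_Icc (θ : ℝ) : Real.cos θ ∈ Icc (-1 : ℝ) 1 :=
  ⟨Real.neg_one_le_cos θ, Real.cos_le_one θ⟩

section ChebSymbol

variable {α : ℝ} {M : ℤ → ℤ → ℂ}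

theorem DecayBound.summable_chebSymbol₁ (hM : DecayBound α M) (n : ℤ) {x : ℝ}
    (hx : x ∈ Icc (-1 : ℝ) 1) :
    Summable fun l => M (n + l) n * (((Polynomial.Chebyshev.T ℝ l).eval x : ℝ) : ℂ) :=
  (hM.isRapid n).summable_of_bound fun l => abs_iterate_derivative_chebyshevT_le 0 l hx

theorem DecayBound.summable_chebSymbol₂ (hM : DecayBound α M) (n : ℤ) {x : ℝ}
    (hx : x ∈ Icc (-1 : ℝ) 1) :
    Summable fun l => M (n + l) n * (((Polynomial.Chebyshev.U ℝ (l - 1)).eval x : ℝ) : ℂ) :=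
  (hM.isRapid n).summable_of_bound fun l => abs_iterate_derivative_chebyshevU_le 0 l hx

theorem DecayBound.contDiffOn_chebSymbol₁ (hM : DecayBound α M) (n : ℤ) :
    ContDiffOn ℝ ∞ (fun x => chebSymbol₁ M x n) (Icc (-1) 1) :=
  (hM.isRapid n).contDiffOn_chebyshevT

theorem DecayBound.contDiffOn_chebSymbol₂ (hM : DecayBound α M) (n : ℤ) :
    ContDiffOn ℝ ∞ (fun x => chebSymbol₂ M x n) (Icc (-1) 1) :=
  (hM.isRapid n).contDiffOn_chebyshevU

theorem DecayBound.matSymbol_eq_chebSymbol (hM : DecayBound α M) (θ : ℝ) (n : ℤ) :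
    matSymbol M θ n = chebSymbol₁ M (Real.cos θ) n +
      Complex.I * Real.sin θ * chebSymbol₂ M (Real.cos θ) n := by
  rw [chebSymbol₁, chebSymbol₂, ← tsum_mul_left,
    ← (hM.summable_chebSymbol₁ n (cos_mem_Icc θ)).tsum_add
      ((hM.summable_chebSymbol₂ n (cos_mem_Icc θ)).mul_left _), matSymbol]
  refine tsum_congr fun l => ?_
  rw [exp_int_mul_eq_chebyshev]
  ring

theorem DecayBound.matSymbol_neg_eq_chebSymbol (hM : DecayBound α M)
    (hs : IsReflectionInvariant M) (θ : ℝ) (n : ℤ) :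
    matSymbol M θ (-n) = chebSymbol₁ M (Real.cos θ) n -
      Complex.I * Real.sin θ * chebSymbol₂ M (Real.cos θ) n := by
  rw [chebSymbol₁, chebSymbol₂, ← tsum_mul_left,
    ← (hM.summable_chebSymbol₁ n (cos_mem_Icc θ)).tsum_sub
      ((hM.summable_chebSymbol₂ n (cos_mem_Icc θ)).mul_left _), matSymbol_neg hs]
  refine tsum_congr fun l => ?_
  rw [exp_neg_int_mul_eq_chebyshev]
  ring

theorem symbA1_opPer (hM : DecayBound α M) (hs : IsReflectionInvariant M) {x : ℝ}
    (hx : x ∈ Icc (-1 : ℝ) 1) (n : ℕ) : symbA1 (opPer M ⟨α, hM⟩) x n = chebSymbol₁ M x n := by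
  rw [symbA1, symmSymbolPer_opPer _ hs, symmSymbolPer_opPer _ hs, hM.matSymbol_eq_chebSymbol,
    hM.matSymbol_neg_eq_chebSymbol hs, Real.cos_arccos hx.1 hx.2]
  ring

theorem symbA2_opPer (hM : DecayBound α M) (hs : IsReflectionInvariant M) {x : ℝ}
    (hx : x ∈ Icc (-1 : ℝ) 1) (n : ℕ) : symbA2 (opPer M ⟨α, hM⟩) x n = chebSymbol₂ M x n := by
  refine extendFrom_eq ?_ ?_
  · rwa [closure_Ioo (by norm_num)]
  -- On the open interval the quotient equals the Chebyshev series, which is continuous on [-1, 1]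
  -- and so gives the extension at the endpoints.
  · have h := ((hM.contDiffOn_chebSymbol₂ n).continuousOn x hx).mono Ioo_subset_Icc_self
    refine h.tendsto.congr' ?_
    filter_upwards [self_mem_nhdsWithin] with y hy
    rw [symmSymbolPer_opPer _ hs, symmSymbolPer_opPer _ hs, hM.matSymbol_eq_chebSymbol,
      hM.matSymbol_neg_eq_chebSymbol hs, Real.cos_arccos hy.1.le hy.2.le, Real.sin_arccos]
    have h0 : (Real.sqrt (1 - y ^ 2) : ℂ) ≠ 0 := by
      refine Complex.ofReal_ne_zero.mpr (Real.sqrt_pos.mpr ?_).ne'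
      nlinarith [hy.1, hy.2]
    have hI := Complex.I_ne_zero
    field_simp
    ring

theorem sigmaTilde_opPer (hM : DecayBound α M) (hs : IsReflectionInvariant M) (θ : ℝ) {n : ℤ}
    (hn : n ≠ 0) : sigmaTilde (symbA1 (opPer M ⟨α, hM⟩)) (symbA2 (opPer M ⟨α, hM⟩)) θ n =
      matSymbol M θ n := by
  rw [sigmaTilde, if_neg hn, symbA1_opPer hM hs (cos_mem_Icc θ),
    symbA2_opPer hM hs (cos_mem_Icc θ)]
  rcases hn.lt_or_gt with h | h
  · have h' := hM.matSymbol_neg_eq_chebSymbol hs θ n.natAbs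
    rw [Int.sign_eq_neg_one_of_neg h]
    rw [show -(n.natAbs : ℤ) = n by omega] at h'
    rw [h']
    push_cast; ring
  · have h' := hM.matSymbol_eq_chebSymbol θ n
    rw [Int.sign_eq_one_of_pos h, h', show (n.natAbs : ℤ) = n by omega]
    push_cast; ring

/-- By convention σ̃ vanishes at n = 0, so column 0 of the matrix has to be removed. -/
theorem sigmaTilde_opPer_eq (hM : DecayBound α M) (hs : IsReflectionInvariant M) :
    sigmaTilde (symbA1 (opPer M ⟨α, hM⟩)) (symbA2 (opPer M ⟨α, hM⟩)) =
      matSymbol (M - lowColumns 1 M) := by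
  funext θ n
  by_cases hn : n = 0
  · subst hn
    rw [sigmaTilde, if_pos rfl, matSymbol]
    simp [lowColumns]
  · have h1 : ¬ n.natAbs < 1 := by omega
    rw [sigmaTilde_opPer hM hs θ hn, matSymbol, matSymbol]
    simp [lowColumns, h1]

end ChebSymbol

/-- The pair of symbols of a periodic operator is a pair of symbols of the corresponding operator
on the segment. -/
theorem memSU_opPer {α β : ℝ} {M : ℤ → ℤ → ℂ} (hM : IsPDMatrix α M) (hd : DecayBound β M)
    (hs : IsReflectionInvariant M) :
    MemSU α (symbA1 (opPer M ⟨β, hd⟩)) (symbA2 (opPer M ⟨β, hd⟩)) := by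
  refine ⟨fun n _ => ⟨?_, ?_⟩, ?_⟩
  · exact (hd.contDiffOn_chebSymbol₁ n).congr fun x hx => symbA1_opPer hd hs hx n
  · exact (hd.contDiffOn_chebSymbol₂ n).congr fun x hx => symbA2_opPer hd hs hx n
  · rw [sigmaTilde_opPer_eq hd hs]
    exact (hM.sub (hM.lowColumns 1 α)).matSymbol_mem

theorem isOpU_opSegment {β : ℝ} {M : ℤ → ℤ → ℂ} (hd : DecayBound β M)
    (hs : IsReflectionInvariant M) :
    IsOpU (symbA1 (opPer M ⟨β, hd⟩)) (symbA2 (opPer M ⟨β, hd⟩)) (opSegment M ⟨β, hd⟩) := by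
  refine ⟨isContinuousOpU_opSegment _ _, fun k m => ?_⟩
  rw [chebCoefU_symbolPair, opSegment_basisU, sigmaTilde_opPer_eq hd hs,
    symbolMatrix_matSymbol (hd.sub (hd.lowColumns 1 β).decayBound)]
  -- Only the columns ±(k + 1) act on the sine transform of U_k, so the removal of column 0 is not
  -- felt.
  · have h1 : ¬ ((k : ℤ) + 1).natAbs < 1 := by omega
    have h2 : ¬ (-((k : ℤ) + 1)).natAbs < 1 := by omega
    simp only [Pi.sub_apply, lowColumns, if_neg h1, if_neg h2, sub_zero]
  · exact (hd.contDiffOn_chebSymbol₁ (k + 1 : ℕ)).continuousOn.congr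
      fun x hx => symbA1_opPer hd hs hx _
  · exact (hd.contDiffOn_chebSymbol₂ (k + 1 : ℕ)).continuousOn.congr
      fun x hx => symbA2_opPer hd hs hx _

/-! ### Operators on the curve -/

namespace SmoothOpenCurve

variable (Γ : SmoothOpenCurve)

theorem toSegment_comp (A B : Γ.UNegInf →ₗ[ℂ] Γ.UNegInf) :
    Γ.toSegment (A ∘ₗ B) = Γ.toSegment A ∘ₗ Γ.toSegment B := by
  refine LinearMap.ext fun u => ?_
  simp [toSegment]

theorem toSegment_sub (A B : Γ.UNegInf →ₗ[ℂ] Γ.UNegInf) :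
    Γ.toSegment (A - B) = Γ.toSegment A - Γ.toSegment B := by
  refine LinearMap.ext fun u => ?_
  simp [toSegment]

theorem toSegment_id : Γ.toSegment LinearMap.id = LinearMap.id := by
  refine LinearMap.ext fun u => ?_
  simp [toSegment]

theorem exists_toSegment_eq (T : _root_.UNegInf →ₗ[ℂ] _root_.UNegInf) :
    ∃ A : Γ.UNegInf →ₗ[ℂ] Γ.UNegInf, Γ.toSegment A = T := by
  refine ⟨Γ.pullbackNegInf.symm.toLinearMap ∘ₗ T ∘ₗ Γ.pullbackNegInf.toLinearMap, ?_⟩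
  refine LinearMap.ext fun u => ?_
  simp [toSegment]

variable {Γ}

theorem IsSymbolPair.decayBound {α : ℝ} {a₁ a₂ : ℝ → ℕ → ℂ} {A : Γ.UNegInf →ₗ[ℂ] Γ.UNegInf}
    (h : Γ.IsSymbolPair α a₁ a₂ A) : DecayBound α (symbolMatrix (sigmaTilde a₁ a₂)) :=
  (isPDMatrix_symbolMatrix h.1.2).decayBound

theorem IsSymbolPair.toSegment_eq {α : ℝ} {a₁ a₂ : ℝ → ℕ → ℂ} {A : Γ.UNegInf →ₗ[ℂ] Γ.UNegInf}
    (h : Γ.IsSymbolPair α a₁ a₂ A) :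
    Γ.toSegment A = opSegment (symbolMatrix (sigmaTilde a₁ a₂)) ⟨α, h.decayBound⟩ :=
  h.2.eq_opSegment h.1.1 _

/-- The exponent β merely certifies that the operator exists, while α is the order obtained. Keeping
them apart lets one pair of symbols serve for every order in `mem_opSUNegInf_of_toSegment_eq`. -/
theorem isSymbolPair_of_toSegment_eq {α β : ℝ} {M : ℤ → ℤ → ℂ} (hM : IsPDMatrix α M)
    (hd : DecayBound β M) (hs : IsReflectionInvariant M) {A : Γ.UNegInf →ₗ[ℂ] Γ.UNegInf}
    (hA : Γ.toSegment A = opSegment M ⟨β, hd⟩) :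
    Γ.IsSymbolPair α (symbA1 (opPer M ⟨β, hd⟩)) (symbA2 (opPer M ⟨β, hd⟩)) A := by
  refine ⟨memSU_opPer hM hd hs, ?_⟩
  rw [hA]
  exact isOpU_opSegment hd hs

theorem mem_opSU_of_toSegment_eq {α β : ℝ} {M : ℤ → ℤ → ℂ} (hM : IsPDMatrix α M)
    (hd : DecayBound β M) (hs : IsReflectionInvariant M) {A : Γ.UNegInf →ₗ[ℂ] Γ.UNegInf}
    (hA : Γ.toSegment A = opSegment M ⟨β, hd⟩) : A ∈ Γ.OpSU α :=
  ⟨_, _, isSymbolPair_of_toSegment_eq hM hd hs hA⟩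

theorem mem_opSUNegInf_of_toSegment_eq {β : ℝ} {M : ℤ → ℤ → ℂ} (hM : IsSmoothingMatrix M)
    (hd : DecayBound β M) (hs : IsReflectionInvariant M) {A : Γ.UNegInf →ₗ[ℂ] Γ.UNegInf}
    (hA : Γ.toSegment A = opSegment M ⟨β, hd⟩) : A ∈ Γ.OpSUNegInf :=
  ⟨_, _, fun α => isSymbolPair_of_toSegment_eq (hM α) hd hs hA⟩

theorem bound_of_mem_opSU {α : ℝ} {A : Γ.UNegInf →ₗ[ℂ] Γ.UNegInf} (hA : A ∈ Γ.OpSU α) (s : ℝ) :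
    ∃ C : ℝ, ∀ u : Γ.UNegInf, u.1 ∈ Γ.USpace s →
      (A u).1 ∈ Γ.USpace (s - α) ∧ Γ.normU (s - α) (A u).1 ≤ C * Γ.normU s u.1 := by
  obtain ⟨a₁, a₂, h⟩ := hA
  obtain ⟨C, hC⟩ := opSegment_bound h.decayBound s
  refine ⟨C, fun u hu => ?_⟩
  obtain ⟨h1, h2⟩ := hC (Γ.pullbackNegInf u) hu
  have e : opSegment (symbolMatrix (sigmaTilde a₁ a₂)) ⟨α, h.decayBound⟩ (Γ.pullbackNegInf u) =
      Γ.pullbackNegInf (A u) := by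
    rw [← h.toSegment_eq]
    simp [toSegment]
  rw [e] at h1 h2
  refine ⟨h1, ?_⟩
  calc Γ.normU (s - α) (A u).1
      = Real.sqrt (Γ.length ^ 2 / 2) * _root_.normU (s - α) (Γ.pullbackNegInf (A u)).1 := rfl
    _ ≤ Real.sqrt (Γ.length ^ 2 / 2) * (C * _root_.normU s (Γ.pullbackNegInf u).1) :=
        mul_le_mul_of_nonneg_left h2 (Real.sqrt_nonneg _)
    _ = C * (Real.sqrt (Γ.length ^ 2 / 2) * _root_.normU s (Γ.pullbackNegInf u).1) := by ring

theorem IsSymbolPair.comp {α β : ℝ} {a₁ a₂ b₁ b₂ : ℝ → ℕ → ℂ}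
    {A B : Γ.UNegInf →ₗ[ℂ] Γ.UNegInf} (hA : Γ.IsSymbolPair α a₁ a₂ A)
    (hB : Γ.IsSymbolPair β b₁ b₂ B) :
    ∃ At Bt : HPerNegInf →ₗ[ℂ] HPerNegInf,
      IsOpPer (sigmaTilde a₁ a₂) At ∧ IsOpPer (sigmaTilde b₁ b₂) Bt ∧
      Γ.IsSymbolPair (α + β) (symbA1 (At ∘ₗ Bt)) (symbA2 (At ∘ₗ Bt)) (A ∘ₗ B) := by
  refine ⟨opPer _ ⟨α, hA.decayBound⟩, opPer _ ⟨β, hB.decayBound⟩, isOpPer_opPer _ _,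
    isOpPer_opPer _ _, ?_⟩
  have hd := hA.decayBound.matMul hB.decayBound
  have hsB := isReflectionInvariant_symbolMatrix_sigmaTilde b₁ b₂
  rw [opPer_comp _ _ ⟨_, hd⟩]
  refine isSymbolPair_of_toSegment_eq
    ((isPDMatrix_symbolMatrix hA.1.2).matMul (isPDMatrix_symbolMatrix hB.1.2)) hd
    ((isReflectionInvariant_symbolMatrix_sigmaTilde a₁ a₂).matMul hsB) ?_
  rw [toSegment_comp, hA.toSegment_eq, hB.toSegment_eq, opSegment_comp _ _ hsB ⟨_, hd⟩]

theorem commutator_mem_opSU {α β : ℝ} {A B : Γ.UNegInf →ₗ[ℂ] Γ.UNegInf} (hA : A ∈ Γ.OpSU α)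
    (hB : B ∈ Γ.OpSU β) : A ∘ₗ B - B ∘ₗ A ∈ Γ.OpSU (α + β - 1) := by
  obtain ⟨a₁, a₂, hA⟩ := hA
  obtain ⟨b₁, b₂, hB⟩ := hB
  have hsA := isReflectionInvariant_symbolMatrix_sigmaTilde a₁ a₂
  have hsB := isReflectionInvariant_symbolMatrix_sigmaTilde b₁ b₂
  have hcomm := (isPDMatrix_symbolMatrix hA.1.2).commutator (isPDMatrix_symbolMatrix hB.1.2)
  refine mem_opSU_of_toSegment_eq hcomm hcomm.decayBound
    ((hsA.matMul hsB).sub (hsB.matMul hsA)) ?_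
  rw [toSegment_sub, toSegment_comp, toSegment_comp, hA.toSegment_eq, hB.toSegment_eq,
    opSegment_comp _ _ hsB ⟨_, hA.decayBound.matMul hB.decayBound⟩,
    opSegment_comp _ _ hsA ⟨_, hB.decayBound.matMul hA.decayBound⟩,
    opSegment_sub _ _ ⟨_, hcomm.decayBound⟩]

end SmoothOpenCurve

/-! ### Transfer of ellipticity through the sine transform. -/

/-- The symbol of a matrix with `D(m, n) = D(m, -n)` is of lower order. -/
theorem DecayBound.norm_matSymbol_le_of_even {α : ℝ} {D : ℤ → ℤ → ℂ} (hD : DecayBound α D)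
    (hev : ∀ m n : ℤ, n ≠ 0 → D m n = D m (-n)) : ∃ C : ℝ, ∀ (θ : ℝ) (n : ℤ), n ≠ 0 →
      ‖matSymbol D θ n‖ ≤ C * bracket (n : ℝ) ^ (α - 1) := by
  -- By evenness the decay bound holds with the offsets l and l + 2n. One of 1 + |l| and 1 + |l +
  -- 2n| is at least 1 + |n|, so one of the three powers yields the factor (1 + |n|)⁻¹ and two
  -- remain for summability.
  obtain ⟨C, hC⟩ := hD 3
  have hC0 := DecayBound.const_nonneg hC
  refine ⟨C * bracketSum, fun θ n hn => ?_⟩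
  have hbr : ∀ l : ℤ, bracket ((l : ℝ) - (0 : ℤ)) ^ 2 *
      ‖D (n + l) n * Complex.exp (l * θ * Complex.I)‖ ≤ C * bracket (n : ℝ) ^ (α - 1) := by
    intro l
    rw [norm_mul, norm_exp_int_mul_I, mul_one, Int.cast_zero, sub_zero]
    have h1 := hC (n + l) n
    have h2 := hC (n + l) (-n)
    rw [← hev _ _ hn] at h2
    push_cast at h1 h2
    rw [add_sub_cancel_left] at h1
    rw [bracket_neg, show (n : ℝ) + l - -n = l + 2 * n by ring] at h2
    set d := ‖D (n + l) n‖ with hd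
    set W := bracket (n : ℝ) ^ α with hW
    have hsplit : bracket (n : ℝ) ^ (α - 1) = W * (bracket (n : ℝ))⁻¹ := by
      rw [hW, Real.rpow_sub_one (bracket_pos _).ne', div_eq_mul_inv]
    rw [hsplit, ← mul_assoc, ← div_eq_mul_inv, le_div_iff₀ (bracket_pos _)]
    have hd0 : 0 ≤ d := norm_nonneg _
    have hl0 := bracket_nonneg (l : ℝ)
    have hn0 := bracket_nonneg (n : ℝ)
    rcases le_total (bracket (n : ℝ)) (bracket (l : ℝ)) with h | h
    · calc bracket (l : ℝ) ^ 2 * d * bracket (n : ℝ)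
          ≤ bracket (l : ℝ) ^ 2 * d * bracket (l : ℝ) := by gcongr
        _ = bracket (l : ℝ) ^ 3 * d := by ring
        _ ≤ C * W := h1
    · have h3 : bracket (n : ℝ) ≤ bracket ((l : ℝ) + 2 * n) := by
        unfold bracket at h ⊢
        have h4 : |2 * (n : ℝ)| ≤ |(l : ℝ) + 2 * n| + |(l : ℝ)| := by
          have := abs_sub ((l : ℝ) + 2 * n) l
          simpa using this
        rw [abs_mul, abs_two] at h4
        linarith
      calc bracket (l : ℝ) ^ 2 * d * bracket (n : ℝ)
          ≤ bracket ((l : ℝ) + 2 * n) ^ 2 * d * bracket ((l : ℝ) + 2 * n) := by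
            have := h.trans h3
            gcongr
        _ = bracket ((l : ℝ) + 2 * n) ^ 3 * d := by ring
        _ ≤ C * W := h2
  calc ‖matSymbol D θ n‖ ≤ C * bracket (n : ℝ) ^ (α - 1) * bracketSum :=
        norm_tsum_le_of_bracket hbr
    _ = _ := by ring

/-- Intertwining only sees the combinations M(m, k+1) - M(m, -(k+1)), so the difference of the two
matrices is even in its column index away from column 0. Its symbol then has order α - 1, and
ellipticity passes from σ to σ̃. -/
theorem isEllipticSymbol_of_intertwining {α : ℝ} {a₁ a₂ : ℝ → ℕ → ℂ}
    (ha : sigmaTilde a₁ a₂ ∈ SigmaClass α) (hM : ∃ γ, DecayBound γ (symbolMatrix (sigmaTilde a₁ a₂)))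
    {σ : ℝ → ℤ → ℂ} (hσ : σ ∈ SigmaClass α) (hell : IsEllipticSymbol α σ)
    {At : HPerNegInf →ₗ[ℂ] HPerNegInf} (hAt : IsOpPer σ At)
    (h : ∀ k : ℕ, sineTransform (opSegment (symbolMatrix (sigmaTilde a₁ a₂)) hM (basisU k)) =
      At (sineTransform (basisU k))) :
    IsEllipticSymbol α (sigmaTilde a₁ a₂) := by
  set M := symbolMatrix (sigmaTilde a₁ a₂) with hMdef
  set N := symbolMatrix σ with hNdef
  have hMP : IsPDMatrix α M := isPDMatrix_symbolMatrix ha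
  have hNP : IsPDMatrix α N := isPDMatrix_symbolMatrix hσ
  have hAt' : At = opPer N ⟨α, hNP.decayBound⟩ := by
    refine LinearMap.ext fun u => Subtype.ext (funext fun m => ?_)
    rw [hAt.apply_eq, opPer_apply]
  have hs : IsReflectionInvariant M := isReflectionInvariant_symbolMatrix_sigmaTilde a₁ a₂
  have hk : ∀ (k : ℕ) (m : ℤ), M m (k + 1) - M m (-(k + 1)) = N m (k + 1) - N m (-(k + 1)) := by
    intro k m
    have h1 := congrArg (fun v : HPerNegInf => v.1 m)
      ((sineTransform_opSegment hM hs (basisU k)).symm.trans (h k))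
    simp only [hAt', opPer_sineTransform_basisU] at h1
    exact mul_left_cancel₀ (inv_ne_zero (mul_ne_zero two_ne_zero Complex.I_ne_zero)) h1
  have hev : ∀ m n : ℤ, n ≠ 0 → (M - N) m n = (M - N) m (-n) := by
    have hpos : ∀ (k : ℕ) (m : ℤ), (M - N) m (k + 1) = (M - N) m (-(k + 1)) := fun k m => by
      simp only [Pi.sub_apply]
      linear_combination hk k m
    intro m n hn
    rcases hn.lt_or_gt with h | h
    · obtain ⟨k, hk⟩ : ∃ k : ℕ, n = -((k : ℤ) + 1) := ⟨(-n - 1).toNat, by omega⟩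
      rw [hk, neg_neg, hpos]
    · obtain ⟨k, hk⟩ : ∃ k : ℕ, n = (k : ℤ) + 1 := ⟨(n - 1).toNat, by omega⟩
      rw [hk, hpos]
  obtain ⟨C, hC⟩ := (hMP.sub hNP).decayBound.norm_matSymbol_le_of_even hev
  refine hell.of_sub_le (D := C) fun θ n hn => ?_
  have h1 := matSymbol_add (hMP.sub hNP).decayBound hNP.decayBound θ n
  rw [sub_add_cancel, hMdef, hNdef, matSymbol_symbolMatrix_of_mem ha,
    matSymbol_symbolMatrix_of_mem hσ] at h1
  rw [h1, add_sub_cancel_right]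
  exact hC θ n hn

namespace SmoothOpenCurve

variable {Γ : SmoothOpenCurve}

theorem basisU_mem_USpace (k : ℕ) (s : ℝ) : (basisU k).1 ∈ _root_.USpace s := by
  refine summable_of_ne_finset_zero (s := {k}) fun i hi => ?_
  have hik : i ≠ k := by simpa using hi
  have : (basisU k).1 i = 0 := Pi.single_eq_of_ne hik 1
  rw [this, norm_zero, zero_pow two_ne_zero, mul_zero]

theorem isEllipticU_iff {α : ℝ} {A : Γ.UNegInf →ₗ[ℂ] Γ.UNegInf} (hA : A ∈ Γ.OpSU α) :
    Γ.IsEllipticU α A ↔ ∃ At : HPerNegInf →ₗ[ℂ] HPerNegInf, IsEllipticPPDO α At ∧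
      ∀ u : _root_.UNegInf, (∀ s : ℝ, u.1 ∈ _root_.USpace s) →
        sineTransform (Γ.toSegment A u) = At (sineTransform u) := by
  constructor
  · rintro ⟨a₁, a₂, h, hell⟩
    refine ⟨opPer _ ⟨α, h.decayBound⟩, ⟨_, h.1.2, isOpPer_opPer _ _, hell⟩, fun u _ => ?_⟩
    rw [h.toSegment_eq]
    exact sineTransform_opSegment _ (isReflectionInvariant_symbolMatrix_sigmaTilde a₁ a₂) u
  · rintro ⟨At, ⟨σ, hσ, hAt, hell⟩, hu⟩
    obtain ⟨a₁, a₂, h⟩ := hA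
    refine ⟨a₁, a₂, h, isEllipticSymbol_of_intertwining h.1.2 ⟨α, h.decayBound⟩ hσ hell hAt
      fun k => ?_⟩
    rw [← h.toSegment_eq]
    -- Intertwining on U^∞ enters only through its instances at the basis elements.
    exact hu _ (basisU_mem_USpace k)

theorem IsEllipticU.exists_parametrix {α : ℝ} {A : Γ.UNegInf →ₗ[ℂ] Γ.UNegInf}
    (hA : Γ.IsEllipticU α A) :
    ∃ B : Γ.UNegInf →ₗ[ℂ] Γ.UNegInf, B ∈ Γ.OpSU (-α) ∧ Γ.IsEllipticU (-α) B ∧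
      B ∘ₗ A - LinearMap.id ∈ Γ.OpSUNegInf ∧ A ∘ₗ B - LinearMap.id ∈ Γ.OpSUNegInf := by
  obtain ⟨a₁, a₂, h, hell⟩ := hA
  have hs := isReflectionInvariant_symbolMatrix_sigmaTilde a₁ a₂
  have hM := isPDMatrix_symbolMatrix h.1.2
  obtain ⟨N, hN, hNs, hNell, hl, hr⟩ := _root_.exists_parametrix hM hs
    (by rwa [matSymbol_symbolMatrix_of_mem h.1.2])
  obtain ⟨B, hB⟩ := Γ.exists_toSegment_eq (opSegment N ⟨-α, hN.decayBound⟩)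
  have hpair := isSymbolPair_of_toSegment_eq hN hN.decayBound hNs hB
  have hone : IsReflectionInvariant matOne := IsReflectionInvariant.matOne
  -- The symbol built from the pair agrees with that of N for all n ≠ 0, so ellipticity transfers
  -- with perturbation constant 0.
  refine ⟨B, ⟨_, _, hpair⟩, ⟨_, _, hpair, hNell.of_sub_le (D := 0) fun θ n hn => ?_⟩, ?_, ?_⟩
  · rw [sigmaTilde_opPer hN.decayBound hNs θ hn, sub_self, norm_zero, zero_mul]
  · refine mem_opSUNegInf_of_toSegment_eq hl (hl 0).decayBound ((hNs.matMul hs).sub hone) ?_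
    rw [toSegment_sub, toSegment_comp, toSegment_id, hB, h.toSegment_eq,
      opSegment_comp _ _ hs ⟨_, (hN.matMul hM).decayBound⟩,
      ← opSegment_matOne ⟨0, isPDMatrix_matOne.decayBound⟩, opSegment_sub]
  · refine mem_opSUNegInf_of_toSegment_eq hr (hr 0).decayBound ((hs.matMul hNs).sub hone) ?_
    rw [toSegment_sub, toSegment_comp, toSegment_id, hB, h.toSegment_eq,
      opSegment_comp _ _ hNs ⟨_, (hM.matMul hN).decayBound⟩,
      ← opSegment_matOne ⟨0, isPDMatrix_matOne.decayBound⟩, opSegment_sub]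

end SmoothOpenCurve

theorem mainTheorem9 (Γ : SmoothOpenCurve) :
    -- continuity on the scale
    (∀ (α : ℝ) (A : Γ.UNegInf →ₗ[ℂ] Γ.UNegInf), A ∈ Γ.OpSU α →
      ∀ s : ℝ, ∃ C : ℝ, ∀ u : Γ.UNegInf, u.1 ∈ Γ.USpace s →
        (A u).1 ∈ Γ.USpace (s - α) ∧ Γ.normU (s - α) (A u).1 ≤ C * Γ.normU s u.1) ∧
    -- composition
    (∀ (α β : ℝ) (A B : Γ.UNegInf →ₗ[ℂ] Γ.UNegInf), A ∈ Γ.OpSU α → B ∈ Γ.OpSU β →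
      A ∘ₗ B ∈ Γ.OpSU (α + β)) ∧
    -- symbol of a composition
    (∀ (α β : ℝ) (A B : Γ.UNegInf →ₗ[ℂ] Γ.UNegInf) (a₁ a₂ b₁ b₂ : ℝ → ℕ → ℂ),
      Γ.IsSymbolPair α a₁ a₂ A → Γ.IsSymbolPair β b₁ b₂ B →
      ∃ At Bt : HPerNegInf →ₗ[ℂ] HPerNegInf,
        IsOpPer (sigmaTilde a₁ a₂) At ∧ IsOpPer (sigmaTilde b₁ b₂) Bt ∧
        Γ.IsSymbolPair (α + β) (symbA1 (At ∘ₗ Bt)) (symbA2 (At ∘ₗ Bt)) (A ∘ₗ B)) ∧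
    -- commutator
    (∀ (α β : ℝ) (A B : Γ.UNegInf →ₗ[ℂ] Γ.UNegInf), A ∈ Γ.OpSU α → B ∈ Γ.OpSU β →
      A ∘ₗ B - B ∘ₗ A ∈ Γ.OpSU (α + β - 1)) ∧
    -- ellipticity through the sine transform, and parametrix
    (∀ (α : ℝ) (A : Γ.UNegInf →ₗ[ℂ] Γ.UNegInf), A ∈ Γ.OpSU α →
      (Γ.IsEllipticU α A ↔
        ∃ At : HPerNegInf →ₗ[ℂ] HPerNegInf, IsEllipticPPDO α At ∧
          ∀ u : UNegInf, (∀ s : ℝ, u.1 ∈ USpace s) →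
            sineTransform (Γ.toSegment A u) = At (sineTransform u)) ∧
      (Γ.IsEllipticU α A →
        ∃ B : Γ.UNegInf →ₗ[ℂ] Γ.UNegInf, B ∈ Γ.OpSU (-α) ∧ Γ.IsEllipticU (-α) B ∧
          B ∘ₗ A - LinearMap.id ∈ Γ.OpSUNegInf ∧ A ∘ₗ B - LinearMap.id ∈ Γ.OpSUNegInf)) := by
  refine ⟨fun α A hA s => SmoothOpenCurve.bound_of_mem_opSU hA s, ?_,
    fun α β A B a₁ a₂ b₁ b₂ hA hB => hA.comp hB,
    fun α β A B hA hB => SmoothOpenCurve.commutator_mem_opSU hA hB,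
    fun α A hA => ⟨SmoothOpenCurve.isEllipticU_iff hA, fun h => h.exists_parametrix⟩⟩
  -- Membership of the composition in its class follows from the explicit pair of symbols of the
  -- composition.
  rintro α β A B ⟨a₁, a₂, hA⟩ ⟨b₁, b₂, hB⟩
  obtain ⟨At, Bt, -, -, h⟩ := hA.comp hB
  exact ⟨_, _, h⟩
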